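/- Work in Euclidean 3-space with isometries including reflections, and let all edges have length $1$. Let $\alpha_3,\beta_3,\gamma_3$ be the regular tetrahedron, regular octahedron and cube, and $\mathrm{Prism}_3$ the semiregular triangular prism. A partition is *normal* if it is a locally finite face-to-face tiling by convex polyhedra. A convex polyhedron is *uniform* if all its faces are regular polygons and its symmetry group is vertex-transitive (Platonic and Archimedean polyhedra, including semiregular prisms and antiprisms). The *Delaunay star* of a vertex is the set of all cells containing it; two stars are congruent if some isometry maps one to the other and the central vertex to the central vertex. A normal partition into uniform polyhedra is *almost-uniform* if its symmetry group is not transitive on vertices but the Delaunay stars (vertex figures) of all its vertices are congruent. A partition is *periodic* if its translational symmetries span $\mathbb R^3$, and *aperiodic* otherwise. An *$(a,b)$-sequence* is a map $w:\mathbb Z\to\{a,b\}$; it is periodic if $w(i+p)=w(i)$ for all $i$, for some integer $p\ne 0$. *Elongated Kelvin partition of $w$.* Let $\Lambda$ be the horizontal triangular lattice generated by $e_1=(1,0,0)$, $e_2=(\tfrac12,\tfrac{\sqrt3}{2},0)$, let $\delta=(e_1+e_2)/3$, and let $h=\sqrt{2/3}$ be the height of $\alpha_3$. Layers of $\alpha_3$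 and $\beta_3$ of thickness $h$ alternate with layers of upright $\mathrm{Prism}_3$ of thickness $1$. The $n$-th layer ($n\in\mathbb Z$) of $\alpha_3$ and $\beta_3$ is the usual filling by regular tetrahedra and octahedra of the slab between a translate $L$ of $\Lambda$ and $L\pm\delta+h(0,0,1)$, with $+$ if $w(n)=a$ and $-$ if $w(n)=b$; it is followed by a layer of prisms over the unit triangles of the upper lattice. The layer $n=0$ starts at $L=\Lambda$. The partition and $w$ are *proper* if $w$ is neither constant nor alternating (that is, the two cases $\dots aaa\dots$ (or $\dots bbb\dots$), elongated fcc, and $\dots ababab\dots$, elongated hcp, are excluded). *Elongated Grünbaum partition of $w$.* Layers of lying $\mathrm{Prism}_3$ of thickness $\sqrt3/2$ alternate with layers of $\gamma_3$ of thickness $1$. In each prism layer the prisms have parallel horizontal heights along one of the two generating directions of a horizontal unit square lattice; the layer is bounded by a translate $L$ of $\mathbb Z^2$ below and, above, by $L$ shifted by half a unit perpendicularly to these heights (and raised by $\sqrt3/2$); then follow the unit cubes over the squares of the upper lattice. The heights in the $n$-th and $(n+1)$-st prism layers are parallel if $w(n)=a$ and perpendicular if $w(n)=b$. The $0$-th prism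 layer starts at $L=\mathbb Z^2$ at height $0$ and has heights parallel to $(0,1,0)$. The partition and $w$ are *proper* if $w$ is not constant. **Theorem.** For each of the two families (elongated Kelvin and elongated Grünbaum): 1. Different $(a,b)$-sequences give different partitions. 2. For every proper $w$, the partition of $w$ has only cells $\alpha_3,\beta_3,\mathrm{Prism}_3$ (Kelvin), respectively $\mathrm{Prism}_3,\gamma_3$ (Grünbaum), and is almost-uniform. The Delaunay star of each vertex consists of $6$ $\mathrm{Prism}_3$, $4$ $\alpha_3$ and $3$ $\beta_3$ (Kelvin), respectively of $4$ $\gamma_3$ and $6$ $\mathrm{Prism}_3$ (Grünbaum). Moreover the stars of any two vertices in any two proper partitions of the same family are congruent. 3. For proper $w$, the partition is periodic if and only if $w$ is periodic. 4. Up to congruence, there are exactly $\aleph_0$ periodic proper partitions and exactly $2^{\aleph_0}$ aperiodic proper partitions in the family. In particular, there is a continuum of pairwise non-congruent aperiodic tilings of 3-space with a single Delaunay star. -/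

import Mathlib

namespace LayeredTiling

noncomputable section

/-- Euclidean 3-space. -/
abbrev Space : Type := EuclideanSpace ℝ (Fin 3)

/-! ### Polyhedra -/

/-- A convex polyhedron: the convex hull of finitely many points, with nonempty interior. -/
def IsPolyhedron (P : Set Space) : Prop :=
  (∃ s : Set Space, s.Finite ∧ P = convexHull ℝ s) ∧ (interior P).Nonempty

/-- `F` is a (convex, filled) regular `n`-gon for some `n ≥ 3`. -/
def IsRegularPolygon (F : Set Space) : Prop :=
  ∃ n : ℕ, 3 ≤ n ∧ ∃ (c u v : Space) (r : ℝ),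
    0 < r ∧ ‖u‖ = 1 ∧ ‖v‖ = 1 ∧ inner ℝ u v = 0 ∧
    F = convexHull ℝ (Set.range fun k : Fin n =>
      c + r • (Real.cos (2 * Real.pi * (k : ℝ) / (n : ℝ)) • u
        + Real.sin (2 * Real.pi * (k : ℝ) / (n : ℝ)) • v))

/-- A uniform polyhedron (Platonic or Archimedean solid, including semiregular prisms and
antiprisms): all two-dimensional faces are regular polygons, and the symmetry group is transitive
on the vertices. -/
def IsUniformPolyhedron (P : Set Space) : Prop :=
  IsPolyhedron P ∧
  (∀ F : Set Space, IsExposed ℝ P F → Module.finrank ℝ (vectorSpan ℝ F) = 2 →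
    IsRegularPolygon F) ∧
  (∀ x ∈ P.extremePoints ℝ, ∀ y ∈ P.extremePoints ℝ,
    ∃ g : Space ≃ᵃⁱ[ℝ] Space, g '' P = P ∧ g x = y)

/-- A regular tetrahedron with unit edges. -/
def IsRegularTetrahedron (P : Set Space) : Prop :=
  ∃ p : Fin 4 → Space, (∀ i j, i ≠ j → dist (p i) (p j) = 1) ∧
    P = convexHull ℝ (Set.range p)

/-- A regular octahedron with unit edges. -/
def IsRegularOctahedron (P : Set Space) : Prop :=
  ∃ (c : Space) (u : Fin 3 → Space), Orthonormal ℝ u ∧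
    P = convexHull ℝ ((Set.range fun i => c + (1 / Real.sqrt 2) • u i) ∪
      (Set.range fun i => c - (1 / Real.sqrt 2) • u i))

/-- A semiregular triangular prism with unit edges. -/
def IsTriangularPrism (P : Set Space) : Prop :=
  ∃ (p : Fin 3 → Space) (a : Space), (∀ i j, i ≠ j → dist (p i) (p j) = 1) ∧
    ‖a‖ = 1 ∧ (∀ i j, inner ℝ a (p i - p j) = 0) ∧
    P = convexHull ℝ (Set.range p ∪ Set.range fun i => p i + a)

/-- A cube with unit edges. -/
def IsCube (P : Set Space) : Prop :=
  ∃ (c : Space) (u : Fin 3 → Space), Orthonormal ℝ u ∧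
    P = convexHull ℝ (Set.range fun s : Finset (Fin 3) => c + ∑ i ∈ s, u i)

/-! ### Partitions of space -/

/-- A normal partition of space: a locally finite, face-to-face tiling by convex polyhedra. -/
def IsNormalPartition (T : Set (Set Space)) : Prop :=
  (∀ P ∈ T, IsPolyhedron P) ∧
  ⋃₀ T = Set.univ ∧
  (∀ P ∈ T, ∀ Q ∈ T, P ≠ Q → Disjoint (interior P) (interior Q)) ∧
  (∀ (x : Space) (r : ℝ), {P ∈ T | (P ∩ Metric.closedBall x r).Nonempty}.Finite) ∧
  (∀ P ∈ T, ∀ Q ∈ T, IsExposed ℝ P (P ∩ Q))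

/-- The image of a family of cells under an isometry of space. -/
def moved (g : Space ≃ᵃⁱ[ℝ] Space) (T : Set (Set Space)) : Set (Set Space) :=
  (fun P : Set Space => g '' P) '' T

/-- The vertices of a partition: all vertices of its cells. -/
def vertices (T : Set (Set Space)) : Set Space :=
  {v | ∃ P ∈ T, v ∈ P.extremePoints ℝ}

/-- The (Delaunay) star of a vertex: all cells that contain it. -/
def delaunayStar (T : Set (Set Space)) (v : Space) : Set (Set Space) :=
  {P ∈ T | v ∈ P}

/-- The star of `v` in `T` is congruent to the star of `v'` in `T'`, with `v` going to `v'`. -/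
def StarsCongruent (T : Set (Set Space)) (v : Space) (T' : Set (Set Space)) (v' : Space) : Prop :=
  ∃ g : Space ≃ᵃⁱ[ℝ] Space, g v = v' ∧ moved g (delaunayStar T v) = delaunayStar T' v'

/-- The symmetry group of the partition acts transitively on its vertices. -/
def IsVertexTransitive (T : Set (Set Space)) : Prop :=
  ∀ v ∈ vertices T, ∀ v' ∈ vertices T, ∃ g : Space ≃ᵃⁱ[ℝ] Space, moved g T = T ∧ g v = v'

/-- An almost-uniform partition. -/
def IsAlmostUniform (T : Set (Set Space)) : Prop :=
  IsNormalPartition T ∧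
  (∀ P ∈ T, IsUniformPolyhedron P) ∧
  ¬ IsVertexTransitive T ∧
  (∀ v ∈ vertices T, ∀ v' ∈ vertices T, StarsCongruent T v T v')

/-- A periodic partition: its translational symmetries span space (that is, it has three linearly
independent translational symmetries). A partition is aperiodic if it is not periodic. -/
def IsPeriodic (T : Set (Set Space)) : Prop :=
  Submodule.span ℝ
    {t : Space | moved (AffineIsometryEquiv.constVAdd ℝ Space t) T = T} = ⊤

/-- The class of all families of cells congruent to `T`. -/
def congruenceClass (T : Set (Set Space)) : Set (Set (Set Space)) :=
  {T' | ∃ g : Space ≃ᵃⁱ[ℝ] Space, T' = moved g T}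

/-! ### Two-sided infinite words -/

inductive Letter : Type
  | a
  | b

/-- `(a,b)`-sequences. -/
abbrev Word : Type := ℤ → Letter

/-- A periodic `(a,b)`-sequence. -/
def IsPeriodicWord (w : Word) : Prop :=
  ∃ p : ℤ, p ≠ 0 ∧ Function.Periodic w p

/-- The two-sided sequence of partial sums of `f`, that is, the solution of
`S 0 = 0`, `S (n + 1) = S n + f n`. -/
def partialSum {M : Type} [AddCommGroup M] (f : ℤ → M) (n : ℤ) : M :=
  ∑ i ∈ Finset.Ico 0 n, f i - ∑ i ∈ Finset.Ico n 0, f i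

theorem partialSum_zero {M : Type} [AddCommGroup M] (f : ℤ → M) : partialSum f 0 = 0 := by
  simp [partialSum]

theorem partialSum_succ {M : Type} [AddCommGroup M] (f : ℤ → M) (n : ℤ) :
    partialSum f (n + 1) = partialSum f n + f n := by
  unfold partialSum
  rcases le_or_gt 0 n with h | h
  · have h1 : Finset.Ico (0 : ℤ) (n + 1) = insert n (Finset.Ico 0 n) := by
      ext x; simp; omega
    have h2 : Finset.Ico (n + 1) (0 : ℤ) = ∅ := by
      ext x; simp; omega
    have h3 : Finset.Ico n (0 : ℤ) = ∅ := by
      ext x; simp; omega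
    rw [h1, h2, h3, Finset.sum_insert (by simp)]
    simp [add_comm]
  · have h1 : Finset.Ico n (0 : ℤ) = insert n (Finset.Ico (n + 1) 0) := by
      ext x; simp; omega
    have h2 : Finset.Ico (0 : ℤ) (n + 1) = ∅ := by
      ext x; simp; omega
    have h3 : Finset.Ico (0 : ℤ) n = ∅ := by
      ext x; simp; omega
    rw [h1, h2, h3, Finset.sum_insert (by simp)]
    simp

/-- The vertical unit vector. -/
def ez : Space := !₂[0, 0, 1]

/-! ### Elongated Kelvin partitions

Layers of tetrahedra and octahedra between two horizontal triangular lattices, alternating with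
layers of upright triangular prisms. A layer of tetrahedra and octahedra of type `a` shifts the
triangular lattice by `δ`, a layer of type `b` (the same layer turned by 60 degrees about a
vertical line through a lattice point) shifts it by `-δ`. -/

/-- Generators of the triangular lattice with unit edges. -/
def e₁ : Space := !₂[1, 0, 0]

def e₂ : Space := !₂[1 / 2, Real.sqrt 3 / 2, 0]

/-- The centre of the lattice triangle `0, e₁, e₂`. -/
def δ : Space := (1 / 3 : ℝ) • (e₁ + e₂)

/-- The height of a regular tetrahedron with unit edges. -/
def tetHeight : ℝ := Real.sqrt (2 / 3)

def Letter.sign : Letter → ℝ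
  | .a => 1
  | .b => -1

/-- Lattice point `(i, j)` on the bottom of the `n`-th layer of tetrahedra and octahedra. -/
def kelvinPoint (w : Word) (n i j : ℤ) : Space :=
  partialSum (fun m => (w m).sign • δ) n + ((n : ℝ) * (tetHeight + 1)) • ez
    + ((i : ℝ) • e₁ + (j : ℝ) • e₂)

/-- The tetrahedron standing on the lattice triangle `p, p + ε e₁, p + ε e₂`. -/
def upTetrahedron (ε : ℝ) (p : Space) : Set Space :=
  convexHull ℝ {p, p + ε • e₁, p + ε • e₂, p + ε • δ + tetHeight • ez}

/-- The tetrahedron with bottom vertex `p`. -/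
def downTetrahedron (ε : ℝ) (p : Space) : Set Space :=
  convexHull ℝ {p, p + ε • δ + tetHeight • ez,
    p + ε • (δ - e₁) + tetHeight • ez, p + ε • (δ - e₂) + tetHeight • ez}

/-- The octahedron standing on the lattice triangle `p + ε e₁, p + ε e₂, p + ε (e₁ + e₂)`. -/
def octahedron (ε : ℝ) (p : Space) : Set Space :=
  convexHull ℝ {p + ε • e₁, p + ε • e₂, p + ε • (e₁ + e₂),
    p + ε • δ + tetHeight • ez, p + ε • (δ + e₁) + tetHeight • ez,
    p + ε • (δ + e₂) + tetHeight • ez}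

/-- The upright prism over the lattice triangle `q, q + e₁, q + e₂`. -/
def uprightPrism (q : Space) : Set Space :=
  convexHull ℝ {q, q + e₁, q + e₂, q + ez, q + e₁ + ez, q + e₂ + ez}

/-- The upright prism over the lattice triangle `q + e₁, q + e₂, q + e₁ + e₂`. -/
def uprightPrism' (q : Space) : Set Space :=
  convexHull ℝ {q + e₁, q + e₂, q + e₁ + e₂, q + e₁ + ez, q + e₂ + ez, q + e₁ + e₂ + ez}

/-- The elongated Kelvin partition of an `(a,b)`-sequence. -/
def elongatedKelvin (w : Word) : Set (Set Space) :=
  {P | ∃ n i j : ℤ,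
    P = upTetrahedron (w n).sign (kelvinPoint w n i j) ∨
    P = downTetrahedron (w n).sign (kelvinPoint w n i j) ∨
    P = octahedron (w n).sign (kelvinPoint w n i j) ∨
    P = uprightPrism (kelvinPoint w n i j + (w n).sign • δ + tetHeight • ez) ∨
    P = uprightPrism' (kelvinPoint w n i j + (w n).sign • δ + tetHeight • ez)}

/-- The sequence is proper: none of `…aaa…`, `…bbb…` (elongated fcc) and `…ababab…`
(elongated hcp). -/
def IsProperKelvin (w : Word) : Prop :=
  ¬ (∀ n, w (n + 1) = w n) ∧ ¬ (∀ n, w (n + 1) ≠ w n)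

/-! ### Elongated Grünbaum partitions

Layers of lying triangular prisms between two horizontal square lattices, alternating with layers
of cubes. All prisms of one layer have parallel heights; the letter `w n` tells whether the heights
in the prism layers `n` and `n + 1` are parallel (`a`) or perpendicular (`b`). -/

def ex : Space := !₂[1, 0, 0]

def ey : Space := !₂[0, 1, 0]

/-- The height of an equilateral triangle with unit edges. -/
def triHeight : ℝ := Real.sqrt 3 / 2

def Letter.turn : Letter → ℤ
  | .a => 0
  | .b => 1

/-- The number of quarter turns that lead from prism layer `0` to prism layer `n`. -/
def turns (w : Word) (n : ℤ) : ℤ := partialSum (fun m => (w m).turn) n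

open Classical in
/-- The direction of the heights of the prisms in layer `n`. -/
def axisDir (w : Word) (n : ℤ) : Space := if Even (turns w n) then ey else ex

open Classical in
/-- The horizontal direction perpendicular to the heights of the prisms in layer `n`. -/
def crossDir (w : Word) (n : ℤ) : Space := if Even (turns w n) then ex else ey

/-- Lattice point `(i, j)` on the bottom of the `n`-th layer of prisms. -/
def grunbaumPoint (w : Word) (n i j : ℤ) : Space :=
  partialSum (fun m => (1 / 2 : ℝ) • crossDir w m) n + ((n : ℝ) * (triHeight + 1)) • ez
    + ((i : ℝ) • ex + (j : ℝ) • ey)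

/-- The prism with height `a` that has the lattice square `p, p + u, p + a, p + u + a` as its
bottom face. -/
def lyingPrism (u a p : Space) : Set Space :=
  convexHull ℝ {p, p + u, p + (1 / 2 : ℝ) • u + triHeight • ez,
    p + a, p + u + a, p + (1 / 2 : ℝ) • u + triHeight • ez + a}

/-- The prism with height `a` that has the lattice edge `p + u, p + u + a` as its bottom edge. -/
def lyingPrism' (u a p : Space) : Set Space :=
  convexHull ℝ {p + u, p + (1 / 2 : ℝ) • u + triHeight • ez, p + (3 / 2 : ℝ) • u + triHeight • ez,
    p + u + a, p + (1 / 2 : ℝ) • u + triHeight • ez + a,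
    p + (3 / 2 : ℝ) • u + triHeight • ez + a}

/-- The axis-parallel unit cube with lowest corner `q`. -/
def cubeAt (q : Space) : Set Space :=
  convexHull ℝ {q, q + ex, q + ey, q + ex + ey,
    q + ez, q + ex + ez, q + ey + ez, q + ex + ey + ez}

/-- The elongated Grünbaum partition of an `(a,b)`-sequence. -/
def elongatedGrunbaum (w : Word) : Set (Set Space) :=
  {P | ∃ n i j : ℤ,
    P = lyingPrism (crossDir w n) (axisDir w n) (grunbaumPoint w n i j) ∨
    P = lyingPrism' (crossDir w n) (axisDir w n) (grunbaumPoint w n i j) ∨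
    P = cubeAt (grunbaumPoint w n i j + (1 / 2 : ℝ) • crossDir w n + triHeight • ez)}

/-- The sequence is proper: neither `…aaa…` (all heights parallel) nor `…bbb…` (the heights turn
by a right angle from each prism layer to the next one). -/
def IsProperGrunbaum (w : Word) : Prop :=
  ¬ (∀ n, w n = Letter.a) ∧ ¬ (∀ n, w n = Letter.b)

end

end LayeredTiling

open LayeredTiling

/-! Both families are stacks. Copies of one planar lattice lie at heights separated alternately by
`τ < 1` and by `1`, and crossing the `n`-th layer of thickness `τ` shifts the lattice by a
horizontal vector `s n`. Most of the argument uses only the vertex set (`nodes`) and these shifts,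
so it is carried out once for both families (`IsFrame`, `IsLayeredFamily`).

Normality comes from empty spheres. Each cell is the convex hull of all vertices on a sphere of
radius less than one that has no vertex inside. For two such cells the radical plane of the spheres
separates them, and the vertices of either cell on that plane are common to both
(`IsDelaunay.exists_functional`). Hence interiors are disjoint and intersections are exposed faces.
Emptiness of a sphere concerns only two levels of the stack and reduces to small inequalities for
integral quadratic forms. That the cells cover space is shown by explicit convex combinations.

Congruence of stars: a vertex at the bottom of layer `n` lies only in cells of that layer and of the
spacer below, so its star depends on a single layer. A half turn about a vertical line (Kelvin) or
an exchange of the two horizontal axes (Grünbaum), followed by a translation, matches any two such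
stars. A point reflection relates the bottom of a layer to its top. This works for all words, proper
or not, so the cells around a vertex are counted in the partition of a constant word.

Rigidity: an isometry between two of these partitions respects the stack. Every lattice vector can
be added to and subtracted from every vertex, whereas a unit vector that is not horizontal cannot
have this property, because the gaps above and below a level have different thickness. Hence
verticals stay vertical, the layers are permuted by `n ↦ ±n + k`, and the relation `s n - s m ∈
lattice f₁ f₂` is preserved (`exists_layer_map`, `exists_shift_sub_mem_iff`). In the Kelvin case
this relation means equality of letters, in the Grünbaum case parallelism of the prisms.
Translations then yield injectivity and the criterion for periodicity. A symmetry that lifts a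
bottom vertex of layer `0` to layer `1` shifts the layers by one and forces an improper word.
Congruent partitions have equivalent words (`WordsEquivalent`).

Cardinalities: equivalence classes of words are countable, there are only countably many periodic
words, and the words `sparseWord p` are pairwise inequivalent for `p ≥ 3` because their periods
differ. -/

namespace LayeredTiling

/-! ### Convex hulls of points on empty spheres -/

/-- A supporting hyperplane of a convex hull cuts out the convex hull of the generators on it. -/
theorem mem_convexHull_of_apply_eq {S : Set Space} (l : Space →L[ℝ] ℝ) {M : ℝ}
    (hS : ∀ y ∈ S, l y ≤ M) {x : Space} (hx : x ∈ convexHull ℝ S) (hM : l x = M) :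
    x ∈ convexHull ℝ {y ∈ S | l y = M} := by
  set K := convexHull ℝ {y ∈ S | l y = M}
  have hK : ∀ y ∈ K, l y = M := fun y hy =>
    convexHull_min (t := {y | l y = M}) (fun z hz => hz.2)
      (convex_hyperplane l.isLinear M) hy
  -- The open half space together with the face is convex and contains `S`, hence contains the whole
  -- hull; a point of the hull with `l x = M` can only be in the face.
  have hconv : Convex ℝ ({y | l y < M} ∪ K) := by
    rw [convex_iff_forall_pos]
    intro y hy z hz a b ha hb hab
    have key : ∀ y z : Space, ∀ a b : ℝ, 0 < a → 0 < b → a + b = 1 → l y < M → l z ≤ M →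
        l (a • y + b • z) < M := by
      intro y z a b ha hb hab h1 h2
      simp only [map_add, map_smul, smul_eq_mul]
      calc a * l y + b * l z < a * M + b * M :=
            add_lt_add_of_lt_of_le (mul_lt_mul_of_pos_left h1 ha) (mul_le_mul_of_nonneg_left h2 hb.le)
        _ = M := by rw [← add_mul, hab, one_mul]
    rcases hy with hy | hy
    · rcases hz with hz | hz
      · exact Or.inl (key y z a b ha hb hab hy (le_of_lt hz))
      · exact Or.inl (key y z a b ha hb hab hy (hK z hz).le)
    · rcases hz with hz | hz
      · refine Or.inl ?_
        rw [add_comm]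
        exact key z y b a hb ha (by linarith) hz (hK y hy).le
      · exact Or.inr ((convex_convexHull ℝ _) hy hz ha.le hb.le hab)
  have hsub : S ⊆ {y | l y < M} ∪ K := fun y hy => by
    rcases (hS y hy).lt_or_eq with h | h
    · exact Or.inl h
    · exact Or.inr (subset_convexHull ℝ _ ⟨hy, h⟩)
  rcases convexHull_min hsub hconv hx with h | h
  · exact absurd hM (ne_of_lt h)
  · exact h

theorem apply_le_of_mem_convexHull {S : Set Space} (l : Space →L[ℝ] ℝ) {M : ℝ}
    (hS : ∀ y ∈ S, l y ≤ M) {x : Space} (hx : x ∈ convexHull ℝ S) : l x ≤ M :=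
  convexHull_min (t := {y | l y ≤ M}) hS (convex_halfSpace_le l.isLinear M) hx

/-- The points of `S` are the points of `V` on a sphere with no points of `V` inside. -/
structure IsDelaunay (V S : Set Space) (c : Space) (R : ℝ) : Prop where
  subset : S ⊆ V
  lt_one : R < 1
  sphere : ∀ v ∈ S, ‖v - c‖ ^ 2 = R
  empty : ∀ v ∈ V, v ∈ S ∨ R < ‖v - c‖ ^ 2

namespace IsDelaunay

variable {V S S' : Set Space} {c c' : Space} {R R' : ℝ}

theorem le (h : IsDelaunay V S c R) {v : Space} (hv : v ∈ V) : R ≤ ‖v - c‖ ^ 2 := by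
  rcases h.empty v hv with h' | h'
  · exact (h.sphere v h').ge
  · exact h'.le

theorem mem_iff (h : IsDelaunay V S c R) {v : Space} (hv : v ∈ V) :
    v ∈ S ↔ ‖v - c‖ ^ 2 = R := by
  refine ⟨h.sphere v, fun h1 => ?_⟩
  rcases h.empty v hv with h' | h'
  · exact h'
  · exact absurd h1 h'.ne'

/-- The radical plane of two Delaunay spheres separates the two cells. -/
theorem exists_functional (h : IsDelaunay V S c R) (h' : IsDelaunay V S' c' R') :
    ∃ (l : Space →L[ℝ] ℝ) (M : ℝ), (∀ v ∈ S, l v ≤ M) ∧ (∀ v ∈ S', M ≤ l v) ∧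
      (∀ v ∈ S, l v = M → v ∈ S') ∧ (∀ v ∈ S', l v = M → v ∈ S) ∧ (l = 0 → M = 0 → S = S') := by
  -- Up to a constant, `l` is the difference of the powers of a point with respect to the two
  -- spheres, in which the quadratic terms cancel. Each power vanishes on its own cell and is
  -- nonnegative on `V`, which gives all the claims. Concentric spheres give `l = 0`, and then `M =
  -- 0` makes their powers equal.
  set l : Space →L[ℝ] ℝ := innerSL ℝ ((2 : ℝ) • (c' - c)) with hl
  have key : ∀ x, l x - (‖c'‖ ^ 2 - R' - ‖c‖ ^ 2 + R)
      = (‖x - c‖ ^ 2 - R) - (‖x - c'‖ ^ 2 - R') := by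
    intro x
    rw [hl, innerSL_apply_apply, inner_smul_left, inner_sub_left, @norm_sub_sq_real, @norm_sub_sq_real,
      real_inner_comm c x, real_inner_comm c' x]
    simp
    ring
  have hS : ∀ v ∈ S, l v - (‖c'‖ ^ 2 - R' - ‖c‖ ^ 2 + R) = - (‖v - c'‖ ^ 2 - R') := fun v hv => by
    rw [key, h.sphere v hv]; ring
  have hS' : ∀ v ∈ S', l v - (‖c'‖ ^ 2 - R' - ‖c‖ ^ 2 + R) = ‖v - c‖ ^ 2 - R := fun v hv => by
    rw [key, h'.sphere v hv]; ring
  refine ⟨l, ‖c'‖ ^ 2 - R' - ‖c‖ ^ 2 + R, fun v hv => ?_, fun v hv => ?_, fun v hv e => ?_,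
    fun v hv e => ?_, fun e1 e2 => ?_⟩
  · linarith [hS v hv, h'.le (h.subset hv)]
  · linarith [hS' v hv, h.le (h'.subset hv)]
  · exact (h'.mem_iff (h.subset hv)).2 (by linarith [hS v hv])
  · exact (h.mem_iff (h'.subset hv)).2 (by linarith [hS' v hv])
  · ext v
    have h0 : l v = 0 := by rw [e1]; rfl
    constructor
    · intro hv; exact (h'.mem_iff (h.subset hv)).2 (by linarith [hS v hv])
    · intro hv; exact (h.mem_iff (h'.subset hv)).2 (by linarith [hS' v hv])

/-- A common point lies on the radical plane, so this plane supports the first cell; the generators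
of the first cell on it belong to the second one as well. -/
theorem isExposed_inter (h : IsDelaunay V S c R) (h' : IsDelaunay V S' c' R') :
    IsExposed ℝ (convexHull ℝ S) (convexHull ℝ S ∩ convexHull ℝ S') := by
  obtain ⟨l, M, h1, h2, h3, -, -⟩ := h.exists_functional h'
  have h2' : ∀ x ∈ convexHull ℝ S', M ≤ l x := fun x hx => by
    have := apply_le_of_mem_convexHull (-l) (M := -M) (fun y hy => by simpa using h2 y hy) hx
    simpa using this
  rintro ⟨x₀, hx₀, hx₀'⟩
  have hM : l x₀ = M := le_antisymm (apply_le_of_mem_convexHull l h1 hx₀) (h2' x₀ hx₀')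
  refine ⟨l, Set.Subset.antisymm ?_ ?_⟩
  · rintro x ⟨hx, hx'⟩
    exact ⟨hx, fun y hy => (apply_le_of_mem_convexHull l h1 hy).trans (h2' x hx')⟩
  · rintro x ⟨hx, hmax⟩
    have hxM : l x = M := le_antisymm (apply_le_of_mem_convexHull l h1 hx) (hM ▸ hmax x₀ hx₀)
    exact ⟨hx, convexHull_mono (fun y hy => h3 y hy.1 hy.2) (mem_convexHull_of_apply_eq l h1 hx hxM)⟩

/-- On a nonempty open set inside both cells the separating functional would be constant, so its
derivative, which is `l` itself, would vanish, and `M` too; then both spheres carry the same points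
of `V`. -/
theorem disjoint_interior (h : IsDelaunay V S c R) (h' : IsDelaunay V S' c' R')
    (hne : convexHull ℝ S ≠ convexHull ℝ S') :
    Disjoint (interior (convexHull ℝ S)) (interior (convexHull ℝ S')) := by
  obtain ⟨l, M, h1, h2, -, -, h5⟩ := h.exists_functional h'
  have h2' : ∀ x ∈ convexHull ℝ S', M ≤ l x := fun x hx => by
    have := apply_le_of_mem_convexHull (-l) (M := -M) (fun y hy => by simpa using h2 y hy) hx
    simpa using this
  rw [Set.disjoint_left]
  intro x hx hx'
  set U := interior (convexHull ℝ S) ∩ interior (convexHull ℝ S') with hU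
  have hUo : IsOpen U := isOpen_interior.inter isOpen_interior
  have hc : ∀ y ∈ U, l y = M := fun y hy => le_antisymm
    (apply_le_of_mem_convexHull l h1 (interior_subset hy.1)) (h2' y (interior_subset hy.2))
  have hl : l = 0 := by
    have : l =ᶠ[nhds x] fun _ => M :=
      Filter.eventuallyEq_of_mem (hUo.mem_nhds ⟨hx, hx'⟩) hc
    have h6 : fderiv ℝ l x = 0 := by
      rw [this.fderiv_eq]; simp
    rwa [ContinuousLinearMap.fderiv] at h6
  have hM : M = 0 := by rw [← hc x ⟨hx, hx'⟩, hl]; rfl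
  exact hne (by rw [h5 hl hM])

theorem convexHull_subset_closedBall (h : IsDelaunay V S c R) :
    convexHull ℝ S ⊆ Metric.closedBall c √R :=
  convexHull_min (fun v hv => by
    rw [mem_closedBall_iff_norm, ← h.sphere v hv, Real.sqrt_sq (norm_nonneg _)])
    (convex_closedBall _ _)

theorem norm_le (h : IsDelaunay V S c R) {v : Space} (hv : v ∈ convexHull ℝ S) :
    ‖v - c‖ ^ 2 ≤ R := by
  have h1 := h.convexHull_subset_closedBall hv
  rw [mem_closedBall_iff_norm] at h1
  have hR : 0 ≤ R := by
    obtain ⟨s, hs⟩ := convexHull_nonempty_iff.1 ⟨v, hv⟩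
    rw [← h.sphere s hs]; positivity
  calc ‖v - c‖ ^ 2 ≤ √R ^ 2 := by gcongr
    _ = R := Real.sq_sqrt hR

theorem mem_of_mem_convexHull (h : IsDelaunay V S c R) {v : Space} (hV : v ∈ V)
    (hv : v ∈ convexHull ℝ S) : v ∈ S :=
  (h.mem_iff hV).2 (le_antisymm (h.norm_le hv) (h.le hV))

/-- Balls are strictly convex: a point of the sphere is extreme in the ball, and therefore in the
hull contained in it. -/
theorem extremePoints (h : IsDelaunay V S c R) (hR : 0 < R) :
    (convexHull ℝ S).extremePoints ℝ = S := by
  refine Set.Subset.antisymm extremePoints_convexHull_subset fun v hv => ?_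
  refine inter_extremePoints_subset_extremePoints_of_subset h.convexHull_subset_closedBall
    ⟨subset_convexHull ℝ S hv, ?_⟩
  refine StrictConvexSpace.sphere_subset_extremePoints_closedBall c (Real.sqrt_pos.2 hR).ne' ?_
  rw [mem_sphere_iff_norm, ← h.sphere v hv, Real.sqrt_sq (norm_nonneg _)]

end IsDelaunay

/-- Each cell of `T` is spanned by the points of `V` on an empty sphere. -/
def IsDelaunayFamily (V : Set Space) (T : Set (Set Space)) : Prop :=
  ∀ P ∈ T, ∃ S c R, 0 < R ∧ IsDelaunay V S c R ∧ P = convexHull ℝ S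

namespace IsDelaunayFamily

variable {V : Set Space} {T : Set (Set Space)}

/-- Radical planes give disjoint interiors and common faces. For local finiteness, all spheres have
radius less than one, so a cell that meets the ball of radius `r` has its vertices in the ball of
radius `r + 2`, which contains finitely many points of `V` and hence finitely many sets of them. -/
theorem isNormalPartition (h : IsDelaunayFamily V T) (hP : ∀ P ∈ T, IsPolyhedron P)
    (hV : ∀ x r, (V ∩ Metric.closedBall x r).Finite) (hT : ⋃₀ T = Set.univ) :
    IsNormalPartition T := by
  refine ⟨hP, hT, ?_, ?_, ?_⟩
  · intro P hP Q hQ hne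
    obtain ⟨S, c, R, -, hS, rfl⟩ := h P hP
    obtain ⟨S', c', R', -, hS', rfl⟩ := h Q hQ
    exact hS.disjoint_interior hS' hne
  · intro x r
    refine ((hV x (r + 2)).finite_subsets.image (convexHull ℝ)).subset ?_
    rintro P ⟨hP, y, hyP, hy⟩
    obtain ⟨S, c, R, hR, hS, rfl⟩ := h P hP
    refine ⟨S, fun v hv => ⟨hS.subset hv, ?_⟩, rfl⟩
    have h1 : ‖y - c‖ ≤ 1 := by nlinarith [hS.norm_le hyP, hS.lt_one, norm_nonneg (y - c)]
    have h2 : ‖v - c‖ ≤ 1 := by nlinarith [hS.sphere v hv, hS.lt_one, norm_nonneg (v - c)]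
    rw [mem_closedBall_iff_norm] at hy ⊢
    calc ‖v - x‖ = ‖(v - c) - (y - c) + (y - x)‖ := by congr 1; abel
      _ ≤ ‖v - c‖ + ‖y - c‖ + ‖y - x‖ := (norm_add_le _ _).trans (by gcongr; exact norm_sub_le _ _)
      _ ≤ r + 2 := by linarith
  · intro P hP Q hQ
    obtain ⟨S, c, R, -, hS, rfl⟩ := h P hP
    obtain ⟨S', c', R', -, hS', rfl⟩ := h Q hQ
    exact hS.isExposed_inter hS'

/-- A point of `V` in a cell cannot be inside the empty sphere, so it is one of the generators, and
these are the extreme points. -/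
theorem vertices_eq (h : IsDelaunayFamily V T) (hV : ∀ v ∈ V, ∃ P ∈ T, v ∈ P) :
    vertices T = V := by
  ext v
  constructor
  · rintro ⟨P, hP, hv⟩
    obtain ⟨S, c, R, hR, hS, rfl⟩ := h P hP
    rw [hS.extremePoints hR] at hv
    exact hS.subset hv
  · intro hv
    obtain ⟨P, hP, hvP⟩ := hV v hv
    refine ⟨P, hP, ?_⟩
    obtain ⟨S, c, R, hR, hS, rfl⟩ := h P hP
    rw [hS.extremePoints hR]
    exact hS.mem_of_mem_convexHull hv hvP

end IsDelaunayFamily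

/-! ### Isometries, congruent stars and mirror symmetries -/

theorem image_extremePoints_isometry (g : Space ≃ᵃⁱ[ℝ] Space) (P : Set Space) :
    g '' P.extremePoints ℝ = (g '' P).extremePoints ℝ := by
  ext b
  obtain ⟨a, rfl⟩ := g.surjective b
  have : ∀ x y, g '' openSegment ℝ x y = openSegment ℝ (g x) (g y) :=
    image_openSegment _ g.toAffineEquiv.toAffineMap
  rw [g.injective.mem_set_image, mem_extremePoints, mem_extremePoints, g.injective.mem_set_image]
  simp only [Set.forall_mem_image, g.injective.mem_set_image, g.injective.eq_iff, ← this]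

theorem vertices_moved (g : Space ≃ᵃⁱ[ℝ] Space) (T : Set (Set Space)) :
    vertices (moved g T) = g '' vertices T := by
  ext v
  constructor
  · rintro ⟨_, ⟨P, hP, rfl⟩, hv⟩
    rw [← image_extremePoints_isometry] at hv
    obtain ⟨u, hu, rfl⟩ := hv
    exact ⟨u, ⟨P, hP, hu⟩, rfl⟩
  · rintro ⟨u, ⟨P, hP, hu⟩, rfl⟩
    refine ⟨_, ⟨P, hP, rfl⟩, ?_⟩
    rw [← image_extremePoints_isometry]
    exact ⟨u, hu, rfl⟩

theorem image_convexHull_isometry (g : Space ≃ᵃⁱ[ℝ] Space) (S : Set Space) :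
    g '' convexHull ℝ S = convexHull ℝ (g '' S) :=
  AffineMap.image_convexHull g.toAffineEquiv.toAffineMap S

theorem moved_moved (g h : Space ≃ᵃⁱ[ℝ] Space) (T : Set (Set Space)) :
    moved g (moved h T) = moved (h.trans g) T := by
  simp only [moved, Set.image_image]
  rfl

theorem moved_refl (T : Set (Set Space)) : moved (AffineIsometryEquiv.refl ℝ Space) T = T := by
  simp [moved]

theorem moved_symm_moved (g : Space ≃ᵃⁱ[ℝ] Space) (T : Set (Set Space)) :
    moved g.symm (moved g T) = T := by
  rw [moved_moved, AffineIsometryEquiv.self_trans_symm, moved_refl]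

namespace StarsCongruent

variable {T T' T'' : Set (Set Space)} {v v' v'' : Space}

theorem symm (h : StarsCongruent T v T' v') : StarsCongruent T' v' T v := by
  obtain ⟨g, rfl, hg⟩ := h
  exact ⟨g.symm, by simp, by rw [← hg, moved_symm_moved]⟩

theorem trans (h : StarsCongruent T v T' v') (h' : StarsCongruent T' v' T'' v'') :
    StarsCongruent T v T'' v'' := by
  obtain ⟨g, rfl, hg⟩ := h
  obtain ⟨g', rfl, hg'⟩ := h'
  exact ⟨g.trans g', rfl, by rw [← hg', ← hg, moved_moved]⟩

/-- It is enough to map the cells of each star into the other star. -/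
theorem of_maps {g g' : Space ≃ᵃⁱ[ℝ] Space} (hgg : ∀ x, g (g' x) = x) (hv : g v = v')
    (h : ∀ P ∈ T, v ∈ P → g '' P ∈ T') (h' : ∀ P ∈ T', v' ∈ P → g' '' P ∈ T) :
    StarsCongruent T v T' v' := by
  have hgg' : ∀ x, g' (g x) = x := fun x => g.injective (hgg _)
  refine ⟨g, hv, Set.Subset.antisymm ?_ ?_⟩
  · rintro _ ⟨P, ⟨hP, hvP⟩, rfl⟩
    exact ⟨h P hP hvP, v, hvP, hv⟩
  · rintro P ⟨hP, hvP⟩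
    refine ⟨g' '' P, ⟨h' P hP hvP, v', hvP, by rw [← hv, hgg']⟩, ?_⟩
    simp [Set.image_image, hgg]

/-- Invariance of `p` under all isometries includes the inverse of the given one, so the bijection
between the stars restricts to the cells with `p`. -/
theorem ncard_eq (h : StarsCongruent T v T' v') {p : Set Space → Prop}
    (hp : ∀ (g : Space ≃ᵃⁱ[ℝ] Space) P, p P → p (g '' P)) :
    {P ∈ delaunayStar T v | p P}.ncard = {P ∈ delaunayStar T' v' | p P}.ncard := by
  obtain ⟨g, -, hg⟩ := h
  have : {P ∈ delaunayStar T' v' | p P}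
      = (fun P : Set Space => g '' P) '' {P ∈ delaunayStar T v | p P} := by
    rw [← hg]
    ext Q
    constructor
    · rintro ⟨⟨P, hP, rfl⟩, hQ⟩
      refine ⟨P, ⟨hP, ?_⟩, rfl⟩
      have := hp g.symm _ hQ
      simpa [Set.image_image] using this
    · rintro ⟨P, ⟨hP, hpP⟩, rfl⟩
      exact ⟨⟨P, hP, rfl⟩, hp g P hpP⟩
  rw [this, Set.ncard_image_of_injective _ (Set.image_injective.2 g.injective)]

end StarsCongruent

/-- The isometry with linear part `L` that sends `0` to `t`. -/
noncomputable def isom (L : Space ≃ₗᵢ[ℝ] Space) (t : Space) : Space ≃ᵃⁱ[ℝ] Space :=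
  L.toAffineIsometryEquiv.trans (AffineIsometryEquiv.constVAdd ℝ Space t)

@[simp] theorem isom_apply (L : Space ≃ₗᵢ[ℝ] Space) (t x : Space) : isom L t x = L x + t := by
  simp [isom, add_comm]

theorem isometry_map_add (g : Space ≃ᵃⁱ[ℝ] Space) (x t : Space) :
    g (x + t) = g x + g.linearIsometryEquiv t := by
  have := g.map_vadd x t
  simp only [vadd_eq_add] at this
  rw [add_comm x t, this, add_comm]

/-- The mirror in the perpendicular bisector plane of `x` and `y`, which is the identity if `x = y`.
The vertex-transitivity of all four solids is assembled from such mirrors. -/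
theorem exists_reflection (x y : Space) :
    ∃ (g : Space ≃ᵃⁱ[ℝ] Space) (L : Space ≃ₗᵢ[ℝ] Space), (∀ z t, g (z + t) = g z + L t) ∧
      g x = y ∧ (∀ z, g (g z) = z) ∧ (∀ z, ‖z - x‖ ^ 2 = ‖z - y‖ ^ 2 → g z = z) ∧
      (∀ t : Space, inner ℝ t (x - y) = 0 → L t = t) := by
  set L : Space ≃ₗᵢ[ℝ] Space := (Submodule.span ℝ {x - y})ᗮ.reflection with hL
  set m : Space := (1 / 2 : ℝ) • (x + y) with hm
  have hfix : ∀ t : Space, inner ℝ t (x - y) = 0 → L t = t := fun t ht =>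
    Submodule.reflection_mem_subspace_eq_self
      (Submodule.mem_orthogonal_singleton_iff_inner_left.2 ht)
  have hneg : L (x - y) = -(x - y) := Submodule.reflection_orthogonalComplement_singleton_eq_neg _
  have happ : ∀ z, isom L (m - L m) z = L (z - m) + m := fun z => by
    rw [isom_apply, map_sub]; abel
  refine ⟨isom L (m - L m), L, ?_, ?_, ?_, ?_, hfix⟩
  · intro z t
    simp only [isom_apply, map_add]; abel
  · rw [happ]
    have : x - m = (1 / 2 : ℝ) • (x - y) := by rw [hm]; module
    rw [this, map_smul, hneg, hm]; module
  · intro z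
    rw [happ, happ, add_sub_cancel_right, hL, Submodule.reflection_reflection, sub_add_cancel]
  · intro z hz
    rw [happ, hfix, sub_add_cancel]
    have e1 : z - x = (z - m) - (1 / 2 : ℝ) • (x - y) := by rw [hm]; module
    have e2 : z - y = (z - m) + (1 / 2 : ℝ) • (x - y) := by rw [hm]; module
    rw [e1, e2, @norm_sub_sq_real, @norm_add_sq_real, inner_smul_right] at hz
    linarith

/-- Some symmetry of `P` takes `x` to `y`. -/
def HasSymmetry (P : Set Space) (x y : Space) : Prop :=
  ∃ g : Space ≃ᵃⁱ[ℝ] Space, g '' P = P ∧ g x = y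

namespace HasSymmetry

variable {P : Set Space} {x y z : Space}

theorem refl (P : Set Space) (x : Space) : HasSymmetry P x x :=
  ⟨AffineIsometryEquiv.refl ℝ Space, by simp, rfl⟩

theorem symm (h : HasSymmetry P x y) : HasSymmetry P y x := by
  obtain ⟨g, hg, rfl⟩ := h
  refine ⟨g.symm, ?_, by simp⟩
  conv_lhs => rw [← hg]
  simp [Set.image_image]

theorem trans (h : HasSymmetry P x y) (h' : HasSymmetry P y z) : HasSymmetry P x z := by
  obtain ⟨g, hg, rfl⟩ := h
  obtain ⟨g', hg', rfl⟩ := h'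
  refine ⟨g.trans g', ?_, rfl⟩
  have : (g.trans g') '' P = g' '' (g '' P) := by rw [Set.image_image]; rfl
  rw [this, hg, hg']

/-- An involution that maps the generators into themselves permutes them. -/
theorem of_involution {S : Set Space} (g : Space ≃ᵃⁱ[ℝ] Space) (hg : ∀ z, g (g z) = z)
    (hS : ∀ z ∈ S, g z ∈ S) (hx : g x = y) : HasSymmetry (convexHull ℝ S) x y := by
  refine ⟨g, ?_, hx⟩
  rw [image_convexHull_isometry]
  congr 1
  refine Set.Subset.antisymm ?_ fun z hz => ⟨g z, hS z hz, hg z⟩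
  rintro _ ⟨z, hz, rfl⟩
  exact hS z hz

end HasSymmetry

/-! ### Faces of convex hulls and regular polygons -/

theorem vectorSpan_convexHull (S : Set Space) :
    vectorSpan ℝ (convexHull ℝ S) = vectorSpan ℝ S := by
  rw [← direction_affineSpan, affineSpan_convexHull, direction_affineSpan]

theorem vectorSpan_eq_top {S : Set Space} {q : Space} {d : Fin 3 → Space}
    (hd : LinearIndependent ℝ d) (hq : q ∈ S) (h : ∀ i, q + d i ∈ S) : vectorSpan ℝ S = ⊤ := by
  rw [eq_top_iff, ← hd.span_eq_top_of_card_eq_finrank (by simp), Submodule.span_le]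
  rintro _ ⟨i, rfl⟩
  simpa using vsub_mem_vectorSpan ℝ (h i) hq

theorem isPolyhedron_convexHull {S : Set Space} (hS : S.Finite) (hne : S.Nonempty)
    (h : vectorSpan ℝ S = ⊤) : IsPolyhedron (convexHull ℝ S) := by
  refine ⟨⟨S, hS, rfl⟩, interior_convexHull_nonempty_iff_affineSpan_eq_top.2 ?_⟩
  rwa [AffineSubspace.affineSpan_eq_top_iff_vectorSpan_eq_top_of_nonempty ℝ Space Space hne]

theorem finrank_vectorSpan_ne_two_of_subset_pair {T : Set Space} {x y : Space} (h : T ⊆ {x, y}) :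
    Module.finrank ℝ (vectorSpan ℝ T) ≠ 2 := by
  have := collinear_iff_finrank_le_one.1 ((collinear_pair ℝ x y).subset h)
  omega

/-- The family of generators of `convexHull ℝ S` that lie on the supporting plane `l = M`
span a two-dimensional face. -/
structure IsFaceOf (S T : Set Space) (l : Space →L[ℝ] ℝ) (M : ℝ) : Prop where
  le : ∀ y ∈ S, l y ≤ M
  mem_iff : ∀ y, y ∈ T ↔ y ∈ S ∧ l y = M
  finrank : Module.finrank ℝ (vectorSpan ℝ T) = 2

namespace IsFaceOf

variable {S T : Set Space} {l : Space →L[ℝ] ℝ} {M : ℝ}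

theorem nonempty (h : IsFaceOf S T l M) : ∃ y, y ∈ T := by
  by_contra! hT
  have : T = ∅ := Set.eq_empty_of_forall_notMem hT
  have h2 := h.finrank
  rw [this, vectorSpan_empty] at h2
  simp at h2

theorem ne_top (h : IsFaceOf S T l M) (hS : vectorSpan ℝ S = ⊤) (hST : S ⊆ T) : False := by
  have h2 := h.finrank
  have : vectorSpan ℝ T = ⊤ := top_unique (hS ▸ vectorSpan_mono ℝ hST)
  rw [this] at h2
  simp at h2

end IsFaceOf

/-- The face is where some functional is maximal on the hull, and the generators at which the
maximum is attained span it. Questions about faces thus become questions about subsets of the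
generators. -/
theorem exists_isFaceOf {S F : Set Space} (hF : IsExposed ℝ (convexHull ℝ S) F)
    (h2 : Module.finrank ℝ (vectorSpan ℝ F) = 2) :
    ∃ T l M, IsFaceOf S T l M ∧ F = convexHull ℝ T := by
  have hne : F.Nonempty := by
    by_contra! h
    rw [h, vectorSpan_empty] at h2
    simp at h2
  obtain ⟨l, hl⟩ := hF hne
  obtain ⟨x₀, hx₀⟩ := hne
  have hx := hx₀
  rw [hl] at hx
  have hle : ∀ y ∈ S, l y ≤ l x₀ := fun y hy => hx.2 y (subset_convexHull ℝ S hy)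
  have hFT : F = convexHull ℝ {y ∈ S | l y = l x₀} := by
    refine Set.Subset.antisymm (fun z hz => ?_) ?_
    · rw [hl] at hz
      exact mem_convexHull_of_apply_eq l hle hz.1
        (le_antisymm (hx.2 z hz.1) (hz.2 x₀ hx.1))
    · refine convexHull_min ?_ (hF.convex (convex_convexHull ℝ S))
      rintro y ⟨hy, hye⟩
      rw [hl]
      exact ⟨subset_convexHull ℝ S hy, fun z hz => hye ▸ hx.2 z hz⟩
  refine ⟨{y ∈ S | l y = l x₀}, l, l x₀, ⟨hle, fun y => Iff.rfl, ?_⟩, hFT⟩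
  rw [← vectorSpan_convexHull, ← hFT, h2]

theorem isUniformPolyhedron_convexHull {S : Set Space} (hS : S.Finite) (hne : S.Nonempty)
    (hspan : vectorSpan ℝ S = ⊤)
    (hface : ∀ T l M, IsFaceOf S T l M → IsRegularPolygon (convexHull ℝ T))
    (hsym : ∀ x ∈ S, ∀ y ∈ S, HasSymmetry (convexHull ℝ S) x y) :
    IsUniformPolyhedron (convexHull ℝ S) := by
  refine ⟨isPolyhedron_convexHull hS hne hspan, fun F hF h2 => ?_, fun x hx y hy => ?_⟩
  · obtain ⟨T, l, M, hT, rfl⟩ := exists_isFaceOf hF h2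
    exact hface T l M hT
  · exact hsym x (extremePoints_convexHull_subset hx) y (extremePoints_convexHull_subset hy)

theorem norm_sub_eq_sqrt_two {u v : Space} (hu : ‖u‖ = 1) (hv : ‖v‖ = 1) (huv : inner ℝ u v = 0) :
    ‖u - v‖ ^ 2 = 2 ∧ ‖u + v‖ ^ 2 = 2 := by
  rw [@norm_sub_sq_real, @norm_add_sq_real, hu, hv, huv]; norm_num

theorem isRegularPolygon_triangle {p q r : Space} (hpq : ‖p - q‖ = 1) (hqr : ‖q - r‖ = 1)
    (hpr : ‖p - r‖ = 1) : IsRegularPolygon (convexHull ℝ {p, q, r}) := by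
  have h3 : √3 ^ 2 = 3 := Real.sq_sqrt (by norm_num)
  have h3' : (0 : ℝ) < √3 := by positivity
  have hin : inner ℝ (q - p) (r - p) = 1 / 2 := by
    have : q - r = (q - p) - (r - p) := by abel
    have h := @norm_sub_sq_real Space _ _ (q - p) (r - p)
    rw [← this, hqr, norm_sub_rev q p, norm_sub_rev r p, hpq, hpr] at h
    linarith
  have hc1 : Real.cos (2 * Real.pi / 3) = -(1 / 2) := by
    rw [show 2 * Real.pi / 3 = Real.pi - Real.pi / 3 by ring, Real.cos_pi_sub, Real.cos_pi_div_three]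
  have hs1 : Real.sin (2 * Real.pi / 3) = √3 / 2 := by
    rw [show 2 * Real.pi / 3 = Real.pi - Real.pi / 3 by ring, Real.sin_pi_sub, Real.sin_pi_div_three]
  have hc2 : Real.cos (2 * Real.pi * 2 / 3) = -(1 / 2) := by
    rw [show 2 * Real.pi * 2 / 3 = Real.pi / 3 + Real.pi by ring, Real.cos_add_pi,
      Real.cos_pi_div_three]
  have hs2 : Real.sin (2 * Real.pi * 2 / 3) = -(√3 / 2) := by
    rw [show 2 * Real.pi * 2 / 3 = Real.pi / 3 + Real.pi by ring, Real.sin_add_pi,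
      Real.sin_pi_div_three]
  -- The circumscribed circle has radius `1 / √3`. The first axis points from the centroid to `p`,
  -- the second is parallel to the side `q - r`, so the angles `0`, `2π/3`, `4π/3` give `p`, `q`,
  -- `r`.
  refine ⟨3, le_rfl, (1 / 3 : ℝ) • (p + q + r), -(√3 / 3) • ((q - p) + (r - p)), q - r, 1 / √3,
    by positivity, ?_, hqr, ?_, ?_⟩
  · rw [norm_smul, ← sq_eq_sq₀ (by positivity) (by norm_num), mul_pow, @norm_add_sq_real, hin,
      norm_sub_rev q p, norm_sub_rev r p, hpq, hpr]
    simp only [norm_neg, norm_div, Real.norm_eq_abs, div_pow, sq_abs, h3]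
    norm_num
  · have : q - r = (q - p) - (r - p) := by abel
    rw [this, inner_smul_left, (real_inner_add_sub_eq_zero_iff _ _).2, mul_zero]
    rw [norm_sub_rev q p, norm_sub_rev r p, hpq, hpr]
  · congr 1
    have e : (1 / √3) * -(√3 / 3) = -(1 / 3 : ℝ) := by field_simp
    have e' : (1 / √3) * (√3 / 2) = (1 / 2 : ℝ) := by field_simp
    have key : ∀ a b : ℝ, (1 / 3 : ℝ) • (p + q + r) +
        (1 / √3) • (a • (-(√3 / 3) • (q - p + (r - p))) + b • (q - r))
        = (1 / 3 : ℝ) • (p + q + r) + (-a / 3) • (q - p + (r - p)) + ((1 / √3) * b) • (q - r) := by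
      intro a b
      have : -a / 3 = a * ((1 / √3) * -(√3 / 3)) := by rw [e]; ring
      rw [this]
      module
    have k0 : p = (1 / 3 : ℝ) • (p + q + r) + (-1 / 3 : ℝ) • (q - p + (r - p))
        + ((1 / √3) * 0) • (q - r) := by rw [mul_zero]; module
    have k1 : q = (1 / 3 : ℝ) • (p + q + r) + (-(-(1 / 2)) / 3 : ℝ) • (q - p + (r - p))
        + ((1 / √3) * (√3 / 2)) • (q - r) := by rw [e']; module
    have k2 : r = (1 / 3 : ℝ) • (p + q + r) + (-(-(1 / 2)) / 3 : ℝ) • (q - p + (r - p))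
        + ((1 / √3) * -(√3 / 2)) • (q - r) := by rw [mul_neg, e']; module
    ext x
    simp only [Set.mem_insert_iff, Set.mem_singleton_iff, Set.mem_range, Fin.exists_fin_succ, key]
    simp only [Nat.cast_ofNat, Fin.val_zero, Nat.cast_zero, mul_zero, zero_div, Real.cos_zero,
      Real.sin_zero, Fin.val_succ, zero_add, Nat.cast_one, mul_one, hc1, hs1, Nat.cast_add,
      IsEmpty.exists_iff, or_false, one_add_one_eq_two, hc2, hs2, ← k1, ← k2]
    rw [← mul_zero (1 / √3), ← k0]
    simp only [eq_comm]

theorem isRegularPolygon_square {p a b : Space} (ha : ‖a‖ = 1) (hb : ‖b‖ = 1)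
    (hab : inner ℝ a b = 0) : IsRegularPolygon (convexHull ℝ {p, p + a, p + b, p + a + b}) := by
  have h2 : √2 ^ 2 = 2 := Real.sq_sqrt (by norm_num)
  have h2' : (0 : ℝ) < √2 := by positivity
  have e : (1 / √2) * (1 / √2) = (1 / 2 : ℝ) := by field_simp; exact h2.symm
  have hc1 : Real.cos (2 * Real.pi / 4) = 0 := by
    rw [show 2 * Real.pi / 4 = Real.pi / 2 by ring, Real.cos_pi_div_two]
  have hs1 : Real.sin (2 * Real.pi / 4) = 1 := by
    rw [show 2 * Real.pi / 4 = Real.pi / 2 by ring, Real.sin_pi_div_two]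
  have hc2 : Real.cos (2 * Real.pi * 2 / 4) = -1 := by
    rw [show 2 * Real.pi * 2 / 4 = Real.pi by ring, Real.cos_pi]
  have hs2 : Real.sin (2 * Real.pi * 2 / 4) = 0 := by
    rw [show 2 * Real.pi * 2 / 4 = Real.pi by ring, Real.sin_pi]
  have hc3 : Real.cos (2 * Real.pi * (2 + 1) / 4) = 0 := by
    rw [show 2 * Real.pi * (2 + 1) / 4 = Real.pi / 2 + Real.pi by ring, Real.cos_add_pi,
      Real.cos_pi_div_two, neg_zero]
  have hs3 : Real.sin (2 * Real.pi * (2 + 1) / 4) = -1 := by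
    rw [show 2 * Real.pi * (2 + 1) / 4 = Real.pi / 2 + Real.pi by ring, Real.sin_add_pi,
      Real.sin_pi_div_two]
  obtain ⟨hd, hs⟩ := norm_sub_eq_sqrt_two ha hb hab
  -- The axes run along the diagonals and the first one points from the centre to `p`; the quarter
  -- turns then give `p`, `p + a`, `p + a + b`, `p + b` in this order.
  refine ⟨4, by norm_num, p + (1 / 2 : ℝ) • (a + b), (-(1 / √2)) • (a + b), (1 / √2) • (a - b),
    1 / √2, by positivity, ?_, ?_, ?_, ?_⟩
  · rw [norm_smul, ← sq_eq_sq₀ (by positivity) (by norm_num), mul_pow, hs]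
    simp [h2]
  · rw [norm_smul, ← sq_eq_sq₀ (by positivity) (by norm_num), mul_pow, hd]
    simp [h2]
  · rw [inner_smul_left, inner_smul_right, inner_add_left, inner_sub_right, inner_sub_right,
      real_inner_self_eq_norm_sq, real_inner_self_eq_norm_sq, real_inner_comm a b, ha, hb, hab]
    simp
  · congr 1
    have key : ∀ s t : ℝ, p + (1 / 2 : ℝ) • (a + b) +
        (1 / √2) • (s • ((-(1 / √2)) • (a + b)) + t • ((1 / √2) • (a - b)))
        = p + (1 / 2 : ℝ) • (a + b) + (-s / 2) • (a + b) + (t / 2) • (a - b) := by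
      intro s t
      simp only [smul_add, smul_smul, ← add_assoc]
      rw [show 1 / √2 * (s * -(1 / √2)) = - s / 2 by
          calc _ = - s * ((1 / √2) * (1 / √2)) := by ring
            _ = _ := by rw [e]; ring,
        show 1 / √2 * (t * (1 / √2)) = t / 2 by
          calc _ = t * ((1 / √2) * (1 / √2)) := by ring
            _ = _ := by rw [e]; ring]
    ext x
    simp only [Set.mem_insert_iff, Set.mem_singleton_iff, Set.mem_range, Fin.exists_fin_succ, key]
    simp only [Nat.cast_ofNat, Fin.val_zero, Nat.cast_zero, mul_zero, zero_div, Real.cos_zero,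
      Real.sin_zero, Fin.val_succ, zero_add, Nat.cast_one, mul_one, hc1, hs1, Nat.cast_add,
      IsEmpty.exists_iff, or_false, one_add_one_eq_two, hc2, hs2, hc3, hs3]
    have k0 : p + (1 / 2 : ℝ) • (a + b) + (-1 / 2 : ℝ) • (a + b) + (0 : ℝ) • (a - b) = p := by module
    have k1 : p + (1 / 2 : ℝ) • (a + b) + (-0 / 2 : ℝ) • (a + b) + (1 / 2 : ℝ) • (a - b) = p + a := by
      module
    have k2 : p + (1 / 2 : ℝ) • (a + b) + (- -1 / 2 : ℝ) • (a + b) + (0 : ℝ) • (a - b)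
      = p + a + b := by module
    have k3 : p + (1 / 2 : ℝ) • (a + b) + (-0 / 2 : ℝ) • (a + b) + (-1 / 2 : ℝ) • (a - b) = p + b := by
      module
    rw [k0, k1, k2, k3]
    tauto

/-- A two-dimensional set of vertices of a regular triangle is the whole triangle. -/
theorem isRegularPolygon_of_subset_triangle {T : Set Space} {p q r : Space} (hpq : ‖p - q‖ = 1)
    (hqr : ‖q - r‖ = 1) (hpr : ‖p - r‖ = 1) (hT : T ⊆ {p, q, r})
    (h2 : Module.finrank ℝ (vectorSpan ℝ T) = 2) : IsRegularPolygon (convexHull ℝ T) := by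
  have : T = {p, q, r} := by
    refine hT.antisymm ?_
    by_contra hn
    simp only [Set.insert_subset_iff, Set.singleton_subset_iff, not_and_or] at hn
    rcases hn with hn | hn | hn
    · exact finrank_vectorSpan_ne_two_of_subset_pair (x := q) (y := r)
        (fun y hy => by rcases hT hy with rfl | rfl | rfl <;> simp_all) h2
    · exact finrank_vectorSpan_ne_two_of_subset_pair (x := p) (y := r)
        (fun y hy => by rcases hT hy with rfl | rfl | rfl <;> simp_all) h2
    · exact finrank_vectorSpan_ne_two_of_subset_pair (x := p) (y := q)
        (fun y hy => by rcases hT hy with rfl | rfl | rfl <;> simp_all) h2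
  rw [this]
  exact isRegularPolygon_triangle hpq hqr hpr

/-- A two-dimensional face of a square is the whole square. -/
theorem IsFaceOf.isRegularPolygon_of_square {T : Set Space} {l : Space →L[ℝ] ℝ} {M : ℝ}
    {p a b : Space} (ha : ‖a‖ = 1) (hb : ‖b‖ = 1)
    (hab : inner ℝ a b = 0) (h : IsFaceOf {p, p + a, p + b, p + a + b} T l M) :
    IsRegularPolygon (convexHull ℝ T) := by
  have hmem := h.mem_iff
  have hle := h.le
  simp only [Set.mem_insert_iff, Set.mem_singleton_iff, forall_eq_or_imp, forall_eq, map_add]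
    at hmem hle
  obtain ⟨y, hy⟩ := h.nonempty
  have hy' := (hmem y).1 hy
  -- If `l` were not constant along `a`, it would be maximal on at most one edge parallel to `b`,
  -- which is too small for a two-dimensional face. The same holds with `a` and `b` exchanged.
  have hla : l a = 0 := by
    by_contra hne
    rcases lt_or_gt_of_ne hne with hlt | hlt
    · refine finrank_vectorSpan_ne_two_of_subset_pair (x := p) (y := p + b) (fun z hz => ?_)
        h.finrank
      obtain ⟨rfl | rfl | rfl | rfl, hzM⟩ := (hmem z).1 hz
      · simp
      · exfalso; rw [map_add] at hzM; linarith
      · simp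
      · exfalso; rw [map_add, map_add] at hzM; linarith
    · refine finrank_vectorSpan_ne_two_of_subset_pair (x := p + a) (y := p + a + b) (fun z hz => ?_)
        h.finrank
      obtain ⟨rfl | rfl | rfl | rfl, hzM⟩ := (hmem z).1 hz
      · exfalso; linarith
      · simp
      · exfalso; rw [map_add] at hzM; linarith
      · simp
  have hlb : l b = 0 := by
    by_contra hne
    rcases lt_or_gt_of_ne hne with hlt | hlt
    · refine finrank_vectorSpan_ne_two_of_subset_pair (x := p) (y := p + a) (fun z hz => ?_)
        h.finrank
      obtain ⟨rfl | rfl | rfl | rfl, hzM⟩ := (hmem z).1 hz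
      · simp
      · simp
      · exfalso; rw [map_add] at hzM; linarith
      · exfalso; rw [map_add, map_add] at hzM; linarith
    · refine finrank_vectorSpan_ne_two_of_subset_pair (x := p + b) (y := p + a + b) (fun z hz => ?_)
        h.finrank
      obtain ⟨rfl | rfl | rfl | rfl, hzM⟩ := (hmem z).1 hz
      · exfalso; linarith
      · exfalso; rw [map_add] at hzM; linarith
      · simp
      · simp
  have hp : l p = M := by
    obtain ⟨rfl | rfl | rfl | rfl, hzM⟩ := hy' <;> try simp only [map_add] at hzM
    all_goals linarith
  have : T = {p, p + a, p + b, p + a + b} := by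
    ext z
    rw [h.mem_iff]
    refine ⟨And.left, fun hz => ⟨hz, ?_⟩⟩
    rcases hz with rfl | rfl | rfl | rfl <;> simp [hla, hlb, hp]
  rw [this]
  exact isRegularPolygon_square ha hb hab

/-- Pairing a vanishing combination with each vector gives the Gram system. For the numerical values
that occur, it visibly has only the zero solution, so the edges at a vertex are independent. -/
theorem gram_equations {d : Fin 3 → Space} {α β γ : ℝ} (hd : ∀ i, ‖d i‖ = 1)
    (h01 : inner ℝ (d 0) (d 1) = α) (h02 : inner ℝ (d 0) (d 2) = β)
    (h12 : inner ℝ (d 1) (d 2) = γ) {g : Fin 3 → ℝ} (hg : ∑ i, g i • d i = 0) :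
    g 0 + α * g 1 + β * g 2 = 0 ∧ α * g 0 + g 1 + γ * g 2 = 0 ∧ β * g 0 + γ * g 1 + g 2 = 0 := by
  have key : ∀ j, inner ℝ (d j) (∑ i, g i • d i) = 0 := fun j => by rw [hg, inner_zero_right]
  have h10 : inner ℝ (d 1) (d 0) = α := by rw [real_inner_comm, h01]
  have h20 : inner ℝ (d 2) (d 0) = β := by rw [real_inner_comm, h02]
  have h21 : inner ℝ (d 2) (d 1) = γ := by rw [real_inner_comm, h12]
  have k0 := key 0
  have k1 := key 1
  have k2 := key 2
  simp only [Fin.sum_univ_three, inner_add_right, inner_smul_right, real_inner_self_eq_norm_sq, hd,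
    h01, h02, h12, h10, h20, h21] at k0 k1 k2
  refine ⟨by linarith, by linarith, by linarith⟩

theorem inner_sub_sub_of_equilateral {p q r : Space} (hpq : ‖p - q‖ = 1)
    (hqr : ‖q - r‖ = 1) (hpr : ‖p - r‖ = 1) : inner ℝ (q - p) (r - p) = 1 / 2 := by
  have : q - r = (q - p) - (r - p) := by abel
  have h := @norm_sub_sq_real Space _ _ (q - p) (r - p)
  rw [← this, hqr, norm_sub_rev q p, norm_sub_rev r p, hpq, hpr] at h
  linarith

theorem extremePoints_convexHull_of_sphere {S : Set Space} {c : Space} {R : ℝ} (hR : 0 < R)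
    (h : ∀ v ∈ S, ‖v - c‖ ^ 2 = R) : (convexHull ℝ S).extremePoints ℝ = S := by
  refine Set.Subset.antisymm extremePoints_convexHull_subset fun v hv => ?_
  have hs : ∀ v ∈ S, v ∈ Metric.sphere c √R := fun v hv => by
    rw [mem_sphere_iff_norm, ← h v hv, Real.sqrt_sq (norm_nonneg _)]
  exact inter_extremePoints_subset_extremePoints_of_subset
    (convexHull_min (fun v hv => Metric.sphere_subset_closedBall (hs v hv)) (convex_closedBall _ _))
    ⟨subset_convexHull ℝ S hv, StrictConvexSpace.sphere_subset_extremePoints_closedBall c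
      (Real.sqrt_pos.2 hR).ne' (hs v hv)⟩

/-- The diameter of a convex hull is that of its generators; this bounds distances within a solid
and helps to tell the solids apart. -/
theorem norm_sub_sq_le_of_mem_convexHull {S : Set Space} {D : ℝ}
    (h : ∀ x ∈ S, ∀ y ∈ S, ‖x - y‖ ^ 2 ≤ D) {x y : Space} (hx : x ∈ convexHull ℝ S)
    (hy : y ∈ convexHull ℝ S) : ‖x - y‖ ^ 2 ≤ D := by
  obtain ⟨x', hx', y', hy', hd⟩ := convexHull_exists_dist_ge2 hx hy
  rw [dist_eq_norm, dist_eq_norm] at hd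
  exact (by gcongr : ‖x - y‖ ^ 2 ≤ ‖x' - y'‖ ^ 2).trans (h x' hx' y' hy')

/-! ### Tetrahedra -/

namespace IsRegularTetrahedron

variable {P : Set Space}

theorem image (h : IsRegularTetrahedron P) (g : Space ≃ᵃⁱ[ℝ] Space) :
    IsRegularTetrahedron (g '' P) := by
  obtain ⟨p, hp, rfl⟩ := h
  exact ⟨fun i => g (p i), fun i j hij => by rw [g.dist_map, hp i j hij],
    by rw [image_convexHull_isometry, ← Set.range_comp]; rfl⟩

theorem norm_sub_sq_le (h : IsRegularTetrahedron P) {x y : Space} (hx : x ∈ P) (hy : y ∈ P) :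
    ‖x - y‖ ^ 2 ≤ 1 := by
  obtain ⟨p, hp, rfl⟩ := h
  refine norm_sub_sq_le_of_mem_convexHull ?_ hx hy
  rintro _ ⟨i, rfl⟩ _ ⟨j, rfl⟩
  rcases eq_or_ne i j with rfl | hij
  · simp
  · rw [← dist_eq_norm, hp i j hij]; norm_num

/-- A face misses some vertex, so it lies among the other three, which form a regular triangle. The
mirror exchanging two vertices fixes the remaining two, being equidistant from them. -/
theorem isUniformPolyhedron (h : IsRegularTetrahedron P) : IsUniformPolyhedron P := by
  obtain ⟨p, hp, rfl⟩ := h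
  simp only [dist_eq_norm] at hp
  have hin : ∀ i j, i ≠ j → i ≠ 0 → j ≠ 0 → inner ℝ (p i - p 0) (p j - p 0) = 1 / 2 :=
    fun i j hij hi hj => inner_sub_sub_of_equilateral (hp _ _ hi.symm) (hp _ _ hij) (hp _ _ hj.symm)
  have hspan : vectorSpan ℝ (Set.range p) = ⊤ := by
    refine vectorSpan_eq_top (q := p 0) (d := fun i => p i.succ - p 0) ?_ ⟨0, rfl⟩ fun i => by simp
    rw [Fintype.linearIndependent_iff]
    intro g hg
    obtain ⟨h0, h1, h2⟩ := gram_equations (fun i => hp _ _ (Fin.succ_ne_zero i))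
      (hin _ _ (by decide) (by decide) (by decide)) (hin _ _ (by decide) (by decide) (by decide))
      (hin _ _ (by decide) (by decide) (by decide)) hg
    intro i
    fin_cases i <;> simp <;> linarith
  refine isUniformPolyhedron_convexHull (Set.finite_range p) ⟨p 0, 0, rfl⟩ hspan ?_ ?_
  · intro T l M hT
    obtain ⟨i, hi⟩ : ∃ i, p i ∉ T := by
      by_contra! hn
      exact hT.ne_top hspan (by rintro _ ⟨i, rfl⟩; exact hn i)
    have hsub : ∀ y ∈ T, ∃ j, j ≠ i ∧ p j = y := fun y hy => by
      obtain ⟨j, rfl⟩ := ((hT.mem_iff y).1 hy).1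
      exact ⟨j, fun e => hi (e ▸ hy), rfl⟩
    fin_cases i
    · refine isRegularPolygon_of_subset_triangle (hp 1 2 (by decide)) (hp 2 3 (by decide))
        (hp 1 3 (by decide)) (fun y hy => ?_) hT.finrank
      obtain ⟨j, hj, rfl⟩ := hsub y hy
      fin_cases j <;> simp_all
    · refine isRegularPolygon_of_subset_triangle (hp 0 2 (by decide)) (hp 2 3 (by decide))
        (hp 0 3 (by decide)) (fun y hy => ?_) hT.finrank
      obtain ⟨j, hj, rfl⟩ := hsub y hy
      fin_cases j <;> simp_all
    · refine isRegularPolygon_of_subset_triangle (hp 0 1 (by decide)) (hp 1 3 (by decide))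
        (hp 0 3 (by decide)) (fun y hy => ?_) hT.finrank
      obtain ⟨j, hj, rfl⟩ := hsub y hy
      fin_cases j <;> simp_all
    · refine isRegularPolygon_of_subset_triangle (hp 0 1 (by decide)) (hp 1 2 (by decide))
        (hp 0 2 (by decide)) (fun y hy => ?_) hT.finrank
      obtain ⟨j, hj, rfl⟩ := hsub y hy
      fin_cases j <;> simp_all
  · rintro _ ⟨i, rfl⟩ _ ⟨j, rfl⟩
    obtain ⟨g, L, -, hxy, hinv, hfix, -⟩ := exists_reflection (p i) (p j)
    refine HasSymmetry.of_involution g hinv ?_ hxy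
    rintro _ ⟨k, rfl⟩
    by_cases hki : k = i
    · rw [hki, hxy]; exact ⟨j, rfl⟩
    · by_cases hkj : k = j
      · rw [hkj, ← hxy, hinv]; exact ⟨i, rfl⟩
      · rw [hfix _ (by rw [hp k i hki, hp k j hkj])]; exact ⟨k, rfl⟩

end IsRegularTetrahedron

/-! ### Octahedra -/

theorem one_div_sqrt_two_sq : (1 / √2 : ℝ) ^ 2 = 1 / 2 := by
  rw [div_pow, Real.sq_sqrt (by norm_num)]; norm_num

/-- The vertices of an octahedron, indexed by an axis and a sign. -/
theorem octahedron_vertices (c : Space) (u : Fin 3 → Space) :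
    (Set.range fun i => c + (1 / √2) • u i) ∪ (Set.range fun i => c - (1 / √2) • u i)
      = {y | ∃ i : Fin 3, ∃ s : ℝ, (s = 1 ∨ s = -1) ∧ y = c + s • ((1 / √2) • u i)} := by
  ext y
  constructor
  · rintro (⟨i, rfl⟩ | ⟨i, rfl⟩)
    · exact ⟨i, 1, Or.inl rfl, by simp⟩
    · exact ⟨i, -1, Or.inr rfl, by simp [sub_eq_add_neg]⟩
  · rintro ⟨i, s, rfl | rfl, rfl⟩
    · left; exact ⟨i, by simp⟩
    · right; exact ⟨i, by simp [sub_eq_add_neg]⟩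

namespace IsRegularOctahedron

variable {P : Set Space}

theorem image (h : IsRegularOctahedron P) (g : Space ≃ᵃⁱ[ℝ] Space) :
    IsRegularOctahedron (g '' P) := by
  obtain ⟨c, u, hu, rfl⟩ := h
  refine ⟨g c, g.linearIsometryEquiv ∘ u, hu.comp_linearIsometryEquiv _, ?_⟩
  rw [image_convexHull_isometry, Set.image_union, ← Set.range_comp, ← Set.range_comp]
  simp only [Function.comp_def, isometry_map_add, map_smul, sub_eq_add_neg, map_neg]

theorem norm_vertex_sub_sq {u : Fin 3 → Space} (hu : Orthonormal ℝ u) (c : Space) (i j : Fin 3)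
    (s t : ℝ) : ‖(c + s • ((1 / √2) • u i)) - (c + t • ((1 / √2) • u j))‖ ^ 2
      = (s ^ 2 + t ^ 2) / 2 - if i = j then s * t else 0 := by
  rw [add_sub_add_left_eq_sub, @norm_sub_sq_real, norm_smul, norm_smul, norm_smul, norm_smul, hu.1,
    hu.1, inner_smul_left, inner_smul_right, inner_smul_left, inner_smul_right,
    orthonormal_iff_ite.1 hu i j]
  have := one_div_sqrt_two_sq
  simp only [mul_pow, Real.norm_eq_abs, sq_abs, this, conj_trivial]
  by_cases h : i = j
  · simp only [h, if_true]
    linear_combination (-2 * s * t) * this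
  · simp only [h, if_false]
    ring

/-- Vertices on different axes are at distance one, so only the antipode of `x` has distance `√2`
from it. -/
theorem extremePoints_subset_unique (h : IsRegularOctahedron P) {x y z : Space}
    (hx : x ∈ P.extremePoints ℝ) (hy : y ∈ P.extremePoints ℝ) (hz : z ∈ P.extremePoints ℝ)
    (hxy : ‖x - y‖ ^ 2 = 2) (hxz : ‖x - z‖ ^ 2 = 2) : y = z := by
  obtain ⟨c, u, hu, rfl⟩ := h
  rw [octahedron_vertices] at hx hy hz
  obtain ⟨i, s, hs, rfl⟩ := extremePoints_convexHull_subset hx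
  obtain ⟨j, t, ht, rfl⟩ := extremePoints_convexHull_subset hy
  obtain ⟨k, r, hr, rfl⟩ := extremePoints_convexHull_subset hz
  rw [norm_vertex_sub_sq hu] at hxy hxz
  split_ifs at hxy with hij
  · split_ifs at hxz with hik
    · subst hij hik
      rcases hs with rfl | rfl <;> rcases ht with rfl | rfl <;> rcases hr with rfl | rfl <;>
        first | rfl | (exfalso; revert hxy hxz; norm_num)
    · rcases hs with rfl | rfl <;> rcases hr with rfl | rfl <;> norm_num at hxz
  · rcases hs with rfl | rfl <;> rcases ht with rfl | rfl <;> norm_num at hxy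

theorem exists_norm_sub_sq (h : IsRegularOctahedron P) : ∃ x ∈ P, ∃ y ∈ P, ‖x - y‖ ^ 2 = 2 := by
  obtain ⟨c, u, hu, rfl⟩ := h
  rw [octahedron_vertices]
  refine ⟨_, subset_convexHull ℝ _ ⟨0, 1, Or.inl rfl, rfl⟩, _,
    subset_convexHull ℝ _ ⟨0, -1, Or.inr rfl, rfl⟩, ?_⟩
  rw [norm_vertex_sub_sq hu]
  norm_num

theorem isUniformPolyhedron (h : IsRegularOctahedron P) : IsUniformPolyhedron P := by
  obtain ⟨c, u, hu, rfl⟩ := h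
  have hfin : ((Set.range fun i => c + (1 / √2) • u i) ∪
      (Set.range fun i => c - (1 / √2) • u i)).Finite :=
    (Set.finite_range _).union (Set.finite_range _)
  rw [octahedron_vertices] at hfin ⊢
  set v : Fin 3 → ℝ → Space := fun i s => c + s • ((1 / √2) • u i) with hv
  have hdist : ∀ i j s t, ‖v i s - v j t‖ ^ 2 = (s ^ 2 + t ^ 2) / 2 - if i = j then s * t else 0 :=
    fun i j s t => norm_vertex_sub_sq hu c i j s t
  have hc : ∀ i s, ‖c - v i s‖ ^ 2 = s ^ 2 / 2 := fun i s => by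
    have := hdist i i 0 s
    simpa [hv] using this
  have hspan : vectorSpan ℝ {y | ∃ i : Fin 3, ∃ s : ℝ, (s = 1 ∨ s = -1) ∧ y = v i s} = ⊤ := by
    rw [eq_top_iff, ← hu.linearIndependent.span_eq_top_of_card_eq_finrank (by simp),
      Submodule.span_le]
    rintro _ ⟨i, rfl⟩
    have h1 := vsub_mem_vectorSpan ℝ
      (s := {y | ∃ i : Fin 3, ∃ s : ℝ, (s = 1 ∨ s = -1) ∧ y = v i s})
      (p₁ := v i 1) (p₂ := v i (-1)) ⟨i, 1, Or.inl rfl, rfl⟩ ⟨i, -1, Or.inr rfl, rfl⟩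
    have h2 : u i = (√2 / 2) • (v i 1 -ᵥ v i (-1)) := by
      have : v i 1 -ᵥ v i (-1) = (2 / √2 : ℝ) • u i := by
        rw [vsub_eq_sub, hv]; module
      rw [this, smul_smul]
      have : √2 / 2 * (2 / √2) = 1 := by field_simp
      rw [this, one_smul]
    rw [SetLike.mem_coe, h2]
    exact Submodule.smul_mem _ _ h1
  refine isUniformPolyhedron_convexHull hfin ⟨v 0 1, 0, 1, Or.inl rfl, rfl⟩ hspan ?_ ?_
  · intro T l M hT
    have hle : ∀ i s, (s = 1 ∨ s = -1) → l (v i s) ≤ M := fun i s hs => hT.le _ ⟨i, s, hs, rfl⟩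
    have hsum : ∀ i, l (v i 1) + l (v i (-1)) = 2 * l c := fun i => by
      simp only [hv, map_add, map_smul, smul_eq_mul]; ring
    -- The values at antipodes average to `l c`; if the centre reached the maximum, all six vertices
    -- would lie on the supporting plane.
    have hM : l c < M := by
      by_contra! hM
      refine hT.ne_top hspan ?_
      rintro _ ⟨i, s, hs, rfl⟩
      refine (hT.mem_iff _).2 ⟨⟨i, s, hs, rfl⟩, ?_⟩
      have h1 := hle i 1 (Or.inl rfl)
      have h2 := hle i (-1) (Or.inr rfl)
      have h3 := hsum i
      rcases hs with rfl | rfl <;> linarith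
    -- Because `l c < M`, a face has at most one vertex on each axis. `σ` selects its sign, with
    -- `-1` as the default when there is no such vertex; in any case the three selected vertices
    -- form a regular triangle.
    have hσ : ∀ i, ∃ s : ℝ, (s = 1 ∨ s = -1) ∧ ∀ t, (t = 1 ∨ t = -1) → v i t ∈ T → t = s := by
      intro i
      by_cases h1 : v i 1 ∈ T
      · refine ⟨1, Or.inl rfl, ?_⟩
        rintro t (rfl | rfl) ht
        · rfl
        · linarith [((hT.mem_iff _).1 h1).2, ((hT.mem_iff _).1 ht).2, hsum i]
      · refine ⟨-1, Or.inr rfl, ?_⟩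
        rintro t (rfl | rfl) ht
        · exact absurd ht h1
        · rfl
    choose σ hσ1 hσ2 using hσ
    have hone : ∀ i j, i ≠ j → ‖v i (σ i) - v j (σ j)‖ = 1 := fun i j hij => by
      have := hdist i j (σ i) (σ j)
      rw [if_neg hij] at this
      rw [← sq_eq_sq₀ (norm_nonneg _) zero_le_one, this]
      rcases hσ1 i with e | e <;> rcases hσ1 j with e' | e' <;> rw [e, e'] <;> norm_num
    refine isRegularPolygon_of_subset_triangle (hone 0 1 (by decide)) (hone 1 2 (by decide))
        (hone 0 2 (by decide)) (fun y hy => ?_) hT.finrank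
    obtain ⟨i, s, hs, rfl⟩ := ((hT.mem_iff _).1 hy).1
    rw [hσ2 i s hs hy]
    fin_cases i
    exacts [Or.inl rfl, Or.inr (Or.inl rfl), Or.inr (Or.inr rfl)]
  -- For vertices on different axes the mirror fixes the centre, hence commutes with taking
  -- antipodes, and it fixes the third axis. Two vertices on one axis are joined through a vertex on
  -- another axis.
  · have hadj : ∀ i j s t, i ≠ j → (s = 1 ∨ s = -1) → (t = 1 ∨ t = -1) →
        HasSymmetry (convexHull ℝ {y | ∃ i : Fin 3, ∃ s : ℝ, (s = 1 ∨ s = -1) ∧ y = v i s})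
          (v i s) (v j t) := by
      intro i j s t hij hs ht
      obtain ⟨g, L, hadd, hxy, hinv, hfix, -⟩ := exists_reflection (v i s) (v j t)
      have hs2 : s ^ 2 = 1 := by rcases hs with rfl | rfl <;> norm_num
      have ht2 : t ^ 2 = 1 := by rcases ht with rfl | rfl <;> norm_num
      have hgc : g c = c := hfix c (by rw [hc, hc, hs2, ht2])
      have hneg : ∀ i s, g (v i (-s)) = 2 • c - g (v i s) := by
        intro i s
        have h1 := hadd c (s • ((1 / √2) • u i))
        have h2 := hadd c (-s • ((1 / √2) • u i))
        rw [hgc] at h1 h2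
        rw [neg_smul, map_neg] at h2
        simp only [hv, neg_smul, h1, h2]
        module
      have hnegv : ∀ i s, 2 • c - v i s = v i (-s) := fun i s => by simp only [hv]; module
      refine HasSymmetry.of_involution g hinv ?_ hxy
      have hsign : ∀ s r : ℝ, (s = 1 ∨ s = -1) → (r = 1 ∨ r = -1) → r = s ∨ r = -s := by
        rintro s r (rfl | rfl) (rfl | rfl) <;> norm_num
      have hsn : ∀ s : ℝ, (s = 1 ∨ s = -1) → (-s = 1 ∨ -s = -1) := by
        rintro s (rfl | rfl) <;> norm_num
      have hyx : g (v j t) = v i s := by rw [← hxy, hinv]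
      rintro _ ⟨k, r, hr, rfl⟩
      by_cases hki : k = i
      · subst hki
        rcases hsign s r hs hr with rfl | rfl
        · exact ⟨j, t, ht, hxy⟩
        · exact ⟨j, -t, hsn t ht, by rw [hneg, hxy, hnegv]⟩
      · by_cases hkj : k = j
        · subst hkj
          rcases hsign t r ht hr with rfl | rfl
          · exact ⟨i, s, hs, hyx⟩
          · exact ⟨i, -s, hsn s hs, by rw [hneg, hyx, hnegv]⟩
        · refine ⟨k, r, hr, hfix _ ?_⟩
          rw [hdist, hdist, if_neg hki, if_neg hkj, hs2, ht2]
    rintro _ ⟨i, s, hs, rfl⟩ _ ⟨j, t, ht, rfl⟩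
    by_cases hij : i = j
    · subst hij
      obtain ⟨k, hk⟩ : ∃ k : Fin 3, i ≠ k := by
        fin_cases i
        exacts [⟨1, by decide⟩, ⟨0, by decide⟩, ⟨0, by decide⟩]
      exact (hadj i k s 1 hk hs (Or.inl rfl)).trans (hadj k i 1 t hk.symm (Or.inl rfl) ht)
    · exact hadj i j s t hij hs ht

end IsRegularOctahedron

theorem exists_others (i : Fin 3) : ∃ j k, i ≠ j ∧ i ≠ k ∧ j ≠ k ∧ ∀ m, m = i ∨ m = j ∨ m = k := by
  revert i; decide

/-! ### Triangular prisms -/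

/-- The vertices of a prism, indexed by a vertex of the base and a height. -/
theorem prism_vertices (p : Fin 3 → Space) (a : Space) :
    Set.range p ∪ (Set.range fun i => p i + a)
      = {y | ∃ i : Fin 3, ∃ s : ℝ, (s = 0 ∨ s = 1) ∧ y = p i + s • a} := by
  ext y
  constructor
  · rintro (⟨i, rfl⟩ | ⟨i, rfl⟩)
    · exact ⟨i, 0, Or.inl rfl, by simp⟩
    · exact ⟨i, 1, Or.inr rfl, by simp⟩
  · rintro ⟨i, s, rfl | rfl, rfl⟩
    · left; exact ⟨i, by simp⟩
    · right; exact ⟨i, by simp⟩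

theorem norm_sub_centroid_sq {p q r : Space} (hpq : ‖p - q‖ = 1)
    (hqr : ‖q - r‖ = 1) (hpr : ‖p - r‖ = 1) :
    ‖p - (1 / 3 : ℝ) • (p + q + r)‖ ^ 2 = 1 / 3 := by
  have h := inner_sub_sub_of_equilateral hpq hqr hpr
  have : p - (1 / 3 : ℝ) • (p + q + r) = -((1 / 3 : ℝ) • ((q - p) + (r - p))) := by module
  rw [this, norm_neg, norm_smul, mul_pow, @norm_add_sq_real, h, norm_sub_rev q p, norm_sub_rev r p,
    hpq, hpr]
  norm_num

namespace IsTriangularPrism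

variable {P : Set Space}

theorem image (h : IsTriangularPrism P) (g : Space ≃ᵃⁱ[ℝ] Space) :
    IsTriangularPrism (g '' P) := by
  obtain ⟨p, a, hp, ha, hpa, rfl⟩ := h
  refine ⟨fun i => g (p i), g.linearIsometryEquiv a, fun i j hij => by rw [g.dist_map, hp i j hij],
    by rw [LinearIsometryEquiv.norm_map, ha], fun i j => ?_, ?_⟩
  · have : g (p i) = g (p j) + g.linearIsometryEquiv (p i - p j) := by
      rw [← isometry_map_add, add_sub_cancel]
    beta_reduce
    rw [this, add_sub_cancel_left, LinearIsometryEquiv.inner_map_map, hpa]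
  · rw [image_convexHull_isometry, Set.image_union, ← Set.range_comp, ← Set.range_comp]
    simp only [Function.comp_def, isometry_map_add]

theorem norm_vertex_sub_sq {p : Fin 3 → Space} {a : Space} (hp : ∀ i j, i ≠ j → dist (p i) (p j) = 1)
    (ha : ‖a‖ = 1) (hpa : ∀ i j, inner ℝ a (p i - p j) = 0) (i j : Fin 3) (s t : ℝ) :
    ‖(p i + s • a) - (p j + t • a)‖ ^ 2 = (if i = j then 0 else 1) + (s - t) ^ 2 := by
  have : (p i + s • a) - (p j + t • a) = (s - t) • a + (p i - p j) := by module
  rw [this, @norm_add_sq_real, inner_smul_left, hpa, norm_smul, ha, ← dist_eq_norm (p i) (p j)]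
  have e : dist (p i) (p j) ^ 2 = if i = j then 0 else 1 := by
    split_ifs with h
    · rw [h, dist_self]; norm_num
    · rw [hp i j h]; norm_num
  rw [e]
  simp [add_comm]

theorem norm_sub_sq_le (h : IsTriangularPrism P) {x y : Space} (hx : x ∈ P) (hy : y ∈ P) :
    ‖x - y‖ ^ 2 ≤ 2 := by
  obtain ⟨p, a, hp, ha, hpa, rfl⟩ := h
  rw [prism_vertices] at hx hy
  refine norm_sub_sq_le_of_mem_convexHull ?_ hx hy
  rintro _ ⟨i, s, hs, rfl⟩ _ ⟨j, t, ht, rfl⟩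
  rw [norm_vertex_sub_sq hp ha hpa]
  split_ifs <;> rcases hs with rfl | rfl <;> rcases ht with rfl | rfl <;> norm_num

/-- A bottom vertex is at distance `√2` from the two top vertices that are not above it. This is
what distinguishes a prism from an octahedron. -/
theorem exists_extremePoints (h : IsTriangularPrism P) :
    ∃ x ∈ P.extremePoints ℝ, ∃ y ∈ P.extremePoints ℝ, ∃ z ∈ P.extremePoints ℝ,
      y ≠ z ∧ ‖x - y‖ ^ 2 = 2 ∧ ‖x - z‖ ^ 2 = 2 := by
  obtain ⟨p, a, hp, ha, hpa, rfl⟩ := h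
  have hp' : ∀ i j, i ≠ j → ‖p i - p j‖ = 1 := fun i j hij => by rw [← dist_eq_norm, hp i j hij]
  have hext : (convexHull ℝ (Set.range p ∪ Set.range fun i => p i + a)).extremePoints ℝ
      = Set.range p ∪ Set.range fun i => p i + a := by
    -- All six vertices lie on a sphere about the centre: `1 / 3` is the squared circumradius of the
    -- base, and half the height contributes `1 / 4`.
    refine extremePoints_convexHull_of_sphere
      (c := (1 / 3 : ℝ) • (p 0 + p 1 + p 2) + (1 / 2 : ℝ) • a) (R := 7 / 12) (by norm_num) ?_
    have hbase : ∀ i, ‖p i - (1 / 3 : ℝ) • (p 0 + p 1 + p 2)‖ ^ 2 = 1 / 3 := by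
      intro i
      fin_cases i
      · exact norm_sub_centroid_sq (hp' 0 1 (by decide)) (hp' 1 2 (by decide)) (hp' 0 2 (by decide))
      · have := norm_sub_centroid_sq (hp' 1 0 (by decide)) (hp' 0 2 (by decide))
          (hp' 1 2 (by decide))
        rwa [show p 1 + p 0 + p 2 = p 0 + p 1 + p 2 by abel] at this
      · have := norm_sub_centroid_sq (hp' 2 0 (by decide)) (hp' 0 1 (by decide))
          (hp' 2 1 (by decide))
        rwa [show p 2 + p 0 + p 1 = p 0 + p 1 + p 2 by abel] at this
    have hperp : ∀ i, inner ℝ a (p i - (1 / 3 : ℝ) • (p 0 + p 1 + p 2)) = 0 := by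
      intro i
      have : p i - (1 / 3 : ℝ) • (p 0 + p 1 + p 2)
          = (1 / 3 : ℝ) • ((p i - p 0) + (p i - p 1) + (p i - p 2)) := by module
      rw [this, inner_smul_right, inner_add_right, inner_add_right, hpa, hpa, hpa]
      simp
    rw [prism_vertices]
    rintro _ ⟨i, s, hs, rfl⟩
    have : p i + s • a - ((1 / 3 : ℝ) • (p 0 + p 1 + p 2) + (1 / 2 : ℝ) • a)
        = (s - 1 / 2) • a + (p i - (1 / 3 : ℝ) • (p 0 + p 1 + p 2)) := by module
    rw [this, @norm_add_sq_real, inner_smul_left, hperp, hbase, norm_smul, ha]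
    rcases hs with rfl | rfl <;> norm_num
  rw [hext, prism_vertices]
  refine ⟨_, ⟨0, 0, Or.inl rfl, rfl⟩, _, ⟨1, 1, Or.inr rfl, rfl⟩, _, ⟨2, 1, Or.inr rfl, rfl⟩, ?_, ?_, ?_⟩
  · intro e
    have := norm_vertex_sub_sq hp ha hpa 1 2 1 1
    rw [e, sub_self, if_neg (by decide)] at this
    norm_num at this
  · rw [norm_vertex_sub_sq hp ha hpa, if_neg (by decide)]; norm_num
  · rw [norm_vertex_sub_sq hp ha hpa, if_neg (by decide)]; norm_num

/-- The sign of `l a` decides which face is cut out: the bottom, the top, or, if `l a = 0`, part of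
the lateral square that avoids an edge not on the supporting plane. The two kinds of mirrors
exchange the bases, or two vertices within each base. -/
theorem isUniformPolyhedron (h : IsTriangularPrism P) : IsUniformPolyhedron P := by
  obtain ⟨p, a, hp, ha, hpa, rfl⟩ := h
  have hp' : ∀ i j, i ≠ j → ‖p i - p j‖ = 1 := fun i j hij => by rw [← dist_eq_norm, hp i j hij]
  have hfin : (Set.range p ∪ Set.range fun i => p i + a).Finite :=
    (Set.finite_range _).union (Set.finite_range _)
  rw [prism_vertices] at hfin ⊢
  have h0 : ∀ i, p i ∈ {y | ∃ i : Fin 3, ∃ s : ℝ, (s = 0 ∨ s = 1) ∧ y = p i + s • a} :=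
    fun i => ⟨i, 0, Or.inl rfl, by simp⟩
  have h1 : ∀ i, p i + a ∈ {y | ∃ i : Fin 3, ∃ s : ℝ, (s = 0 ∨ s = 1) ∧ y = p i + s • a} :=
    fun i => ⟨i, 1, Or.inr rfl, by simp⟩
  have hspan : vectorSpan ℝ {y | ∃ i : Fin 3, ∃ s : ℝ, (s = 0 ∨ s = 1) ∧ y = p i + s • a} = ⊤ := by
    refine vectorSpan_eq_top (q := p 0) (d := ![p 1 - p 0, p 2 - p 0, a]) ?_ (h0 0) ?_
    · rw [Fintype.linearIndependent_iff]
      intro g hg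
      obtain ⟨e0, e1, e2⟩ := gram_equations (d := ![p 1 - p 0, p 2 - p 0, a])
        (α := 1 / 2) (β := 0) (γ := 0) (fun i => by
          fin_cases i
          exacts [hp' _ _ (by decide), hp' _ _ (by decide), ha])
        (inner_sub_sub_of_equilateral (hp' _ _ (by decide)) (hp' _ _ (by decide))
          (hp' _ _ (by decide)))
        (by simp only [Matrix.cons_val]; rw [real_inner_comm, hpa])
        (by simp only [Matrix.cons_val]; rw [real_inner_comm, hpa]) hg
      intro i
      fin_cases i <;> simp <;> linarith
    · intro i
      fin_cases i
      · simpa using h0 1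
      · simpa using h0 2
      · simpa using h1 0
  refine isUniformPolyhedron_convexHull hfin ⟨p 0, h0 0⟩ hspan ?_ ?_
  · intro T l M hT
    have hmem : ∀ y ∈ T, l y = M ∧ ∃ i, y = p i ∨ y = p i + a := by
      intro y hy
      obtain ⟨⟨i, s, rfl | rfl, rfl⟩, hM⟩ := (hT.mem_iff y).1 hy
      · exact ⟨hM, i, Or.inl (by simp)⟩
      · exact ⟨hM, i, Or.inr (by simp)⟩
    have hle0 := fun i => hT.le _ (h0 i)
    have hle1 : ∀ i, l (p i) + l a ≤ M := fun i => by rw [← map_add]; exact hT.le _ (h1 i)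
    rcases lt_trichotomy (l a) 0 with hla | hla | hla
    · refine isRegularPolygon_of_subset_triangle (hp' 0 1 (by decide)) (hp' 1 2 (by decide))
        (hp' 0 2 (by decide)) (fun y hy => ?_) hT.finrank
      obtain ⟨hM, i, rfl | rfl⟩ := hmem y hy
      · fin_cases i <;> simp
      · rw [map_add] at hM
        linarith [hle0 i]
    · obtain ⟨i, hi⟩ : ∃ i, p i ∉ T := by
        by_contra! hn
        refine hT.ne_top hspan ?_
        rintro _ ⟨i, s, hs, rfl⟩
        refine (hT.mem_iff _).2 ⟨⟨i, s, hs, rfl⟩, ?_⟩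
        rw [map_add, map_smul, hla, smul_zero, add_zero]
        exact ((hT.mem_iff _).1 (hn i)).2
      obtain ⟨j, k, hij, hik, hjk, hall⟩ := exists_others i
      have e : p j + (p k - p j) = p k := by abel
      have hsub : ∀ y, y = p j ∨ y = p k ∨ y = p j + a ∨ y = p k + a →
          y ∈ {y | ∃ i : Fin 3, ∃ s : ℝ, (s = 0 ∨ s = 1) ∧ y = p i + s • a} := by
        rintro y (rfl | rfl | rfl | rfl)
        exacts [h0 _, h0 _, h1 _, h1 _]
      have hface : IsFaceOf {p j, p j + (p k - p j), p j + a, p j + (p k - p j) + a} T l M := by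
        refine ⟨fun y hy => ?_, fun y => ⟨fun hy => ?_, fun hy => ?_⟩, hT.finrank⟩
        · rw [e] at hy
          exact hT.le y (hsub y hy)
        · refine ⟨?_, (hmem y hy).1⟩
          obtain ⟨hM, m, hm⟩ := hmem y hy
          have hmi : m ≠ i := by
            rintro rfl
            refine hi ((hT.mem_iff _).2 ⟨h0 m, ?_⟩)
            rcases hm with rfl | rfl
            · exact hM
            · rw [map_add, hla, add_zero] at hM; exact hM
          rw [e]
          rcases hall m with rfl | rfl | rfl
          · exact absurd rfl hmi
          · rcases hm with rfl | rfl <;> simp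
          · rcases hm with rfl | rfl <;> simp
        · rw [e] at hy
          exact (hT.mem_iff y).2 ⟨hsub y hy.1, hy.2⟩
      exact hface.isRegularPolygon_of_square (hp' k j hjk.symm) ha
        (by rw [real_inner_comm, hpa])
    · have hadd : ∀ i j, i ≠ j → ‖p i + a - (p j + a)‖ = 1 := fun i j hij => by
        rw [add_sub_add_right_eq_sub, hp' i j hij]
      refine isRegularPolygon_of_subset_triangle (hadd 0 1 (by decide)) (hadd 1 2 (by decide))
        (hadd 0 2 (by decide)) (fun y hy => ?_) hT.finrank
      obtain ⟨hM, i, rfl | rfl⟩ := hmem y hy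
      · linarith [hle1 i]
      · fin_cases i <;> simp
  · set K := convexHull ℝ {y | ∃ i : Fin 3, ∃ s : ℝ, (s = 0 ∨ s = 1) ∧ y = p i + s • a}
    have hflip : ∀ i, HasSymmetry K (p i) (p i + a) := by
      intro i
      obtain ⟨g, L, hadd, hxy, hinv, -, hfix⟩ := exists_reflection (p i) (p i + a)
      have hyx : g (p i + a) = p i := by rw [← hxy, hinv]
      have hL : ∀ k, L (p k - p i) = p k - p i := fun k => hfix _ (by
        rw [sub_add_cancel_left, inner_neg_right, real_inner_comm, hpa, neg_zero])
      refine HasSymmetry.of_involution g hinv ?_ hxy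
      rintro _ ⟨k, s, rfl | rfl, rfl⟩
      · refine ⟨k, 1, Or.inr rfl, ?_⟩
        have := hadd (p i) (p k - p i)
        rw [hL, hxy, add_sub_cancel] at this
        rw [zero_smul, add_zero, this, one_smul]
        abel
      · refine ⟨k, 0, Or.inl rfl, ?_⟩
        have := hadd (p i + a) (p k - p i)
        rw [hL, hyx, add_sub_cancel] at this
        have e : p k + (1 : ℝ) • a = p i + a + (p k - p i) := by module
        rw [zero_smul, add_zero, e, this]
    have hbase : ∀ i j, HasSymmetry K (p i) (p j) := by
      intro i j
      obtain ⟨g, L, hadd, hxy, hinv, hfix, hfix'⟩ := exists_reflection (p i) (p j)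
      have hL : L a = a := hfix' a (hpa i j)
      have hg : ∀ k, ∃ m, g (p k) = p m := by
        intro k
        by_cases hki : k = i
        · exact ⟨j, by rw [hki, hxy]⟩
        · by_cases hkj : k = j
          · exact ⟨i, by rw [hkj, ← hxy, hinv]⟩
          · exact ⟨k, hfix _ (by rw [hp' k i hki, hp' k j hkj])⟩
      refine HasSymmetry.of_involution g hinv ?_ hxy
      rintro _ ⟨k, s, hs, rfl⟩
      obtain ⟨m, hm⟩ := hg k
      exact ⟨m, s, hs, by rw [hadd, map_smul, hL, hm]⟩
    have hup : ∀ i (s : ℝ), (s = 0 ∨ s = 1) → HasSymmetry K (p i) (p i + s • a) := by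
      rintro i s (rfl | rfl)
      · simpa using HasSymmetry.refl K (p i)
      · simpa using hflip i
    rintro _ ⟨i, s, hs, rfl⟩ _ ⟨j, t, ht, rfl⟩
    exact ((hup i s hs).symm.trans (hbase i j)).trans (hup j t ht)

end IsTriangularPrism

/-! ### Cubes -/

/-- The vertices of a cube, indexed by their coordinates. -/
theorem cube_vertices (c : Space) (u : Fin 3 → Space) :
    (Set.range fun s : Finset (Fin 3) => c + ∑ i ∈ s, u i)
      = {y | ∃ t : Fin 3 → ℝ, (∀ i, t i = 0 ∨ t i = 1) ∧ y = c + ∑ i, t i • u i} := by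
  classical
  ext y
  constructor
  · rintro ⟨s, rfl⟩
    refine ⟨fun i => if i ∈ s then 1 else 0, fun i => ?_, ?_⟩
    · by_cases h : i ∈ s <;> simp [h]
    · simp [ite_smul, Finset.sum_ite_mem]
  · rintro ⟨t, ht, rfl⟩
    refine ⟨Finset.univ.filter fun i => t i = 1, ?_⟩
    simp only [Finset.sum_filter]
    congr 1
    refine Finset.sum_congr rfl fun i _ => ?_
    rcases ht i with h | h <;> simp [h]

namespace IsCube

variable {P : Set Space}

theorem image (h : IsCube P) (g : Space ≃ᵃⁱ[ℝ] Space) : IsCube (g '' P) := by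
  obtain ⟨c, u, hu, rfl⟩ := h
  refine ⟨g c, g.linearIsometryEquiv ∘ u, hu.comp_linearIsometryEquiv _, ?_⟩
  rw [image_convexHull_isometry, ← Set.range_comp]
  simp only [Function.comp_def, isometry_map_add, map_sum]

theorem exists_norm_sub_sq (h : IsCube P) : ∃ x ∈ P, ∃ y ∈ P, ‖x - y‖ ^ 2 = 3 := by
  obtain ⟨c, u, hu, rfl⟩ := h
  refine ⟨_, subset_convexHull ℝ _ ⟨Finset.univ, rfl⟩, _, subset_convexHull ℝ _ ⟨∅, rfl⟩, ?_⟩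
  simp only [add_sub_add_left_eq_sub, Finset.sum_empty, sub_zero]
  rw [← real_inner_self_eq_norm_sq, Fin.sum_univ_three]
  simp only [inner_add_right, inner_add_left, orthonormal_iff_ite.1 hu]
  simp
  norm_num

/-- Some edge direction `u i` has `l (u i) ≠ 0`; maximality then fixes the `i`-th coordinate on the
face, so the face lies in a square. Changing a single coordinate is realized by a mirror, and three
such changes join any two vertices. -/
theorem isUniformPolyhedron (h : IsCube P) : IsUniformPolyhedron P := by
  obtain ⟨c, u, hu, rfl⟩ := h
  have hfin : (Set.range fun s : Finset (Fin 3) => c + ∑ i ∈ s, u i).Finite := Set.finite_range _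
  rw [cube_vertices] at hfin ⊢
  set v : (Fin 3 → ℝ) → Space := fun t => c + ∑ i, t i • u i with hv
  have hupd : ∀ t i b, v (Function.update t i b) = v t + (b - t i) • u i := by
    intro t i b
    have : ∑ m, Function.update t i b m • u m = ∑ m, t m • u m + (b - t i) • u i := by
      rw [← Finset.add_sum_erase _ _ (Finset.mem_univ i),
        ← Finset.add_sum_erase (a := i) Finset.univ (fun m => t m • u m) (Finset.mem_univ i),
        Function.update_self, Finset.sum_congr rfl (g := fun m => t m • u m)
        (fun m hm => by rw [Function.update_of_ne (Finset.ne_of_mem_erase hm)])]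
      module
    simp only [hv, this]; abel
  have hmem : ∀ t, (∀ i, t i = 0 ∨ t i = 1) →
      v t ∈ {y | ∃ t : Fin 3 → ℝ, (∀ i, t i = 0 ∨ t i = 1) ∧ y = v t} := fun t ht => ⟨t, ht, rfl⟩
  have hupd01 : ∀ (t : Fin 3 → ℝ) i b, (∀ i, t i = 0 ∨ t i = 1) → (b = 0 ∨ b = 1) →
      ∀ m, Function.update t i b m = 0 ∨ Function.update t i b m = 1 := by
    intro t i b ht hb m
    by_cases hm : m = i
    · subst hm; simpa using hb
    · simpa [hm] using ht m
  have hz : ∀ i : Fin 3, (0 : Fin 3 → ℝ) i = 0 ∨ (0 : Fin 3 → ℝ) i = 1 := fun _ => Or.inl rfl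
  have hspan : vectorSpan ℝ {y | ∃ t : Fin 3 → ℝ, (∀ i, t i = 0 ∨ t i = 1) ∧ y = v t} = ⊤ := by
    refine vectorSpan_eq_top (q := v 0) hu.linearIndependent (hmem 0 hz) fun i => ?_
    have := hupd 0 i 1
    simp only [Pi.zero_apply, sub_zero, one_smul] at this
    rw [← this]
    exact hmem _ (hupd01 0 i 1 hz (Or.inr rfl))
  refine isUniformPolyhedron_convexHull hfin ⟨v 0, hmem 0 hz⟩ hspan ?_ ?_
  · intro T l M hT
    obtain ⟨y₀, hy₀⟩ := hT.nonempty
    obtain ⟨⟨t₀, ht₀, rfl⟩, hM₀⟩ := (hT.mem_iff _).1 hy₀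
    obtain ⟨i, hi⟩ : ∃ i, l (u i) ≠ 0 := by
      by_contra! hn
      refine hT.ne_top hspan ?_
      have hl : ∀ t, l (v t) = l c := fun t => by simp [hv, map_sum, hn]
      rintro _ ⟨t, ht, rfl⟩
      exact (hT.mem_iff _).2 ⟨hmem t ht, by rw [hl, ← hM₀, hl]⟩
    obtain ⟨j, k, hij, hik, hjk, hall⟩ := exists_others i
    have hfix : ∀ t, (∀ i, t i = 0 ∨ t i = 1) → v t ∈ T → t i = if 0 < l (u i) then 1 else 0 := by
      intro t ht htT
      have hM := ((hT.mem_iff _).1 htT).2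
      have hflip := hT.le _ (hmem _ (hupd01 t i (if 0 < l (u i) then 1 else 0) ht
        (by split_ifs <;> simp)))
      rw [hupd, map_add, map_smul, smul_eq_mul, hM] at hflip
      split_ifs at hflip ⊢ with hpos
      · rcases ht i with h | h
        · rw [h] at hflip; linarith
        · exact h
      · have hneg : l (u i) < 0 := lt_of_le_of_ne (not_lt.1 hpos) hi
        rcases ht i with h | h
        · exact h
        · rw [h] at hflip; linarith
    set σ : ℝ := if 0 < l (u i) then 1 else 0 with hσ
    have hσ01 : σ = 0 ∨ σ = 1 := by rw [hσ]; split_ifs <;> simp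
    set q := v (Function.update (0 : Fin 3 → ℝ) i σ) with hq
    have hw : ∀ β γ : ℝ, v (Function.update (Function.update (Function.update (0 : Fin 3 → ℝ) i σ) j β) k γ)
        = q + β • u j + γ • u k := by
      intro β γ
      rw [hupd, hupd, Function.update_of_ne hij.symm, Function.update_of_ne hjk.symm,
        Function.update_of_ne hik.symm]
      simp [hq]
    have hsq : ∀ y ∈ ({q, q + u j, q + u k, q + u j + u k} : Set Space), ∃ β γ : ℝ,
        (β = 0 ∨ β = 1) ∧ (γ = 0 ∨ γ = 1) ∧ y = q + β • u j + γ • u k := by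
      rintro y (rfl | rfl | rfl | rfl)
      · exact ⟨0, 0, by simp, by simp, by simp⟩
      · exact ⟨1, 0, by simp, by simp, by simp⟩
      · exact ⟨0, 1, by simp, by simp, by simp⟩
      · exact ⟨1, 1, by simp, by simp, by simp⟩
    have hsub : ∀ y ∈ ({q, q + u j, q + u k, q + u j + u k} : Set Space),
        y ∈ {y | ∃ t : Fin 3 → ℝ, (∀ i, t i = 0 ∨ t i = 1) ∧ y = v t} := by
      intro y hy
      obtain ⟨β, γ, hβ, hγ, rfl⟩ := hsq y hy
      rw [← hw]
      exact hmem _ (hupd01 _ _ _ (hupd01 _ _ _ (hupd01 _ _ _ hz hσ01) hβ) hγ)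
    have hface : IsFaceOf {q, q + u j, q + u k, q + u j + u k} T l M := by
      refine ⟨fun y hy => hT.le y (hsub y hy), fun y => ⟨fun hy => ?_, fun hy => ?_⟩, hT.finrank⟩
      · obtain ⟨⟨t, ht, rfl⟩, hM⟩ := (hT.mem_iff y).1 hy
        refine ⟨?_, hM⟩
        have ht' : t = Function.update (Function.update
            (Function.update (0 : Fin 3 → ℝ) i σ) j (t j)) k (t k) := by
          funext m
          rcases hall m with rfl | rfl | rfl
          · rw [Function.update_of_ne hik, Function.update_of_ne hij, Function.update_self]
            exact hfix t ht hy
          · rw [Function.update_of_ne hjk, Function.update_self]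
          · rw [Function.update_self]
        have e1 : v t = q + t j • u j + t k • u k := (congrArg v ht').trans (hw _ _)
        change v t ∈ _
        rw [e1]
        rcases ht j with e | e <;> rcases ht k with e' | e' <;> rw [e, e'] <;> simp
      · exact (hT.mem_iff y).2 ⟨hsub y hy.1, hy.2⟩
    exact hface.isRegularPolygon_of_square (hu.1 j) (hu.1 k) (hu.2 hjk)
  · set K := convexHull ℝ {y | ∃ t : Fin 3 → ℝ, (∀ i, t i = 0 ∨ t i = 1) ∧ y = v t}
    have hflip : ∀ (t : Fin 3 → ℝ) (i : Fin 3) (b : ℝ), (∀ i, t i = 0 ∨ t i = 1) → (b = 0 ∨ b = 1) →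
        HasSymmetry K (v t) (v (Function.update t i b)) := by
      intro t i b ht hb
      obtain ⟨g, L, hadd, hxy, hinv, -, hfix⟩ := exists_reflection (v t) (v (Function.update t i b))
      by_cases hbt : b = t i
      · rw [hbt, Function.update_eq_self]; exact HasSymmetry.refl _ _
      have hyx : g (v (Function.update t i b)) = v t := by rw [← hxy, hinv]
      have hL : ∀ s s' : Fin 3 → ℝ, s i = s' i → L (v s - v s') = v s - v s' := by
        intro s s' hs
        have e : v s - v s' = ∑ m, (s m - s' m) • u m := by
          simp only [hv, add_sub_add_left_eq_sub, ← Finset.sum_sub_distrib, sub_smul]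
        refine hfix _ ?_
        rw [hupd, sub_add_cancel_left, inner_neg_right, inner_smul_right, e,
          hu.inner_left_fintype, hs, sub_self]
        simp
      refine HasSymmetry.of_involution g hinv ?_ hxy
      rintro _ ⟨s, hs, rfl⟩
      by_cases hst : s i = t i
      · refine ⟨Function.update s i b, hupd01 s i b hs hb, ?_⟩
        have := hadd (v t) (v s - v t)
        rw [hL s t hst, hxy, add_sub_cancel] at this
        rw [this, hupd, hupd, hst]; abel
      · have hsb : s i = b := by
          rcases hs i with e | e <;> rcases ht i with e' | e' <;> rcases hb with e'' | e'' <;>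
            simp_all
        refine ⟨Function.update s i (t i), hupd01 s i (t i) hs (ht i), ?_⟩
        have := hadd (v (Function.update t i b)) (v s - v (Function.update t i b))
        rw [hL s (Function.update t i b) (by simp [hsb]), hyx, add_sub_cancel] at this
        rw [this, hupd, hupd, hsb]; module
    rintro _ ⟨s, hs, rfl⟩ _ ⟨t, ht, rfl⟩
    have h1 := hflip s 0 (t 0) hs (ht 0)
    have hs1 := hupd01 s 0 (t 0) hs (ht 0)
    have h2 := hflip _ 1 (t 1) hs1 (ht 1)
    have h3 := hflip _ 2 (t 2) (hupd01 _ 1 (t 1) hs1 (ht 1)) (ht 2)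
    have e : Function.update (Function.update (Function.update s 0 (t 0)) 1 (t 1)) 2 (t 2) = t := by
      funext m
      fin_cases m <;> simp [Function.update]
    rw [e] at h3
    exact (h1.trans h2).trans h3

end IsCube

/-! ### The four solids are different -/

theorem IsRegularTetrahedron.not_isRegularOctahedron {P : Set Space} (h : IsRegularTetrahedron P) :
    ¬ IsRegularOctahedron P := fun h' => by
  obtain ⟨x, hx, y, hy, e⟩ := h'.exists_norm_sub_sq
  linarith [h.norm_sub_sq_le hx hy]

theorem IsRegularTetrahedron.not_isTriangularPrism {P : Set Space} (h : IsRegularTetrahedron P) :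
    ¬ IsTriangularPrism P := fun h' => by
  obtain ⟨x, hx, y, hy, -, -, -, e, -⟩ := h'.exists_extremePoints
  linarith [h.norm_sub_sq_le hx.1 hy.1]

/-- Diameters do not help, as both are `√2`; the number of vertices at this distance from a given
one does. -/
theorem IsRegularOctahedron.not_isTriangularPrism {P : Set Space} (h : IsRegularOctahedron P) :
    ¬ IsTriangularPrism P := fun h' => by
  obtain ⟨x, hx, y, hy, z, hz, hne, e, e'⟩ := h'.exists_extremePoints
  exact hne (h.extremePoints_subset_unique hx hy hz e e')

theorem IsCube.not_isTriangularPrism {P : Set Space} (h : IsCube P) :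
    ¬ IsTriangularPrism P := fun h' => by
  obtain ⟨x, hx, y, hy, e⟩ := h.exists_norm_sub_sq
  linarith [h'.norm_sub_sq_le hx hy]

/-! ### Stacks of planar lattices -/

theorem inner_ez (x : Space) : inner ℝ ez x = x 2 := by
  simp [ez, PiLp.inner_apply, Fin.sum_univ_three]

theorem ez_apply_two : ez 2 = 1 := by simp [ez]

theorem norm_ez : ‖ez‖ = 1 := by
  rw [← sq_eq_sq₀ (norm_nonneg _) zero_le_one, ← real_inner_self_eq_norm_sq, inner_ez, ez_apply_two]
  norm_num

theorem abs_apply_two_le (x : Space) : |x 2| ≤ ‖x‖ := by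
  have := abs_real_inner_le_norm ez x
  rwa [inner_ez, norm_ez, one_mul] at this

theorem apply_two_sq_le (x : Space) : x 2 ^ 2 ≤ ‖x‖ ^ 2 := by
  rw [← sq_abs]
  gcongr
  exact abs_apply_two_le x

/-- `f₁`, `f₂` generate a horizontal lattice with unit edges, and `τ` is the thickness of the
layers that are separated by layers of thickness `1`. -/
structure IsFrame (f₁ f₂ : Space) (γ τ : ℝ) : Prop where
  apply_two₁ : f₁ 2 = 0
  apply_two₂ : f₂ 2 = 0
  norm_sq : ∀ x y z : ℝ, ‖x • f₁ + y • f₂ + z • ez‖ ^ 2 = x ^ 2 + 2 * γ * x * y + y ^ 2 + z ^ 2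
  exists_coords : ∀ v : Space, ∃ x y z : ℝ, v = x • f₁ + y • f₂ + z • ez
  γ_nonneg : 0 ≤ γ
  γ_le : γ ≤ 1 / 2
  le_τ : 1 / 2 ≤ τ
  τ_lt : τ < 1

/-- The lattice generated by `f₁` and `f₂`. -/
def lattice (f₁ f₂ : Space) : AddSubgroup Space := AddSubgroup.closure {f₁, f₂}

theorem mem_lattice {f₁ f₂ v : Space} :
    v ∈ lattice f₁ f₂ ↔ ∃ i j : ℤ, v = (i : ℝ) • f₁ + (j : ℝ) • f₂ := by
  simp only [lattice, AddSubgroup.mem_closure_pair, Int.cast_smul_eq_zsmul, eq_comm]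

/-- The height of the lower (`false`) or upper (`true`) boundary of the `n`-th layer. -/
noncomputable def levelHeight (τ : ℝ) (n : ℤ) (b : Bool) : ℝ :=
  (n : ℝ) * (τ + 1) + if b then τ else 0

/-- The points of a stack of planar lattices: the `n`-th layer of thickness `τ` shifts the lattice
by `s n`. -/
noncomputable def node (f₁ f₂ : Space) (τ : ℝ) (s : ℤ → Space) (n : ℤ) (b : Bool) (i j : ℤ) :
    Space :=
  partialSum s n + ((n : ℝ) * (τ + 1)) • ez + ((i : ℝ) • f₁ + (j : ℝ) • f₂)
    + if b then s n + τ • ez else 0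

def nodes (f₁ f₂ : Space) (τ : ℝ) (s : ℤ → Space) : Set Space :=
  {v | ∃ n b i j, v = node f₁ f₂ τ s n b i j}

theorem partialSum_apply_two {s : ℤ → Space} (hs : ∀ n, s n 2 = 0) (n : ℤ) :
    partialSum s n 2 = 0 := by
  simp [partialSum, hs]

/-- The bottom of layer `n + 1` lies at distance `1` above the top of layer `n`. -/
theorem node_succ_false (f₁ f₂ : Space) (τ : ℝ) (s : ℤ → Space) (n i j : ℤ) :
    node f₁ f₂ τ s (n + 1) false i j = node f₁ f₂ τ s n true i j + ez := by
  simp only [node, partialSum_succ, Int.cast_add, Int.cast_one, if_true, Bool.false_eq_true,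
    if_false]
  module

theorem node_add (f₁ f₂ : Space) (τ : ℝ) (s : ℤ → Space) (n : ℤ) (b : Bool) (i j k l : ℤ) :
    node f₁ f₂ τ s n b (i + k) (j + l)
      = node f₁ f₂ τ s n b i j + ((k : ℝ) • f₁ + (l : ℝ) • f₂) := by
  simp only [node, Int.cast_add]
  module

theorem node_true (f₁ f₂ : Space) (τ : ℝ) (s : ℤ → Space) (n i j : ℤ) :
    node f₁ f₂ τ s n true i j = node f₁ f₂ τ s n false i j + (s n + τ • ez) := by
  simp [node]

theorem node_mem (f₁ f₂ : Space) (τ : ℝ) (s : ℤ → Space) (n : ℤ) (b : Bool) (i j : ℤ) :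
    node f₁ f₂ τ s n b i j ∈ nodes f₁ f₂ τ s := ⟨n, b, i, j, rfl⟩

theorem node_sub_node_mem (f₁ f₂ : Space) (τ : ℝ) (s : ℤ → Space) (n : ℤ) (b : Bool)
    (i j k l : ℤ) :
    node f₁ f₂ τ s n b i j - node f₁ f₂ τ s n b k l ∈ lattice f₁ f₂ := by
  refine mem_lattice.2 ⟨i - k, j - l, ?_⟩
  simp only [node, Int.cast_sub]
  module

theorem node_true_sub_node_false_mem (f₁ f₂ : Space) (τ : ℝ) (s : ℤ → Space) (n : ℤ)
    (i j k l : ℤ) :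
    node f₁ f₂ τ s n true i j - node f₁ f₂ τ s n false k l - s n - τ • ez ∈ lattice f₁ f₂ := by
  have := node_sub_node_mem f₁ f₂ τ s n false i j k l
  rw [node_true]
  convert this using 1
  abel

theorem add_mem_nodes {f₁ f₂ : Space} {τ : ℝ} {s : ℤ → Space} {v u : Space}
    (hv : v ∈ nodes f₁ f₂ τ s) (hu : u ∈ lattice f₁ f₂) : v + u ∈ nodes f₁ f₂ τ s := by
  obtain ⟨n, b, i, j, rfl⟩ := hv
  obtain ⟨k, l, rfl⟩ := mem_lattice.1 hu
  exact ⟨n, b, i + k, j + l, (node_add ..).symm⟩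

namespace IsFrame

variable {f₁ f₂ : Space} {γ τ : ℝ}

theorem coords_apply_two (hF : IsFrame f₁ f₂ γ τ) (x y z : ℝ) :
    (x • f₁ + y • f₂ + z • ez) 2 = z := by
  simp [hF.apply_two₁, hF.apply_two₂, ez_apply_two]

theorem lattice_apply_two (hF : IsFrame f₁ f₂ γ τ) {u : Space} (hu : u ∈ lattice f₁ f₂) :
    u 2 = 0 := by
  obtain ⟨i, j, rfl⟩ := mem_lattice.1 hu
  simp [hF.apply_two₁, hF.apply_two₂]

theorem node_apply_two (hF : IsFrame f₁ f₂ γ τ) {s : ℤ → Space} (hs : ∀ n, s n 2 = 0) (n : ℤ)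
    (b : Bool) (i j : ℤ) : node f₁ f₂ τ s n b i j 2 = levelHeight τ n b := by
  cases b <;> simp [node, levelHeight, partialSum_apply_two hs, hs, hF.apply_two₁, hF.apply_two₂,
    ez_apply_two]

/-- Consecutive gaps are `τ` and `1` with sum greater than one, so levels at distance at most one
are neighbours. -/
theorem levelHeight_gap (hF : IsFrame f₁ f₂ γ τ) {n n' : ℤ} {b b' : Bool}
    (h0 : levelHeight τ n b < levelHeight τ n' b') (h1 : levelHeight τ n' b' ≤ levelHeight τ n b + 1) :
    (b = false ∧ b' = true ∧ n' = n) ∨ (b = true ∧ b' = false ∧ n' = n + 1) := by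
  have h2 := hF.le_τ
  have h3 := hF.τ_lt
  rcases lt_trichotomy n' n with h | h | h
  · have h' : (n' : ℝ) + 1 ≤ n := by exact_mod_cast h
    cases b <;> cases b' <;> simp [levelHeight] at h0 h1 <;> exfalso <;> nlinarith
  · subst h
    cases b <;> cases b' <;> simp [levelHeight] at h0 h1
    · simp
    · linarith
  · rcases eq_or_lt_of_le (Int.add_one_le_iff.2 h) with h' | h'
    · subst h'
      cases b <;> cases b' <;> simp [levelHeight] at h0 h1 <;> first | (exfalso; nlinarith) | simp
    · have h' : (n : ℝ) + 1 + 1 ≤ n' := by exact_mod_cast h'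
      cases b <;> cases b' <;> simp [levelHeight] at h0 h1 <;> exfalso <;> nlinarith

theorem levelHeight_inj (hF : IsFrame f₁ f₂ γ τ) {n n' : ℤ} {b b' : Bool}
    (h : levelHeight τ n b = levelHeight τ n' b') : n = n' ∧ b = b' := by
  have h2 := hF.le_τ
  have h3 := hF.τ_lt
  rcases lt_trichotomy n' n with h | h | h
  · have h' : (n' : ℝ) + 1 ≤ n := by exact_mod_cast h
    cases b <;> cases b' <;>
      simp only [levelHeight, if_true, Bool.false_eq_true, if_false] at h <;> exfalso <;> nlinarith
  · subst h
    cases b <;> cases b' <;> simp [levelHeight] at h <;> first | (exfalso; linarith) | simp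
  · have h' : (n : ℝ) + 1 ≤ n' := by exact_mod_cast h
    cases b <;> cases b' <;>
      simp only [levelHeight, if_true, Bool.false_eq_true, if_false] at h <;> exfalso <;> nlinarith

/-- The bounds on `γ` make the planar quadratic form positive definite, so coordinates are unique.
-/
theorem mem_lattice_coords (hF : IsFrame f₁ f₂ γ τ) {x y : ℝ}
    (h : x • f₁ + y • f₂ ∈ lattice f₁ f₂) : ∃ i j : ℤ, x = i ∧ y = j := by
  obtain ⟨i, j, hij⟩ := mem_lattice.1 h
  have h1 := hF.norm_sq (x - i) (y - j) 0
  have e : (x - i) • f₁ + (y - j) • f₂ + (0 : ℝ) • ez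
      = (x • f₁ + y • f₂) - ((i : ℝ) • f₁ + (j : ℝ) • f₂) := by module
  rw [e, hij, sub_self, norm_zero] at h1
  have h2 : (x - i) ^ 2 + (y - j) ^ 2 = 0 := by
    have := hF.γ_nonneg
    have := hF.γ_le
    nlinarith [sq_nonneg (x - i), sq_nonneg (y - j), sq_nonneg (x - i + (y - j)),
      mul_nonneg hF.γ_nonneg (sq_nonneg (x - i + (y - j)))]
  refine ⟨i, j, ?_, ?_⟩ <;> nlinarith [sq_nonneg (x - i), sq_nonneg (y - j)]

theorem node_injective (hF : IsFrame f₁ f₂ γ τ) {s : ℤ → Space} (hs : ∀ n, s n 2 = 0)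
    {n n' : ℤ} {b b' : Bool} {i j i' j' : ℤ}
    (h : node f₁ f₂ τ s n b i j = node f₁ f₂ τ s n' b' i' j') :
    n = n' ∧ b = b' ∧ i = i' ∧ j = j' := by
  obtain ⟨rfl, rfl⟩ : n = n' ∧ b = b' := hF.levelHeight_inj (by
    rw [← hF.node_apply_two hs n b i j, h, hF.node_apply_two hs])
  have h1 := hF.norm_sq (i - i' : ℤ) (j - j' : ℤ) 0
  have e : ((i - i' : ℤ) : ℝ) • f₁ + ((j - j' : ℤ) : ℝ) • f₂ + (0 : ℝ) • ez
      = node f₁ f₂ τ s n b i j - node f₁ f₂ τ s n b i' j' := by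
    simp only [node, Int.cast_sub]
    module
  rw [e, h, sub_self, norm_zero] at h1
  have h2 : (((i - i' : ℤ) : ℝ)) ^ 2 + ((j - j' : ℤ) : ℝ) ^ 2 = 0 := by
    nlinarith [sq_nonneg (((i - i' : ℤ) : ℝ)), sq_nonneg (((j - j' : ℤ) : ℝ)), hF.γ_nonneg, hF.γ_le,
      sq_nonneg (((i - i' : ℤ) : ℝ) + ((j - j' : ℤ) : ℝ)),
      mul_nonneg hF.γ_nonneg (sq_nonneg (((i - i' : ℤ) : ℝ) + ((j - j' : ℤ) : ℝ)))]
  have h3 : ((i - i' : ℤ) : ℝ) = 0 := by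
    nlinarith [sq_nonneg (((i - i' : ℤ) : ℝ)), sq_nonneg (((j - j' : ℤ) : ℝ))]
  have h4 : ((j - j' : ℤ) : ℝ) = 0 := by
    nlinarith [sq_nonneg (((i - i' : ℤ) : ℝ)), sq_nonneg (((j - j' : ℤ) : ℝ))]
  have h5 : i - i' = 0 := by exact_mod_cast h3
  have h6 : j - j' = 0 := by exact_mod_cast h4
  exact ⟨rfl, rfl, by omega, by omega⟩

theorem finite_nodes_inter_closedBall (hF : IsFrame f₁ f₂ γ τ) {s : ℤ → Space}
    (hs : ∀ n, s n 2 = 0) (x : Space) (r : ℝ) :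
    (nodes f₁ f₂ τ s ∩ Metric.closedBall x r).Finite := by
  have hlevel : ∀ n b, ({v | ∃ i j, v = node f₁ f₂ τ s n b i j} ∩ Metric.closedBall x r).Finite := by
    intro n b
    set R : ℝ := ‖x - node f₁ f₂ τ s n b 0 0‖ + r with hR
    set N : ℤ := ⌈2 * R + 1⌉ with hN
    refine (((Set.finite_Icc (-N) N).prod (Set.finite_Icc (-N) N)).image
      fun q : ℤ × ℤ => node f₁ f₂ τ s n b q.1 q.2).subset ?_
    rintro v ⟨⟨i, j, rfl⟩, hv⟩
    rw [mem_closedBall_iff_norm] at hv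
    have h1 : ‖(i : ℝ) • f₁ + (j : ℝ) • f₂ + (0 : ℝ) • ez‖ ≤ R := by
      have : (i : ℝ) • f₁ + (j : ℝ) • f₂ + (0 : ℝ) • ez
          = (x - node f₁ f₂ τ s n b 0 0) + (node f₁ f₂ τ s n b i j - x) := by
        simp only [node, Int.cast_zero]
        module
      rw [this]
      exact (norm_add_le _ _).trans (by rw [hR]; gcongr)
    have hR0 : 0 ≤ R := (norm_nonneg _).trans h1
    have h2 : (i : ℝ) ^ 2 + 2 * γ * i * j + (j : ℝ) ^ 2 ≤ R ^ 2 := by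
      have := hF.norm_sq i j 0
      nlinarith [norm_nonneg ((i : ℝ) • f₁ + (j : ℝ) • f₂ + (0 : ℝ) • ez)]
    -- The form equals `γ (i + j)² + (1 - γ) (i² + j²)`, which is at least half of `i² + j²` because
    -- `0 ≤ γ ≤ 1 / 2`.
    have h3 : (i : ℝ) ^ 2 + (j : ℝ) ^ 2 ≤ 2 * R ^ 2 := by
      nlinarith [hF.γ_le, mul_nonneg hF.γ_nonneg (sq_nonneg ((i : ℝ) + j)), sq_nonneg (i : ℝ),
        sq_nonneg (j : ℝ)]
    have hbound : ∀ m : ℤ, (m : ℝ) ^ 2 ≤ 2 * R ^ 2 → m ∈ Set.Icc (-N) N := by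
      intro m hm
      have h4 : |(m : ℝ)| ≤ 2 * R + 1 := abs_le_of_sq_le_sq (by nlinarith) (by linarith)
      have h5 : |(m : ℝ)| ≤ (N : ℝ) := h4.trans (Int.le_ceil _)
      have h6 : |m| ≤ N := by exact_mod_cast h5
      exact abs_le.1 h6
    exact ⟨(i, j), ⟨hbound i (by nlinarith [sq_nonneg (j : ℝ)]),
      hbound j (by nlinarith [sq_nonneg (i : ℝ)])⟩, rfl⟩
  set N : ℤ := ⌈|x 2| + r + 1⌉ with hN
  refine ((Set.finite_Icc (-N) N).biUnion fun n _ =>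
    (hlevel n false).union (hlevel n true)).subset ?_
  rintro v ⟨⟨n, b, i, j, rfl⟩, hv⟩
  rw [Set.mem_iUnion₂]
  refine ⟨n, ?_, ?_⟩
  · rw [mem_closedBall_iff_norm] at hv
    have h1 := (abs_apply_two_le _).trans hv
    rw [PiLp.sub_apply, hF.node_apply_two hs] at h1
    have h2 : |levelHeight τ n b| ≤ |x 2| + r := by
      have := abs_sub_abs_le_abs_sub (levelHeight τ n b) (x 2)
      linarith
    have h3 : |(n : ℝ)| ≤ |x 2| + r + 1 := by
      rw [abs_le] at h2 ⊢
      have h4 := hF.le_τ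
      have h5 := hF.τ_lt
      rcases le_or_gt 0 (n : ℝ) with hn | hn <;> cases b <;> simp [levelHeight] at h2 <;>
        constructor <;> nlinarith
    have h5 : |(n : ℝ)| ≤ (N : ℝ) := h3.trans (Int.le_ceil _)
    have h6 : |n| ≤ N := by exact_mod_cast h5
    exact abs_le.1 h6
  · cases b
    · exact Or.inl ⟨⟨i, j, rfl⟩, hv⟩
    · exact Or.inr ⟨⟨i, j, rfl⟩, hv⟩

/-- Only the two boundary levels of a layer of thickness `τ` matter for the spheres centred
in it. -/
theorem isDelaunay_of_layer (hF : IsFrame f₁ f₂ γ τ) {s : ℤ → Space} (hs : ∀ n, s n 2 = 0)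
    {n : ℤ} {c : Space} {ζ R : ℝ} {S : Set Space} (hc : c 2 = n * (τ + 1) + ζ) (h0 : 0 ≤ ζ)
    (h1 : ζ ≤ τ) (hR : R < 1) (hS : ∀ v ∈ S, v ∈ nodes f₁ f₂ τ s ∧ ‖v - c‖ ^ 2 = R)
    (hbot : ∀ i j, node f₁ f₂ τ s n false i j ∈ S ∨ R < ‖node f₁ f₂ τ s n false i j - c‖ ^ 2)
    (htop : ∀ i j, node f₁ f₂ τ s n true i j ∈ S ∨ R < ‖node f₁ f₂ τ s n true i j - c‖ ^ 2) :
    IsDelaunay (nodes f₁ f₂ τ s) S c R := by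
  refine ⟨fun v hv => (hS v hv).1, hR, fun v hv => (hS v hv).2, ?_⟩
  rintro _ ⟨m, b, i, j, rfl⟩
  by_cases hm : m = n
  · subst hm
    cases b
    · exact hbot i j
    · exact htop i j
  -- Any other layer is separated from this one by a spacer of thickness `1`, so its levels are at
  -- vertical distance at least one from the centre.
  · right
    refine hR.trans_le (le_trans ?_ (apply_two_sq_le _))
    rw [PiLp.sub_apply, hF.node_apply_two hs, hc]
    have h4 := hF.le_τ
    have h5 := hF.τ_lt
    rcases lt_or_gt_of_ne hm with h | h
    · have h' : (m : ℝ) + 1 ≤ n := by exact_mod_cast h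
      have : levelHeight τ m b - (n * (τ + 1) + ζ) ≤ -1 := by
        cases b <;> simp [levelHeight] <;> nlinarith
      nlinarith
    · have h' : (n : ℝ) + 1 ≤ m := by exact_mod_cast h
      have : 1 ≤ levelHeight τ m b - (n * (τ + 1) + ζ) := by
        cases b <;> simp [levelHeight] <;> nlinarith
      nlinarith

/-- The analogue of `isDelaunay_of_layer` for the layers of thickness `1`. -/
theorem isDelaunay_of_spacer (hF : IsFrame f₁ f₂ γ τ) {s : ℤ → Space} (hs : ∀ n, s n 2 = 0)
    {n : ℤ} {c : Space} {R : ℝ} {S : Set Space} (hc : c 2 = n * (τ + 1) + τ + 1 / 2)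
    (hR : R < 1) (hS : ∀ v ∈ S, v ∈ nodes f₁ f₂ τ s ∧ ‖v - c‖ ^ 2 = R)
    (hbot : ∀ i j, node f₁ f₂ τ s n true i j ∈ S ∨ R < ‖node f₁ f₂ τ s n true i j - c‖ ^ 2)
    (htop : ∀ i j, node f₁ f₂ τ s n true i j + ez ∈ S ∨
      R < ‖node f₁ f₂ τ s n true i j + ez - c‖ ^ 2) :
    IsDelaunay (nodes f₁ f₂ τ s) S c R := by
  refine ⟨fun v hv => (hS v hv).1, hR, fun v hv => (hS v hv).2, ?_⟩
  rintro _ ⟨m, b, i, j, rfl⟩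
  by_cases hm : m = n ∧ b = true
  · obtain ⟨rfl, rfl⟩ := hm
    exact hbot i j
  by_cases hm' : m = n + 1 ∧ b = false
  · obtain ⟨rfl, rfl⟩ := hm'
    rw [node_succ_false]
    exact htop i j
  right
  refine hR.trans_le (le_trans ?_ (apply_two_sq_le _))
  rw [PiLp.sub_apply, hF.node_apply_two hs, hc]
  have h4 := hF.le_τ
  have h5 := hF.τ_lt
  -- The nearest levels beyond the two faces of the spacer have vertical distance `τ + 1 / 2` from
  -- its middle; this is where `1 / 2 ≤ τ` is needed.
  rcases lt_or_ge n m with h | h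
  · have h' : (n : ℝ) + 1 ≤ m := by exact_mod_cast h
    have : 1 ≤ levelHeight τ m b - (n * (τ + 1) + τ + 1 / 2) := by
      cases b
      · have h'' : n + 1 + 1 ≤ m := by
          simp only [and_true] at hm'
          omega
        have h'' : (n : ℝ) + 1 + 1 ≤ m := by exact_mod_cast h''
        simp [levelHeight]; nlinarith
      · simp [levelHeight]; nlinarith
    nlinarith
  · have h' : (m : ℝ) ≤ n := by exact_mod_cast h
    have : levelHeight τ m b - (n * (τ + 1) + τ + 1 / 2) ≤ -1 := by
      cases b
      · simp [levelHeight]; nlinarith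
      · have h'' : m + 1 ≤ n := by
          simp only [and_true] at hm
          omega
        have h'' : (m : ℝ) + 1 ≤ n := by exact_mod_cast h''
        simp [levelHeight]; nlinarith
    nlinarith

/-- Every point lies over the fundamental cell of a lattice point of its layer. The sign `η` allows
to reflect the fundamental cell. -/
theorem exists_layer_coords (hF : IsFrame f₁ f₂ γ τ) {s : ℤ → Space} (hs : ∀ n, s n 2 = 0)
    {η : ℤ → ℤ} (hη : ∀ n, η n = 1 ∨ η n = -1) (v : Space) :
    ∃ (n i j : ℤ) (x y t : ℝ), 0 ≤ x ∧ x ≤ 1 ∧ 0 ≤ y ∧ y ≤ 1 ∧ 0 ≤ t ∧ t ≤ 1 ∧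
      (v = node f₁ f₂ τ s n false i j + (x • (η n : ℝ) • f₁ + y • (η n : ℝ) • f₂)
          + t • (s n + τ • ez) ∨
        v = node f₁ f₂ τ s n true i j + (x • f₁ + y • f₂) + t • ez) := by
  have hτ : 0 < τ := by linarith [hF.le_τ]
  have h4 : (0 : ℝ) < τ + 1 := by linarith
  set n : ℤ := ⌊v 2 / (τ + 1)⌋ with hn
  set ρ : ℝ := v 2 - n * (τ + 1) with hρ
  have hρ0 : 0 ≤ ρ := by
    have := Int.floor_le (v 2 / (τ + 1))
    rw [le_div_iff₀ h4] at this
    linarith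
  have hρ1 : ρ < τ + 1 := by
    have := Int.lt_floor_add_one (v 2 / (τ + 1))
    rw [div_lt_iff₀ h4] at this
    linarith
  rcases le_or_gt ρ τ with hρτ | hρτ
  · obtain ⟨x, y, z, hxyz⟩ :=
      hF.exists_coords (v - node f₁ f₂ τ s n false 0 0 - (ρ / τ) • (s n + τ • ez))
    have hz : z = 0 := by
      have h5 := congrArg (fun u : Space => u 2) hxyz
      simp only [hF.coords_apply_two, PiLp.sub_apply, hF.node_apply_two hs, PiLp.smul_apply,
        PiLp.add_apply, hs, ez_apply_two, smul_eq_mul] at h5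
      rw [← h5, levelHeight, hρ]
      simp only [Bool.false_eq_true, if_false]
      field_simp
      ring
    have hηη : (η n : ℝ) * η n = 1 := by rcases hη n with h | h <;> rw [h] <;> norm_num
    -- Integer and fractional parts are taken of `η n * x` and `η n * y`, that is, of the
    -- coordinates along the possibly reversed generators.
    refine ⟨n, η n * ⌊η n * x⌋, η n * ⌊η n * y⌋, Int.fract (η n * x), Int.fract (η n * y), ρ / τ,
      Int.fract_nonneg _, (Int.fract_lt_one _).le, Int.fract_nonneg _, (Int.fract_lt_one _).le,
      by positivity, (div_le_one hτ).2 hρτ, Or.inl ?_⟩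
    have e1 : v = node f₁ f₂ τ s n false 0 0 + (x • f₁ + y • f₂) + (ρ / τ) • (s n + τ • ez) := by
      rw [hz] at hxyz
      rw [sub_sub, sub_eq_iff_eq_add] at hxyz
      rw [hxyz]
      module
    have e2 : ∀ x : ℝ, (Int.fract (η n * x)) * (η n : ℝ) = x - η n * ⌊η n * x⌋ := by
      intro x
      rw [Int.fract]
      linear_combination x * hηη
    rw [smul_smul, smul_smul, e2, e2]
    conv_lhs => rw [e1]
    simp only [node, Int.cast_mul, Int.cast_zero]
    module
  · obtain ⟨x, y, z, hxyz⟩ :=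
      hF.exists_coords (v - node f₁ f₂ τ s n true 0 0 - (ρ - τ) • ez)
    have hz : z = 0 := by
      have h5 := congrArg (fun u : Space => u 2) hxyz
      simp only [hF.coords_apply_two, PiLp.sub_apply, hF.node_apply_two hs, PiLp.smul_apply,
        ez_apply_two, smul_eq_mul] at h5
      rw [← h5, levelHeight, hρ]
      simp only [if_true]
      ring
    refine ⟨n, ⌊x⌋, ⌊y⌋, Int.fract x, Int.fract y, ρ - τ,
      Int.fract_nonneg _, (Int.fract_lt_one _).le, Int.fract_nonneg _, (Int.fract_lt_one _).le,
      by linarith, by linarith, Or.inr ?_⟩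
    have e1 : v = node f₁ f₂ τ s n true 0 0 + (x • f₁ + y • f₂) + (ρ - τ) • ez := by
      rw [hz] at hxyz
      rw [sub_sub, sub_eq_iff_eq_add] at hxyz
      rw [hxyz]
      module
    conv_lhs => rw [e1]
    simp only [node, Int.cast_zero, Int.fract]
    module

end IsFrame

/-! ### Isometries between stacks of lattices -/

namespace IsFrame

variable {f₁ f₂ : Space} {γ τ : ℝ}

/-- Since layers of different thickness alternate, no vertical direction is symmetric at a
node. -/
theorem not_pos_of_symmetric (hF : IsFrame f₁ f₂ γ τ) {s : ℤ → Space} (hs : ∀ n, s n 2 = 0)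
    {v u : Space} (hv : v ∈ nodes f₁ f₂ τ s) (h1 : v + u ∈ nodes f₁ f₂ τ s)
    (h2 : v - u ∈ nodes f₁ f₂ τ s) (hu : ‖u‖ = 1) : ¬ 0 < u 2 := by
  intro hpos
  have hu1 : u 2 ≤ 1 := (le_abs_self _).trans (hu ▸ abs_apply_two_le u)
  obtain ⟨n, b, i, j, rfl⟩ := hv
  obtain ⟨n₁, b₁, i₁, j₁, h1⟩ := h1
  obtain ⟨n₂, b₂, i₂, j₂, h2⟩ := h2
  have e1 := congrArg (fun u : Space => u 2) h1
  have e2 := congrArg (fun u : Space => u 2) h2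
  simp only [PiLp.add_apply, PiLp.sub_apply, hF.node_apply_two hs] at e1 e2
  -- The levels of `v + u` and `v - u` are the neighbours of the level of `v`, at the same distance
  -- `u 2`; but one of these gaps is `τ` and the other is `1`.
  have g1 := hF.levelHeight_gap (n := n) (b := b) (n' := n₁) (b' := b₁) (by linarith) (by linarith)
  have g2 := hF.levelHeight_gap (n := n₂) (b := b₂) (n' := n) (b' := b) (by linarith) (by linarith)
  have h3 := hF.τ_lt
  rcases g1 with ⟨rfl, rfl, rfl⟩ | ⟨rfl, rfl, rfl⟩ <;>
    rcases g2 with ⟨rfl, h, rfl⟩ | ⟨rfl, h, rfl⟩ <;> simp [levelHeight] at h e1 e2 <;> linarith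

theorem apply_two_eq_zero_of_symmetric (hF : IsFrame f₁ f₂ γ τ) {s : ℤ → Space}
    (hs : ∀ n, s n 2 = 0) {v u : Space} (hv : v ∈ nodes f₁ f₂ τ s) (h1 : v + u ∈ nodes f₁ f₂ τ s)
    (h2 : v - u ∈ nodes f₁ f₂ τ s) (hu : ‖u‖ = 1) : u 2 = 0 := by
  have a1 := hF.not_pos_of_symmetric hs hv h1 h2 hu
  have a2 := hF.not_pos_of_symmetric hs hv (u := -u) (by rwa [← sub_eq_add_neg])
    (by rwa [sub_neg_eq_add]) (by rwa [norm_neg])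
  rw [PiLp.neg_apply] at a2
  linarith

theorem norm_f₁ (hF : IsFrame f₁ f₂ γ τ) : ‖f₁‖ = 1 := by
  have := hF.norm_sq 1 0 0
  rw [← sq_eq_sq₀ (norm_nonneg _) zero_le_one]
  simpa using this

theorem norm_f₂ (hF : IsFrame f₁ f₂ γ τ) : ‖f₂‖ = 1 := by
  have := hF.norm_sq 0 1 0
  rw [← sq_eq_sq₀ (norm_nonneg _) zero_le_one]
  simpa using this

/-- An isometry between two stacks preserves the vertical direction. -/
theorem exists_apply_two_eq (hF : IsFrame f₁ f₂ γ τ) {s s' : ℤ → Space}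
    (hs' : ∀ n, s' n 2 = 0) {g : Space ≃ᵃⁱ[ℝ] Space}
    (hg : g '' nodes f₁ f₂ τ s = nodes f₁ f₂ τ s') :
    ∃ ε : ℝ, (ε = 1 ∨ ε = -1) ∧ g.linearIsometryEquiv ez = ε • ez ∧
      ∀ x, g.linearIsometryEquiv x 2 = ε * x 2 := by
  set A := g.linearIsometryEquiv with hA
  have hv := node_mem f₁ f₂ τ s 0 false 0 0
  -- A lattice vector can be added to and subtracted from any node, and the isometry transports this
  -- property; a unit vector with it must be horizontal.
  have hmem : ∀ u, u ∈ lattice f₁ f₂ → ‖u‖ = 1 → (A u) 2 = 0 := by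
    intro u hu hu1
    have k : ∀ u, u ∈ lattice f₁ f₂ → g (node f₁ f₂ τ s 0 false 0 0) + A u ∈ nodes f₁ f₂ τ s' :=
      fun u hu => by
        rw [← isometry_map_add, ← hg]
        exact ⟨_, add_mem_nodes hv hu, rfl⟩
    have k0 : g (node f₁ f₂ τ s 0 false 0 0) ∈ nodes f₁ f₂ τ s' := by rw [← hg]; exact ⟨_, hv, rfl⟩
    refine hF.apply_two_eq_zero_of_symmetric hs' k0 (k u hu) ?_ (by rw [A.norm_map, hu1])
    rw [sub_eq_add_neg, ← map_neg]
    exact k _ (neg_mem hu)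
  have hf1 : A f₁ 2 = 0 := hmem f₁ (mem_lattice.2 ⟨1, 0, by simp⟩) hF.norm_f₁
  have hf2 : A f₂ 2 = 0 := hmem f₂ (mem_lattice.2 ⟨0, 1, by simp⟩) hF.norm_f₂
  obtain ⟨x, y, z, hxyz⟩ := hF.exists_coords (A.symm ez)
  have hin : ∀ v : Space, inner ℝ (A.symm ez) v = A v 2 := fun v => by
    rw [← inner_ez, ← A.inner_map_map, A.apply_symm_apply]
  -- The horizontal part of the preimage of `ez` is orthogonal to that preimage, since its image is
  -- horizontal; so it is orthogonal to itself.
  have hW : x • f₁ + y • f₂ = 0 := by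
    have h1 : inner ℝ (A.symm ez) (x • f₁ + y • f₂) = 0 := by
      rw [hin]; simp [hf1, hf2]
    rw [hxyz, inner_add_left, inner_smul_left, inner_ez, real_inner_self_eq_norm_sq] at h1
    simpa [hF.apply_two₁, hF.apply_two₂] using h1
  rw [hW, zero_add] at hxyz
  have hz : z = 1 ∨ z = -1 := by
    have h1 : ‖A.symm ez‖ = 1 := by rw [LinearIsometryEquiv.norm_map, norm_ez]
    rw [hxyz, norm_smul, norm_ez, mul_one, Real.norm_eq_abs] at h1
    exact (abs_eq zero_le_one).1 h1
  refine ⟨z, hz, ?_, fun v => ?_⟩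
  · have h1 : ez = z • A ez := by rw [← map_smul, ← hxyz, A.apply_symm_apply]
    have h2 : z • ez = (z * z) • A ez := by rw [mul_smul, ← h1]
    rw [h2]
    rcases hz with rfl | rfl <;> simp
  · rw [← hin, hxyz, inner_smul_left, inner_ez]; simp

/-- An isometry between two stacks maps layers to layers. -/
theorem exists_layer_map (hF : IsFrame f₁ f₂ γ τ) {s s' : ℤ → Space} (hs : ∀ n, s n 2 = 0)
    (hs' : ∀ n, s' n 2 = 0) {g : Space ≃ᵃⁱ[ℝ] Space}
    (hg : g '' nodes f₁ f₂ τ s = nodes f₁ f₂ τ s') :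
    ∃ k : ℤ, (∀ u, u ∈ lattice f₁ f₂ ↔ g.linearIsometryEquiv u ∈ lattice f₁ f₂) ∧
      (((∀ x, g x 2 = x 2 + k * (τ + 1)) ∧
          ∀ n, g.linearIsometryEquiv (s n) - s' (n + k) ∈ lattice f₁ f₂) ∨
        ((∀ x, g x 2 = k * (τ + 1) + τ - x 2) ∧
          ∀ n, g.linearIsometryEquiv (s n) + s' (-n + k) ∈ lattice f₁ f₂)) := by
  obtain ⟨ε, hε, hAez, hA⟩ := hF.exists_apply_two_eq hs' hg
  set A := g.linearIsometryEquiv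
  have hε2 : ε ≠ 0 := by rcases hε with rfl | rfl <;> norm_num
  have hgx : ∀ x, g x 2 = ε * x 2 + g 0 2 := fun x => by
    have := isometry_map_add g 0 x
    rw [zero_add] at this
    rw [this, PiLp.add_apply, hA, add_comm]
  have hnode : ∀ n b i j, ∃ n' b' i' j',
      g (node f₁ f₂ τ s n b i j) = node f₁ f₂ τ s' n' b' i' j' := fun n b i j => by
    have : g (node f₁ f₂ τ s n b i j) ∈ nodes f₁ f₂ τ s' := by
      rw [← hg]; exact ⟨_, node_mem .., rfl⟩
    exact this
  have hlat : ∀ u, u ∈ lattice f₁ f₂ ↔ A u ∈ lattice f₁ f₂ := by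
    intro u
    obtain ⟨n, b, i, j, h⟩ := hnode 0 false 0 0
    constructor
    · intro hu
      have h1 : g (node f₁ f₂ τ s 0 false 0 0 + u) ∈ nodes f₁ f₂ τ s' := by
        rw [← hg]; exact ⟨_, add_mem_nodes (node_mem ..) hu, rfl⟩
      obtain ⟨n', b', i', j', h'⟩ := h1
      have h2 : A u = node f₁ f₂ τ s' n' b' i' j' - node f₁ f₂ τ s' n b i j := by
        rw [← h', ← h, isometry_map_add, add_sub_cancel_left]
      have h3 := congrArg (fun u : Space => u 2) h2
      simp only [hA, hF.lattice_apply_two hu, mul_zero, PiLp.sub_apply, hF.node_apply_two hs'] at h3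
      obtain ⟨rfl, rfl⟩ := hF.levelHeight_inj (sub_eq_zero.1 h3.symm)
      rw [h2]
      exact node_sub_node_mem f₁ f₂ τ _ _ _ _ _ _ _
    · intro hu
      have h1 : g (node f₁ f₂ τ s 0 false 0 0 + u) ∈ nodes f₁ f₂ τ s' := by
        rw [isometry_map_add, h]
        exact add_mem_nodes (node_mem ..) hu
      rw [← hg, g.injective.mem_set_image] at h1
      obtain ⟨n', b', i', j', h'⟩ := h1
      have h2 : u = node f₁ f₂ τ s n' b' i' j' - node f₁ f₂ τ s 0 false 0 0 := by
        rw [← h', add_sub_cancel_left]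
      have hu0 : u 2 = 0 := by
        have := hA u
        rw [hF.lattice_apply_two hu] at this
        rcases mul_eq_zero.1 this.symm with h | h
        · exact absurd h hε2
        · exact h
      have h3 := congrArg (fun u : Space => u 2) h2
      simp only [hu0, PiLp.sub_apply, hF.node_apply_two hs] at h3
      obtain ⟨rfl, rfl⟩ := hF.levelHeight_inj (sub_eq_zero.1 h3.symm)
      rw [h2]
      exact node_sub_node_mem f₁ f₂ τ _ _ _ _ _ _ _
  obtain ⟨n₀, b₀, i₀, j₀, h₀⟩ := hnode 0 false 0 0
  obtain ⟨n₁, b₁, i₁, j₁, h₁⟩ := hnode 0 true 0 0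
  have h3 := hF.τ_lt
  have h3' := hF.le_τ
  have e0 := hgx (node f₁ f₂ τ s 0 false 0 0)
  have e1 := hgx (node f₁ f₂ τ s 0 true 0 0)
  rw [h₀, hF.node_apply_two hs, hF.node_apply_two hs'] at e0
  rw [h₁, hF.node_apply_two hs, hF.node_apply_two hs'] at e1
  have z0 : levelHeight τ 0 false = 0 := by simp [levelHeight]
  have z1 : levelHeight τ 0 true = τ := by simp [levelHeight]
  rw [z0, mul_zero, zero_add] at e0
  rw [z1] at e1
  have hdiff : ∀ n, g (node f₁ f₂ τ s n true 0 0) - g (node f₁ f₂ τ s n false 0 0)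
      = A (s n) + (τ * ε) • ez := fun n => by
    rw [node_true, isometry_map_add, add_sub_cancel_left, map_add, map_smul, hAez, smul_smul]
  -- The two levels of layer `0` go to levels at distance `τ < 1`. These bound a layer and not a
  -- spacer, in the same order if `ε = 1` and in the opposite order if `ε = -1`.
  rcases hε with rfl | rfl
  · have hk : g 0 2 = n₀ * (τ + 1) := by
      rcases hF.levelHeight_gap (n := n₀) (b := b₀) (n' := n₁) (b' := b₁) (by linarith)
        (by linarith) with ⟨rfl, rfl, rfl⟩ | ⟨rfl, rfl, rfl⟩
      · rw [← e0]; simp [levelHeight]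
      · exfalso
        simp [levelHeight] at e0 e1
        linarith
    refine ⟨n₀, hlat, Or.inl ⟨fun x => by rw [hgx, hk, one_mul], fun n => ?_⟩⟩
    have hlev : ∀ b, ∃ i j, g (node f₁ f₂ τ s n b 0 0) = node f₁ f₂ τ s' (n + n₀) b i j := by
      intro b
      obtain ⟨n', b', i', j', h⟩ := hnode n b 0 0
      have h2 := hgx (node f₁ f₂ τ s n b 0 0)
      rw [h, hF.node_apply_two hs, hF.node_apply_two hs', hk] at h2
      have : levelHeight τ n' b' = levelHeight τ (n + n₀) b := by
        rw [h2]; simp only [levelHeight]; push_cast; ring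
      obtain ⟨rfl, rfl⟩ := hF.levelHeight_inj this
      exact ⟨i', j', h⟩
    obtain ⟨i, j, ht⟩ := hlev true
    obtain ⟨k, l, hb⟩ := hlev false
    have h2 := node_true_sub_node_false_mem f₁ f₂ τ s' (n + n₀) i j k l
    rw [← ht, ← hb, hdiff] at h2
    convert h2 using 1
    module
  · have hk : g 0 2 = n₁ * (τ + 1) + τ := by
      rcases hF.levelHeight_gap (n := n₁) (b := b₁) (n' := n₀) (b' := b₀) (by linarith)
        (by linarith) with ⟨rfl, rfl, rfl⟩ | ⟨rfl, rfl, rfl⟩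
      · rw [← e0]; simp [levelHeight]
      · exfalso
        simp [levelHeight] at e0 e1
        linarith
    refine ⟨n₁, hlat, Or.inr ⟨fun x => by rw [hgx, hk]; ring, fun n => ?_⟩⟩
    -- Bottom and top change places, so the shift of the image layer is traversed backwards and
    -- enters with the opposite sign.
    have hlev : ∀ b, ∃ i j, g (node f₁ f₂ τ s n b 0 0) = node f₁ f₂ τ s' (-n + n₁) (!b) i j := by
      intro b
      obtain ⟨n', b', i', j', h⟩ := hnode n b 0 0
      have h2 := hgx (node f₁ f₂ τ s n b 0 0)
      rw [h, hF.node_apply_two hs, hF.node_apply_two hs', hk] at h2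
      have : levelHeight τ n' b' = levelHeight τ (-n + n₁) (!b) := by
        rw [h2]; cases b <;> simp [levelHeight] <;> ring
      obtain ⟨rfl, rfl⟩ := hF.levelHeight_inj this
      exact ⟨i', j', h⟩
    obtain ⟨i, j, ht⟩ := hlev true
    obtain ⟨k, l, hb⟩ := hlev false
    have h2 := node_true_sub_node_false_mem f₁ f₂ τ s' (-n + n₁) k l i j
    have h4 : node f₁ f₂ τ s' (-n + n₁) true k l - node f₁ f₂ τ s' (-n + n₁) false i j
        = - (A (s n) + (τ * (-1)) • ez) := by
      rw [← hdiff, ht, hb]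
      simp
    rw [h4] at h2
    rw [← neg_mem_iff]
    convert h2 using 1
    module

/-- The relative shifts of the layers are preserved by an isometry between two stacks, up to a
shift or a reflection of the order of the layers. -/
theorem exists_shift_sub_mem_iff (hF : IsFrame f₁ f₂ γ τ) {s s' : ℤ → Space} (hs : ∀ n, s n 2 = 0)
    (hs' : ∀ n, s' n 2 = 0) {g : Space ≃ᵃⁱ[ℝ] Space}
    (hg : g '' nodes f₁ f₂ τ s = nodes f₁ f₂ τ s') :
    ∃ σ k : ℤ, (σ = 1 ∨ σ = -1) ∧
      (∀ n m, s n - s m ∈ lattice f₁ f₂ ↔ s' (σ * n + k) - s' (σ * m + k) ∈ lattice f₁ f₂) ∧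
      ∀ n, g (node f₁ f₂ τ s 0 false 0 0) = node f₁ f₂ τ s' n false 0 0 → σ = 1 ∧ k = n := by
  obtain ⟨k, hlat, ⟨h2, h⟩ | ⟨h2, h⟩⟩ := hF.exists_layer_map hs hs' hg
  · refine ⟨1, k, Or.inl rfl, fun n m => ?_, fun n hn => ⟨rfl, ?_⟩⟩
    · rw [hlat, one_mul, one_mul, map_sub]
      have e : g.linearIsometryEquiv (s n) - g.linearIsometryEquiv (s m)
        = (g.linearIsometryEquiv (s n) - s' (n + k)) - (g.linearIsometryEquiv (s m) - s' (m + k))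
          + (s' (n + k) - s' (m + k)) := by abel
      rw [e]
      exact AddSubgroup.add_mem_cancel_left _ (sub_mem (h n) (h m))
    · have h3 := h2 (node f₁ f₂ τ s 0 false 0 0)
      rw [hn, hF.node_apply_two hs, hF.node_apply_two hs'] at h3
      exact (hF.levelHeight_inj (n := n) (n' := k) (b := false) (b' := false)
        (by rw [h3]; simp [levelHeight])).1.symm
  · refine ⟨-1, k, Or.inr rfl, fun n m => ?_, fun n hn => ?_⟩
    · rw [hlat, neg_one_mul, neg_one_mul, map_sub, ← neg_mem_iff (x := s' _ - _)]
      have e : g.linearIsometryEquiv (s n) - g.linearIsometryEquiv (s m)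
        = (g.linearIsometryEquiv (s n) + s' (-n + k)) - (g.linearIsometryEquiv (s m) + s' (-m + k))
          + -(s' (-n + k) - s' (-m + k)) := by abel
      rw [e]
      exact AddSubgroup.add_mem_cancel_left _ (sub_mem (h n) (h m))
    -- An isometry that reverses the order sends the bottom of a layer to the top of a layer, never
    -- to a bottom.
    · have h3 := h2 (node f₁ f₂ τ s 0 false 0 0)
      rw [hn, hF.node_apply_two hs, hF.node_apply_two hs'] at h3
      have := (hF.levelHeight_inj (n := n) (n' := k) (b := false) (b' := true)
        (by rw [h3]; simp [levelHeight])).2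
      simp at this

/-- A translation between two stacks shifts the order of the layers. -/
theorem exists_shift_of_translation (hF : IsFrame f₁ f₂ γ τ) {s s' : ℤ → Space}
    (hs : ∀ n, s n 2 = 0) (hs' : ∀ n, s' n 2 = 0) {t : Space}
    (hg : AffineIsometryEquiv.constVAdd ℝ Space t '' nodes f₁ f₂ τ s = nodes f₁ f₂ τ s') :
    ∃ k : ℤ, t 2 = k * (τ + 1) ∧ ∀ n, s n - s' (n + k) ∈ lattice f₁ f₂ := by
  have hlin : ∀ x, (AffineIsometryEquiv.constVAdd ℝ Space t).linearIsometryEquiv x = x := by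
    intro x
    have := isometry_map_add (AffineIsometryEquiv.constVAdd ℝ Space t) 0 x
    simpa using this.symm
  obtain ⟨k, -, ⟨h2, h⟩ | ⟨h2, h⟩⟩ := hF.exists_layer_map hs hs' hg
  · refine ⟨k, ?_, fun n => ?_⟩
    · have := h2 0
      simpa using this
    · have := h n
      rwa [hlin] at this
  · exfalso
    have e0 := h2 0
    have e1 := h2 ez
    simp [ez_apply_two] at e0 e1
    linarith

end IsFrame

/-! ### Words -/

/-- Two words agree up to a shift, a reversal and an exchange of the letters. -/
def WordsEquivalent (w w' : Word) : Prop :=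
  ∃ σ k : ℤ, (σ = 1 ∨ σ = -1) ∧ ∀ n m, w n = w m ↔ w' (σ * n + k) = w' (σ * m + k)

namespace WordsEquivalent

variable {w w' : Word}

/-- A period is a statement about which positions carry equal letters, and exactly this is
preserved. A reversal turns `p` into `-p`, which is a period at the same time. -/
theorem periodic_iff (h : WordsEquivalent w w') (p : ℤ) :
    Function.Periodic w p ↔ Function.Periodic w' p := by
  obtain ⟨σ, k, hσ, h⟩ := h
  have hσσ : σ * σ = 1 := by rcases hσ with rfl | rfl <;> norm_num
  have e : ∀ q, (∀ n, w (n + q) = w n) ↔ ∀ n, w' (n + σ * q) = w' n := by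
    intro q
    constructor
    · intro hq n
      have h1 := (h (σ * (n - k) + q) (σ * (n - k))).1 (hq _)
      rw [mul_add, ← mul_assoc, hσσ] at h1
      convert h1 using 2 <;> ring
    · intro hq n
      refine (h _ _).2 ?_
      rw [← hq (σ * n + k)]
      congr 1; ring
  have hpq : (∀ n, w' (n + σ * p) = w' n) ↔ ∀ n, w' (n + p) = w' n := by
    rcases hσ with rfl | rfl
    · simp
    · constructor
      · intro hq n
        rw [← hq (n + p)]; congr 1; ring
      · intro hq n
        rw [← hq (n + -1 * p)]; congr 1; ring
  exact (e p).trans hpq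

/-- As there are two letters only, an equivalent word is determined by `σ`, `k` and whether `w' k`
equals `w 0`. -/
theorem countable (w : Word) : {w' | WordsEquivalent w w'}.Countable := by
  classical
  set F : ℤ × ℤ × Bool → Word := fun q m =>
    if q.2.2 then w (q.1 * (m - q.2.1)) else
      (if w (q.1 * (m - q.2.1)) = .a then .b else .a) with hF
  refine (Set.countable_range F).mono ?_
  rintro w' ⟨σ, k, hσ, h⟩
  have hσσ : σ * σ = 1 := by rcases hσ with rfl | rfl <;> norm_num
  refine ⟨(σ, k, decide (w' k = w 0)), funext fun m => ?_⟩
  have h1 := h (σ * (m - k)) 0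
  have e1 : σ * (σ * (m - k)) + k = m := by rw [← mul_assoc, hσσ]; ring
  rw [e1, mul_zero, zero_add] at h1
  simp only [hF, decide_eq_true_eq]
  generalize w (σ * (m - k)) = x at *
  generalize w 0 = y at *
  generalize w' m = z at *
  generalize w' k = u at *
  cases x <;> cases y <;> cases z <;> cases u <;> simp_all

end WordsEquivalent

theorem mk_letter : Cardinal.mk Letter = 2 := by
  have e : Letter ≃ Bool :=
    ⟨fun x => match x with | .a => true | .b => false, fun x => if x then .a else .b,
      fun x => by cases x <;> rfl, fun x => by cases x <;> rfl⟩
  rw [Cardinal.mk_congr e, Cardinal.mk_bool]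

instance : Finite Letter :=
  Cardinal.lt_aleph0_iff_finite.1 (by rw [mk_letter]; exact Cardinal.natCast_lt_aleph0)

theorem mk_word : Cardinal.mk Word = Cardinal.continuum := by
  rw [← Cardinal.power_def, mk_letter, Cardinal.mk_int, Cardinal.two_power_aleph0]

/-- For each positive period `p` a word is determined by its letters at `0, …, p - 1`, so there are
finitely many. -/
theorem countable_periodicWords : {w : Word | IsPeriodicWord w}.Countable := by
  have h : {w : Word | IsPeriodicWord w} ⊆ ⋃ p : ℕ, {w : Word | 0 < p ∧ Function.Periodic w (p : ℤ)} := by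
    rintro w ⟨p, hp, hw⟩
    rw [Set.mem_iUnion]
    refine ⟨p.natAbs, Int.natAbs_pos.2 hp, ?_⟩
    rcases Int.natAbs_eq p with h | h
    · rwa [← h]
    · rw [h] at hw
      simpa using hw.neg
  refine (Set.countable_iUnion fun p => ?_).mono h
  refine Set.Finite.countable ?_
  refine Set.Finite.of_finite_image (f := fun w => fun i : Fin p => w i) (Set.toFinite _) ?_
  rintro w ⟨hp, hw⟩ w' ⟨-, hw'⟩ e
  funext n
  have hmod : ∀ u : Word, Function.Periodic u (p : ℤ) → u n = u (n % p) := fun u hu => by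
    conv_lhs => rw [← Int.emod_add_mul_ediv n p, mul_comm]
    exact hu.int_mul (n / p) (n % p)
  rw [hmod w hw, hmod w' hw']
  have h0 : 0 ≤ n % p := Int.emod_nonneg _ (by omega)
  have h1 : n % p < p := Int.emod_lt_of_pos _ (by omega)
  have := congrFun e ⟨(n % p).toNat, by omega⟩
  simpa [Int.toNat_of_nonneg h0] using this

open Classical in
/-- The word with letter `a` exactly at the multiples of `p`. -/
noncomputable def sparseWord (p : ℤ) : Word := fun n => if p ∣ n then .a else .b

/-- Equivalent words have the same periods, so this makes the words with different positive
parameters inequivalent. -/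
theorem sparseWord_periodic_iff (p q : ℤ) : Function.Periodic (sparseWord p) q ↔ p ∣ q := by
  constructor
  · intro h
    have := h 0
    simp only [sparseWord, zero_add, dvd_zero, if_true] at this
    by_contra hn
    simp [hn] at this
  · intro h n
    simp only [sparseWord, dvd_add_left h]

theorem sparseWord_one {p : ℤ} (hp : 2 ≤ p) : sparseWord p 1 = .b := by
  have : ¬ p ∣ 1 := fun h => by have := Int.le_of_dvd one_pos h; omega
  simp [sparseWord, this]

theorem sparseWord_two {p : ℤ} (hp : 3 ≤ p) : sparseWord p 2 = .b := by
  have : ¬ p ∣ 2 := fun h => by have := Int.le_of_dvd two_pos h; omega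
  simp [sparseWord, this]

theorem sparseWord_zero (p : ℤ) : sparseWord p 0 = .a := by simp [sparseWord]

theorem isPeriodicWord_sparseWord {p : ℤ} (hp : 3 ≤ p) : IsPeriodicWord (sparseWord p) :=
  ⟨p, by omega, (sparseWord_periodic_iff p p).2 dvd_rfl⟩

/-! ### Counting congruence classes -/

section Cardinality

variable {T : Word → Set (Set Space)} {Proper : Word → Prop}

theorem wordsEquivalent_of_congruenceClass_eq
    (hcong : ∀ w w' g, T w' = moved g (T w) → WordsEquivalent w w') {w w' : Word}
    (h : congruenceClass (T w) = congruenceClass (T w')) : WordsEquivalent w w' := by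
  have : T w' ∈ congruenceClass (T w) := by
    rw [h]; exact ⟨AffineIsometryEquiv.refl ℝ Space, (moved_refl _).symm⟩
  obtain ⟨g, hg⟩ := this
  exact hcong w w' g hg

/-- Only the countably many periodic words contribute, and the sparse words already give infinitely
many classes. -/
theorem mk_congruenceClasses_periodic
    (hcong : ∀ w w' g, T w' = moved g (T w) → WordsEquivalent w w')
    (hper : ∀ w, Proper w → (IsPeriodic (T w) ↔ IsPeriodicWord w))
    (hsparse : ∀ p, 3 ≤ p → Proper (sparseWord p)) :
    Cardinal.mk ↥(congruenceClass '' (T '' {w | Proper w ∧ IsPeriodic (T w)}))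
      = Cardinal.aleph0 := by
  have hc : (congruenceClass '' (T '' {w | Proper w ∧ IsPeriodic (T w)})).Countable := by
    refine ((countable_periodicWords.mono ?_).image _).image _
    rintro w ⟨h1, h2⟩
    exact (hper w h1).1 h2
  have hi : (congruenceClass '' (T '' {w | Proper w ∧ IsPeriodic (T w)})).Infinite := by
    -- The parameters start at `3`: with `1` the word would be constant, and with `2` alternating.
    refine Set.infinite_of_injective_forall_mem
      (f := fun p : ℕ => congruenceClass (T (sparseWord (p + 3)))) ?_ fun p => ?_
    · intro p q hpq
      have h := wordsEquivalent_of_congruenceClass_eq hcong hpq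
      have h1 := (h.periodic_iff (p + 3)).1 ((sparseWord_periodic_iff _ _).2 dvd_rfl)
      have h2 := (h.periodic_iff (q + 3)).2 ((sparseWord_periodic_iff _ _).2 dvd_rfl)
      rw [sparseWord_periodic_iff] at h1 h2
      have := Int.dvd_antisymm (by omega) (by omega) h1 h2
      omega
    · have hp : (3 : ℤ) ≤ p + 3 := by omega
      exact ⟨_, ⟨_, ⟨hsparse _ hp, (hper _ (hsparse _ hp)).2 (isPeriodicWord_sparseWord hp)⟩, rfl⟩, rfl⟩
  have := hc.to_subtype
  have := hi.to_subtype
  exact Cardinal.mk_eq_aleph0 _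

/-- Since improper words are periodic, the words that contribute are exactly the nonperiodic ones, a
continuum. Each congruence class comes from countably many of them, and fewer than continuum many
countable fibres cannot exhaust a continuum. -/
theorem mk_congruenceClasses_aperiodic
    (hcong : ∀ w w' g, T w' = moved g (T w) → WordsEquivalent w w')
    (hper : ∀ w, Proper w → (IsPeriodic (T w) ↔ IsPeriodicWord w))
    (hproper : ∀ w, ¬ Proper w → IsPeriodicWord w) :
    Cardinal.mk ↥(congruenceClass '' (T '' {w | Proper w ∧ ¬ IsPeriodic (T w)}))
      = Cardinal.continuum := by
  have hX : {w | Proper w ∧ ¬ IsPeriodic (T w)} = {w : Word | IsPeriodicWord w}ᶜ := by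
    ext w
    constructor
    · rintro ⟨h1, h2⟩ h3
      exact h2 ((hper w h1).2 h3)
    · intro h
      have h1 : Proper w := by_contra fun hn => h (hproper w hn)
      exact ⟨h1, fun h2 => h ((hper w h1).1 h2)⟩
  rw [hX, Set.image_image]
  set X : Set Word := {w : Word | IsPeriodicWord w}ᶜ
  have hXc : Cardinal.mk X = Cardinal.continuum := by
    have : Infinite Word := Cardinal.infinite_iff.2 (by rw [mk_word]; exact Cardinal.aleph0_le_continuum)
    rw [Cardinal.mk_compl_of_infinite _ ?_, mk_word]
    rw [mk_word]
    exact (Cardinal.mk_le_aleph0_iff.2 countable_periodicWords.to_subtype).trans_lt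
      Cardinal.aleph0_lt_continuum
  set F : Word → Set (Set (Set Space)) := fun w => congruenceClass (T w)
  refine le_antisymm (Cardinal.mk_image_le.trans hXc.le) ?_
  by_contra! hlt
  have hsub : X ⊆ ⋃ y ∈ F '' X, {w | F w = y} := fun w hw =>
    Set.mem_biUnion ⟨w, hw, rfl⟩ rfl
  have h1 : Cardinal.mk X ≤ Cardinal.mk (F '' X) * Cardinal.aleph0 := by
    refine (Cardinal.mk_le_mk_of_subset hsub).trans ((Cardinal.mk_biUnion_le _ _).trans ?_)
    gcongr
    refine ciSup_le' ?_
    rintro ⟨_, w, hw, rfl⟩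
    refine Cardinal.mk_le_aleph0_iff.2 (Set.Countable.to_subtype
      ((WordsEquivalent.countable w).mono fun w' hw' => ?_))
    exact wordsEquivalent_of_congruenceClass_eq hcong (Eq.symm hw')
  rw [hXc] at h1
  exact absurd (h1.trans_lt (Cardinal.mul_lt_of_lt Cardinal.aleph0_le_continuum hlt
    Cardinal.aleph0_lt_continuum)) (lt_irrefl _)

end Cardinality

/-! ### Convex combinations, periodic sums and translations -/

theorem mem_convexHull_of_sum {m : ℕ} {S : Set Space} {v : Space} (z : Fin m → Space)
    (c : Fin m → ℝ) (hz : ∀ i, z i ∈ S) (h0 : ∀ i, 0 ≤ c i) (h1 : ∑ i, c i = 1)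
    (hv : v = ∑ i, c i • z i) : v ∈ convexHull ℝ S := by
  rw [hv]
  exact (convex_convexHull ℝ S).sum_mem (fun i _ => h0 i) h1
    fun i _ => subset_convexHull ℝ S (hz i)

/-- Translating a convex hull along `a` sweeps out a prism. -/
theorem add_smul_mem_convexHull {S S' : Set Space} {v a : Space} {t : ℝ} (h0 : 0 ≤ t) (h1 : t ≤ 1)
    (hv : v ∈ convexHull ℝ S) (hS : S ⊆ S') (ha : ∀ x ∈ S, x + a ∈ S') :
    v + t • a ∈ convexHull ℝ S' := by
  have hva : v + a ∈ convexHull ℝ S' := by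
    have h2 : AffineIsometryEquiv.constVAdd ℝ Space a '' convexHull ℝ S ⊆ convexHull ℝ S' := by
      rw [image_convexHull_isometry]
      refine convexHull_mono ?_
      rintro _ ⟨x, hx, rfl⟩
      simpa [add_comm] using ha x hx
    simpa [add_comm] using h2 ⟨v, hv, rfl⟩
  have := (convex_convexHull ℝ S') (convexHull_mono hS hv) hva (sub_nonneg.2 h1) h0 (by ring)
  convert this using 1
  module

theorem apply_two_mem_of_mem_convexHull {S : Set Space} {a b : ℝ}
    (h : ∀ v ∈ S, a ≤ v 2 ∧ v 2 ≤ b) {v : Space} (hv : v ∈ convexHull ℝ S) : a ≤ v 2 ∧ v 2 ≤ b := by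
  have e : ∀ x : Space, innerSL ℝ ez x = x 2 := fun x => by rw [innerSL_apply_apply, inner_ez]
  constructor
  · have := apply_le_of_mem_convexHull (-innerSL ℝ ez) (M := -a)
      (fun y hy => by simpa [e] using (h y hy).1) hv
    simpa [e] using this
  · have := apply_le_of_mem_convexHull (innerSL ℝ ez) (M := b)
      (fun y hy => by simpa [e] using (h y hy).2) hv
    simpa [e] using this

theorem partialSum_add_period {M : Type} [AddCommGroup M] {f : ℤ → M} {p : ℤ}
    (hf : ∀ n, f (n + p) = f n) (n : ℤ) :
    partialSum f (n + p) = partialSum f n + partialSum f p := by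
  induction n using Int.induction_on with
  | zero => simp [partialSum_zero]
  | succ n ih =>
    rw [add_right_comm, partialSum_succ, ih, partialSum_succ, hf]; abel
  | pred n ih =>
    have h1 := partialSum_succ f (-(n : ℤ) - 1 + p)
    have h2 := partialSum_succ f (-(n : ℤ) - 1)
    rw [hf] at h1
    rw [sub_add_cancel] at h2
    rw [show -(n : ℤ) - 1 + p + 1 = -(n : ℤ) + p by ring, ih, h2] at h1
    have := add_right_cancel (h1.symm.trans (add_right_comm _ _ _))
    exact this

theorem moved_constVAdd_eq {T : Set (Set Space)} {t : Space}
    (h : ∀ P ∈ T, AffineIsometryEquiv.constVAdd ℝ Space t '' P ∈ T)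
    (h' : ∀ P ∈ T, AffineIsometryEquiv.constVAdd ℝ Space (-t) '' P ∈ T) :
    moved (AffineIsometryEquiv.constVAdd ℝ Space t) T = T := by
  refine Set.Subset.antisymm ?_ fun P hP => ⟨_, h' P hP, ?_⟩
  · rintro _ ⟨P, hP, rfl⟩
    exact h P hP
  · simp only [Set.image_image, AffineIsometryEquiv.coe_constVAdd, vadd_eq_add, add_neg_cancel_left,
      Set.image_id']

namespace IsFrame

variable {f₁ f₂ : Space} {γ τ : ℝ}

/-- The two lattice translations span the horizontal plane, and any translation that is not
horizontal completes them. -/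
theorem isPeriodic_of (hF : IsFrame f₁ f₂ γ τ) {T : Set (Set Space)} {t : Space}
    (h1 : moved (AffineIsometryEquiv.constVAdd ℝ Space f₁) T = T)
    (h2 : moved (AffineIsometryEquiv.constVAdd ℝ Space f₂) T = T)
    (h3 : moved (AffineIsometryEquiv.constVAdd ℝ Space t) T = T) (ht : t 2 ≠ 0) :
    IsPeriodic T := by
  rw [IsPeriodic, eq_top_iff]
  set U := Submodule.span ℝ {t : Space | moved (AffineIsometryEquiv.constVAdd ℝ Space t) T = T}
  have m1 : f₁ ∈ U := Submodule.subset_span h1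
  have m2 : f₂ ∈ U := Submodule.subset_span h2
  have m3 : t ∈ U := Submodule.subset_span h3
  obtain ⟨x, y, z, rfl⟩ := hF.exists_coords t
  rw [hF.coords_apply_two] at ht
  have m4 : ez ∈ U := by
    have : ez = z⁻¹ • ((x • f₁ + y • f₂ + z • ez) - x • f₁ - y • f₂) := by
      rw [show x • f₁ + y • f₂ + z • ez - x • f₁ - y • f₂ = z • ez by abel, smul_smul,
        inv_mul_cancel₀ ht, one_smul]
    rw [this]
    exact U.smul_mem _ (U.sub_mem (U.sub_mem m3 (U.smul_mem _ m1)) (U.smul_mem _ m2))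
  intro v _
  obtain ⟨x, y, z, rfl⟩ := hF.exists_coords v
  exact U.add_mem (U.add_mem (U.smul_mem _ m1) (U.smul_mem _ m2)) (U.smul_mem _ m4)

end IsFrame

/-- Otherwise all translational symmetries, and hence their span, would be orthogonal to `ez`. -/
theorem exists_apply_two_ne_zero_of_isPeriodic {T : Set (Set Space)} (h : IsPeriodic T) :
    ∃ t : Space, moved (AffineIsometryEquiv.constVAdd ℝ Space t) T = T ∧ t 2 ≠ 0 := by
  by_contra! hn
  have : Submodule.span ℝ {t : Space | moved (AffineIsometryEquiv.constVAdd ℝ Space t) T = T}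
      ≤ (Submodule.span ℝ {ez})ᗮ := by
    rw [Submodule.span_le]
    intro t ht
    rw [SetLike.mem_coe, Submodule.mem_orthogonal_singleton_iff_inner_right, inner_ez]
    exact hn t ht
  rw [h] at this
  have h2 := this (Submodule.mem_top (x := ez))
  rw [Submodule.mem_orthogonal_singleton_iff_inner_right, inner_ez, ez_apply_two] at h2
  exact one_ne_zero h2

/-! ### Families of layered tilings -/

/-- A family of normal tilings whose vertices form the stacks of lattices with shifts `s w`. -/
structure IsLayeredFamily (f₁ f₂ : Space) (γ τ : ℝ) (s : Word → ℤ → Space)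
    (T : Word → Set (Set Space)) : Prop where
  frame : IsFrame f₁ f₂ γ τ
  shift : ∀ w n, s w n 2 = 0
  vertices : ∀ w, vertices (T w) = nodes f₁ f₂ τ (s w)

namespace IsLayeredFamily

variable {f₁ f₂ : Space} {γ τ : ℝ} {s : Word → ℤ → Space} {T : Word → Set (Set Space)}

theorem image_nodes (hT : IsLayeredFamily f₁ f₂ γ τ s T) {w w' : Word} {g : Space ≃ᵃⁱ[ℝ] Space}
    (h : moved g (T w) = T w') : g '' nodes f₁ f₂ τ (s w) = nodes f₁ f₂ τ (s w') := by
  rw [← hT.vertices, ← hT.vertices, ← h, vertices_moved]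

/-- Apply the rigidity of translations to the zero translation: it moves no layer, so the shifts of
both words agree modulo the lattice. -/
theorem injective (hT : IsLayeredFamily f₁ f₂ γ τ s T)
    (hs : ∀ w w', (∀ n, s w n - s w' n ∈ lattice f₁ f₂) → w = w') : Function.Injective T := by
  intro w w' h
  refine hs w w' ?_
  have h1 : moved (AffineIsometryEquiv.constVAdd ℝ Space 0) (T w) = T w' := by
    rw [← h]; simp [moved]
  obtain ⟨k, hk, hk'⟩ :=
    hT.frame.exists_shift_of_translation (hT.shift w) (hT.shift w') (hT.image_nodes h1)
  have h0 : k = 0 := by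
    have h2 := hT.frame.le_τ
    have : (k : ℝ) * (τ + 1) = 0 := by rw [← hk]; simp
    rcases mul_eq_zero.1 this with h | h
    · exact_mod_cast h
    · linarith
  subst h0
  simpa using hk'

/-- A translational symmetry that is not horizontal moves the layers by some `k ≠ 0`, and the shifts
are `k`-periodic modulo the lattice. -/
theorem isPeriodicWord (hT : IsLayeredFamily f₁ f₂ γ τ s T)
    (hs : ∀ w k, (∀ n, s w n - s w (n + k) ∈ lattice f₁ f₂) → ∀ n, w (n + k) = w n) {w : Word}
    (h : IsPeriodic (T w)) : IsPeriodicWord w := by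
  obtain ⟨t, ht, ht2⟩ := exists_apply_two_ne_zero_of_isPeriodic h
  obtain ⟨k, hk, hk'⟩ :=
    hT.frame.exists_shift_of_translation (hT.shift w) (hT.shift w) (hT.image_nodes ht)
  refine ⟨k, ?_, hs w k hk'⟩
  rintro rfl
  simp at hk
  exact ht2 hk

/-- A symmetry carrying a bottom vertex of layer `0` to a bottom vertex of layer `1` cannot reverse
the layers, so it moves each of them to the next one. -/
theorem shift_sub_mem_iff_succ (hT : IsLayeredFamily f₁ f₂ γ τ s T) {w : Word}
    (h : IsVertexTransitive (T w)) (n m : ℤ) :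
    s w n - s w m ∈ lattice f₁ f₂ ↔ s w (n + 1) - s w (m + 1) ∈ lattice f₁ f₂ := by
  obtain ⟨g, hg, hg'⟩ := h (node f₁ f₂ τ (s w) 0 false 0 0)
    (by rw [hT.vertices]; exact node_mem ..) (node f₁ f₂ τ (s w) 1 false 0 0)
    (by rw [hT.vertices]; exact node_mem ..)
  obtain ⟨σ, k, -, h1, h2⟩ :=
    hT.frame.exists_shift_sub_mem_iff (hT.shift w) (hT.shift w) (hT.image_nodes hg)
  obtain ⟨rfl, rfl⟩ := h2 1 hg'
  simpa using h1 n m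

theorem exists_shift_sub_mem_iff (hT : IsLayeredFamily f₁ f₂ γ τ s T) {w w' : Word}
    {g : Space ≃ᵃⁱ[ℝ] Space} (h : T w' = moved g (T w)) :
    ∃ σ k : ℤ, (σ = 1 ∨ σ = -1) ∧ ∀ n m, s w n - s w m ∈ lattice f₁ f₂ ↔
      s w' (σ * n + k) - s w' (σ * m + k) ∈ lattice f₁ f₂ := by
  obtain ⟨σ, k, hσ, h1, -⟩ :=
    hT.frame.exists_shift_sub_mem_iff (hT.shift w) (hT.shift w') (hT.image_nodes h.symm)
  exact ⟨σ, k, hσ, h1⟩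

end IsLayeredFamily

/-! ### Cells given by the indices of their vertices -/

/-- The convex hull of a finite family of nodes. -/
noncomputable def cell (f₁ f₂ : Space) (τ : ℝ) (s : ℤ → Space) (I : Finset (ℤ × Bool × ℤ × ℤ)) :
    Set Space :=
  convexHull ℝ ((fun q : ℤ × Bool × ℤ × ℤ => node f₁ f₂ τ s q.1 q.2.1 q.2.2.1 q.2.2.2) '' I)

namespace IsFrame

variable {f₁ f₂ : Space} {γ τ : ℝ} {s : ℤ → Space} {T : Set (Set Space)}

theorem node_injective' (hF : IsFrame f₁ f₂ γ τ) (hs : ∀ n, s n 2 = 0) : Function.Injective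
    (fun q : ℤ × Bool × ℤ × ℤ => node f₁ f₂ τ s q.1 q.2.1 q.2.2.1 q.2.2.2) := by
  rintro ⟨n, b, i, j⟩ ⟨n', b', i', j'⟩ h
  obtain ⟨rfl, rfl, rfl, rfl⟩ := hF.node_injective hs h
  rfl

theorem extremePoints_cell (hT : IsDelaunayFamily (nodes f₁ f₂ τ s) T)
    {I : Finset (ℤ × Bool × ℤ × ℤ)} (hI : cell f₁ f₂ τ s I ∈ T) :
    (cell f₁ f₂ τ s I).extremePoints ℝ
      = (fun q : ℤ × Bool × ℤ × ℤ => node f₁ f₂ τ s q.1 q.2.1 q.2.2.1 q.2.2.2) '' I := by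
  obtain ⟨S, c, R, hR, hS, e⟩ := hT _ hI
  refine Set.Subset.antisymm extremePoints_convexHull_subset ?_
  rintro _ ⟨q, hq, rfl⟩
  rw [e, hS.extremePoints hR]
  refine hS.mem_of_mem_convexHull (node_mem ..) ?_
  rw [← e]
  exact subset_convexHull ℝ _ ⟨q, hq, rfl⟩

/-- A cell determines its extreme points, and a node determines its index. Cells around a vertex can
therefore be counted as finite sets of indices, where equality and membership are decidable. -/
theorem cell_injOn (hF : IsFrame f₁ f₂ γ τ) (hs : ∀ n, s n 2 = 0)
    (hT : IsDelaunayFamily (nodes f₁ f₂ τ s) T) :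
    Set.InjOn (cell f₁ f₂ τ s) {I | cell f₁ f₂ τ s I ∈ T} := by
  intro I hI J hJ h
  have h1 := extremePoints_cell hT hI
  rw [h, extremePoints_cell hT hJ] at h1
  exact Finset.coe_injective ((hF.node_injective' hs).image_injective h1.symm)

theorem node_mem_cell (hF : IsFrame f₁ f₂ γ τ) (hs : ∀ n, s n 2 = 0)
    (hT : IsDelaunayFamily (nodes f₁ f₂ τ s) T) {I : Finset (ℤ × Bool × ℤ × ℤ)}
    (hI : cell f₁ f₂ τ s I ∈ T) {n : ℤ} {b : Bool} {i j : ℤ} :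
    node f₁ f₂ τ s n b i j ∈ cell f₁ f₂ τ s I ↔ (n, b, i, j) ∈ I := by
  have h1 := extremePoints_cell hT hI
  constructor
  · intro h
    obtain ⟨S, c, R, hR, hS, e⟩ := hT _ hI
    rw [e] at h h1
    have h2 := hS.mem_of_mem_convexHull (node_mem ..) h
    rw [← hS.extremePoints hR, h1] at h2
    exact_mod_cast ((hF.node_injective' hs).mem_set_image
      (a := ((n, b, i, j) : ℤ × Bool × ℤ × ℤ))).1 h2
  · intro h
    exact subset_convexHull ℝ _ ⟨(n, b, i, j), h, rfl⟩

/-- The number of cells of a given kind around a node. -/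
theorem ncard_star (hF : IsFrame f₁ f₂ γ τ) (hs : ∀ n, s n 2 = 0)
    (hT : IsDelaunayFamily (nodes f₁ f₂ τ s) T) (p : Set Space → Prop) {n : ℤ} {b : Bool} {i j : ℤ}
    (C : Finset (Finset (ℤ × Bool × ℤ × ℤ)))
    (hC : ∀ I ∈ C, cell f₁ f₂ τ s I ∈ T ∧ p (cell f₁ f₂ τ s I) ∧ (n, b, i, j) ∈ I)
    (hC' : ∀ P ∈ T, p P → ∃ I, P = cell f₁ f₂ τ s I ∧ ((n, b, i, j) ∈ I → I ∈ C)) :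
    {P ∈ delaunayStar T (node f₁ f₂ τ s n b i j) | p P}.ncard = C.card := by
  have : {P ∈ delaunayStar T (node f₁ f₂ τ s n b i j) | p P} = cell f₁ f₂ τ s '' C := by
    ext P
    constructor
    · rintro ⟨⟨hP, hv⟩, hp⟩
      obtain ⟨I, rfl, hI⟩ := hC' P hP hp
      exact ⟨I, hI ((hF.node_mem_cell hs hT hP).1 hv), rfl⟩
    · rintro ⟨I, hI, rfl⟩
      obtain ⟨h1, h2, h3⟩ := hC I hI
      exact ⟨⟨h1, (hF.node_mem_cell hs hT h1).2 h3⟩, h2⟩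
  rw [this, Set.InjOn.ncard_image ((hF.cell_injOn hs hT).mono fun I hI => (hC I hI).1),
    Set.ncard_coe_finset]

end IsFrame

/-! ### Elongated Kelvin partitions: cells and vertices -/

theorem tetHeight_sq : tetHeight ^ 2 = 2 / 3 := Real.sq_sqrt (by norm_num)

theorem tetHeight_pos : 0 < tetHeight := Real.sqrt_pos.2 (by norm_num)

/-- `γ` is the cosine of the angle of 60 degrees between the generators. -/
theorem isFrame_kelvin : IsFrame e₁ e₂ (1 / 2) tetHeight where
  apply_two₁ := by simp [e₁]
  apply_two₂ := by simp [e₂]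
  norm_sq x y z := by
    have h3 : √3 ^ 2 = 3 := Real.sq_sqrt (by norm_num)
    simp [EuclideanSpace.norm_sq_eq, Fin.sum_univ_three, e₁, e₂, ez]
    linear_combination (y ^ 2 / 4) * h3
  exists_coords v := by
    have h3 : √3 ≠ 0 := by positivity
    refine ⟨v 0 - v 1 / √3, 2 * v 1 / √3, v 2, ?_⟩
    ext i
    fin_cases i
    · simp [e₁, e₂, ez]; ring
    · simp [e₁, e₂, ez]; field_simp
    · simp [e₁, e₂, ez]
  γ_nonneg := by norm_num
  γ_le := le_rfl
  le_τ := by nlinarith [tetHeight_sq, tetHeight_pos]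
  τ_lt := by nlinarith [tetHeight_sq, tetHeight_pos]

noncomputable def kelvinShift (w : Word) (n : ℤ) : Space := (w n).sign • δ

theorem kelvinShift_apply_two (w : Word) (n : ℤ) : kelvinShift w n 2 = 0 := by
  simp [kelvinShift, δ, e₁, e₂]

theorem Letter.sign_sq (x : Letter) : x.sign ^ 2 = 1 := by
  cases x <;> simp [Letter.sign]

/-- The sign of a letter as an integer. -/
def Letter.intSign : Letter → ℤ
  | .a => 1
  | .b => -1

theorem Letter.cast_intSign (x : Letter) : (x.intSign : ℝ) = x.sign := by
  cases x <;> simp [Letter.sign, Letter.intSign]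

theorem Letter.intSign_eq_or (x : Letter) : x.intSign = 1 ∨ x.intSign = -1 := by
  cases x <;> simp [Letter.intSign]

/-- Nodes of an elongated Kelvin partition. -/
noncomputable abbrev kelvinNode (w : Word) (n : ℤ) (b : Bool) (i j : ℤ) : Space :=
  node e₁ e₂ tetHeight (kelvinShift w) n b i j

abbrev kelvinNodes (w : Word) : Set Space := nodes e₁ e₂ tetHeight (kelvinShift w)

theorem kelvinPoint_eq (w : Word) (n i j : ℤ) :
    kelvinPoint w n i j = kelvinNode w n false i j := by
  simp only [node, kelvinPoint, Bool.false_eq_true, if_false, add_zero]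
  rfl

theorem kelvinPoint_top_eq (w : Word) (n i j : ℤ) :
    kelvinPoint w n i j + (w n).sign • δ + tetHeight • ez = kelvinNode w n true i j := by
  rw [kelvinNode, node_true, kelvinPoint_eq, kelvinShift, ← add_assoc]

theorem mem_elongatedKelvin {w : Word} {P : Set Space} : P ∈ elongatedKelvin w ↔ ∃ n i j : ℤ,
    P = upTetrahedron (w n).sign (kelvinNode w n false i j) ∨
    P = downTetrahedron (w n).sign (kelvinNode w n false i j) ∨
    P = octahedron (w n).sign (kelvinNode w n false i j) ∨
    P = uprightPrism (kelvinNode w n true i j) ∨ P = uprightPrism' (kelvinNode w n true i j) := by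
  simp only [elongatedKelvin, Set.mem_ofPred_eq, kelvinPoint_top_eq]
  simp only [kelvinPoint_eq]

theorem kelvinNode_add_sign (w : Word) (n m : ℤ) (b : Bool) (i j x y : ℤ) :
    kelvinNode w n b i j + (w m).sign • ((x : ℝ) • e₁ + (y : ℝ) • e₂)
      = kelvinNode w n b (i + (w m).intSign * x) (j + (w m).intSign * y) := by
  rw [kelvinNode, kelvinNode, node_add]
  push_cast [Letter.cast_intSign]
  module

theorem exists_kelvinNode_eq (w : Word) (n m : ℤ) (b : Bool) (i j k l : ℤ) : ∃ x y : ℤ,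
    kelvinNode w n b k l = kelvinNode w n b i j + (w m).sign • ((x : ℝ) • e₁ + (y : ℝ) • e₂) := by
  refine ⟨(w m).intSign * (k - i), (w m).intSign * (l - j), ?_⟩
  rw [kelvinNode_add_sign]
  rcases (w m).intSign_eq_or with h | h <;> rw [h] <;> congr 1 <;> ring

theorem kelvin_form_zero (x y : ℤ) : (x = 0 ∧ y = 0) ∨ 1 ≤ x ^ 2 + x * y + y ^ 2 := by
  by_contra! h
  obtain ⟨h1, h2⟩ := h
  have h3 : 4 * x ^ 2 + 4 * (x * y) + 4 * y ^ 2 ≤ 0 := by omega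
  have hx : x = 0 := by nlinarith [sq_nonneg (2 * y + x)]
  subst hx
  exact h1 rfl (by nlinarith)

/-- The squared distance from a lattice point to the centroid of the triangle `0, e₁, e₂` is this
form plus `1 / 3`. Being integral and zero only at the three corners, it leaves a gap of one between
the corners and all other points. -/
theorem kelvin_form_triangle (x y : ℤ) : (x = 0 ∧ y = 0) ∨ (x = 1 ∧ y = 0) ∨ (x = 0 ∧ y = 1) ∨
    1 ≤ x ^ 2 + x * y + y ^ 2 - x - y := by
  by_contra! h
  obtain ⟨h1, h2, h3, h4⟩ := h
  have h5 : x ^ 2 + x * y + y ^ 2 - x - y ≤ 0 := by omega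
  have hx : x = 0 ∨ x = 1 := by
    have : -1 < x ∧ x < 2 := by constructor <;> nlinarith [sq_nonneg (2 * y + x - 1)]
    omega
  have hy : y = 0 ∨ y = 1 := by
    have : -1 < y ∧ y < 2 := by constructor <;> nlinarith [sq_nonneg (2 * x + y - 1)]
    omega
  rcases hx with rfl | rfl <;> rcases hy with rfl | rfl <;> simp_all

/-- The same gap for the adjacent triangle with centroid `(2 / 3, 2 / 3)`, obtained by the point
reflection `(x, y) ↦ (1 - x, 1 - y)`. -/
theorem kelvin_form_triangle' (x y : ℤ) : (x = 1 ∧ y = 1) ∨ (x = 0 ∧ y = 1) ∨ (x = 1 ∧ y = 0) ∨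
    1 ≤ x ^ 2 + x * y + y ^ 2 - 2 * x - 2 * y + 1 := by
  rcases kelvin_form_triangle (1 - x) (1 - y) with h | h | h | h
  · left; omega
  · right; left; omega
  · right; right; left; omega
  · right; right; right; nlinarith

/-- The bottom point with coordinates `x`, `y` relative to `p`. -/
noncomputable def kelvinBot (ε : ℝ) (p : Space) (x y : ℝ) : Space := p + ε • (x • e₁ + y • e₂)

/-- The top point with coordinates `x`, `y` relative to `p`. -/
noncomputable def kelvinTop (ε : ℝ) (p : Space) (x y : ℝ) : Space :=
  p + ε • (x • e₁ + y • e₂) + (ε • δ + tetHeight • ez)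

theorem upTetrahedron_eq (ε : ℝ) (p : Space) : upTetrahedron ε p = convexHull ℝ
    {kelvinBot ε p 0 0, kelvinBot ε p 1 0, kelvinBot ε p 0 1, kelvinTop ε p 0 0} := by
  rw [upTetrahedron]
  simp [kelvinBot, kelvinTop, add_assoc]

theorem downTetrahedron_eq (ε : ℝ) (p : Space) : downTetrahedron ε p = convexHull ℝ
    {kelvinBot ε p 0 0, kelvinTop ε p 0 0, kelvinTop ε p (-1) 0, kelvinTop ε p 0 (-1)} := by
  rw [downTetrahedron]
  have h1 : p + ε • (δ - e₁) + tetHeight • ez = kelvinTop ε p (-1) 0 := by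
    simp only [kelvinTop]; module
  have h2 : p + ε • (δ - e₂) + tetHeight • ez = kelvinTop ε p 0 (-1) := by
    simp only [kelvinTop]; module
  rw [h1, h2]
  simp [kelvinBot, kelvinTop, add_assoc]

theorem octahedron_eq (ε : ℝ) (p : Space) : octahedron ε p = convexHull ℝ
    {kelvinBot ε p 1 0, kelvinBot ε p 0 1, kelvinBot ε p 1 1,
      kelvinTop ε p 0 0, kelvinTop ε p 1 0, kelvinTop ε p 0 1} := by
  rw [octahedron]
  have h1 : p + ε • (δ + e₁) + tetHeight • ez = kelvinTop ε p 1 0 := by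
    simp only [kelvinTop]; module
  have h2 : p + ε • (δ + e₂) + tetHeight • ez = kelvinTop ε p 0 1 := by
    simp only [kelvinTop]; module
  rw [h1, h2]
  simp [kelvinBot, kelvinTop, add_assoc]

theorem norm_kelvinBot_sub_sq {ε : ℝ} (hε : ε ^ 2 = 1) (p : Space) (x y α β ζ : ℝ) :
    ‖kelvinBot ε p x y - (kelvinBot ε p α β + ζ • ez)‖ ^ 2
      = (x - α) ^ 2 + (x - α) * (y - β) + (y - β) ^ 2 + ζ ^ 2 := by
  have : kelvinBot ε p x y - (kelvinBot ε p α β + ζ • ez)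
      = (ε * (x - α)) • e₁ + (ε * (y - β)) • e₂ + (-ζ) • ez := by
    simp only [kelvinBot]; module
  rw [this, isFrame_kelvin.norm_sq]
  linear_combination ((x - α) ^ 2 + (x - α) * (y - β) + (y - β) ^ 2) * hε

theorem norm_kelvinTop_sub_sq {ε : ℝ} (hε : ε ^ 2 = 1) (p : Space) (x y α β ζ : ℝ) :
    ‖kelvinTop ε p x y - (kelvinBot ε p α β + ζ • ez)‖ ^ 2
      = (x + 1 / 3 - α) ^ 2 + (x + 1 / 3 - α) * (y + 1 / 3 - β) + (y + 1 / 3 - β) ^ 2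
        + (tetHeight - ζ) ^ 2 := by
  have : kelvinTop ε p x y - (kelvinBot ε p α β + ζ • ez)
      = (ε * (x + 1 / 3 - α)) • e₁ + (ε * (y + 1 / 3 - β)) • e₂ + (tetHeight - ζ) • ez := by
    simp only [kelvinBot, kelvinTop, δ]; module
  rw [this, isFrame_kelvin.norm_sq]
  linear_combination ((x + 1 / 3 - α) ^ 2 + (x + 1 / 3 - α) * (y + 1 / 3 - β)
    + (y + 1 / 3 - β) ^ 2) * hε

theorem kelvinBot_mem (w : Word) (n i j x y : ℤ) :
    kelvinBot (w n).sign (kelvinNode w n false i j) x y ∈ kelvinNodes w := by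
  rw [kelvinBot, kelvinNode_add_sign]; exact node_mem ..

theorem kelvinTop_mem (w : Word) (n i j x y : ℤ) :
    kelvinTop (w n).sign (kelvinNode w n false i j) x y ∈ kelvinNodes w := by
  have := node_mem e₁ e₂ tetHeight (kelvinShift w) n true (i + (w n).intSign * x)
    (j + (w n).intSign * y)
  rwa [node_true, ← kelvinNode, ← kelvinNode_add_sign] at this

/-- For a centre with coordinates `α`, `β` at height `ζ` above the bottom, emptiness becomes one
inequality over integer points for each of the two levels of the layer. The sign of the letter has
disappeared, since the coordinates are taken along `ε e₁` and `ε e₂`. -/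
theorem isDelaunay_kelvin_layer (w : Word) (n i j : ℤ) {α β ζ R : ℝ} {S : Set Space}
    (h0 : 0 ≤ ζ) (h1 : ζ ≤ tetHeight) (hR : R < 1)
    (hS : ∀ v ∈ S, v ∈ kelvinNodes w ∧
      ‖v - (kelvinBot (w n).sign (kelvinNode w n false i j) α β + ζ • ez)‖ ^ 2 = R)
    (hbot : ∀ x y : ℤ, kelvinBot (w n).sign (kelvinNode w n false i j) x y ∈ S ∨
      R < (x - α) ^ 2 + (x - α) * (y - β) + (y - β) ^ 2 + ζ ^ 2)
    (htop : ∀ x y : ℤ, kelvinTop (w n).sign (kelvinNode w n false i j) x y ∈ S ∨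
      R < (x + 1 / 3 - α) ^ 2 + (x + 1 / 3 - α) * (y + 1 / 3 - β) + (y + 1 / 3 - β) ^ 2
        + (tetHeight - ζ) ^ 2) :
    ∃ c, IsDelaunay (kelvinNodes w) S c R := by
  refine ⟨_, isFrame_kelvin.isDelaunay_of_layer (kelvinShift_apply_two w) (n := n) (ζ := ζ) ?_ h0 h1
    hR hS (fun k l => ?_) fun k l => ?_⟩
  · simp only [kelvinBot, PiLp.add_apply, PiLp.smul_apply, ez_apply_two,
      isFrame_kelvin.node_apply_two (kelvinShift_apply_two w), levelHeight, isFrame_kelvin.apply_two₁,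
      isFrame_kelvin.apply_two₂, smul_eq_mul, Bool.false_eq_true, if_false]
    ring
  · obtain ⟨x, y, h⟩ := exists_kelvinNode_eq w n n false i j k l
    rw [kelvinNode, ← kelvinBot] at h
    rw [h, norm_kelvinBot_sub_sq (w n).sign_sq]
    exact hbot x y
  · obtain ⟨x, y, h⟩ := exists_kelvinNode_eq w n n false i j k l
    have h2 : node e₁ e₂ tetHeight (kelvinShift w) n true k l
        = kelvinTop (w n).sign (kelvinNode w n false i j) x y := by
      rw [node_true, ← kelvinNode, h]; rfl
    rw [h2, norm_kelvinTop_sub_sq (w n).sign_sq]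
    exact htop x y

theorem isDelaunay_kelvin_spacer (w : Word) (n i j : ℤ) {α β R : ℝ} {S : Set Space} (hR : R < 1)
    (hS : ∀ v ∈ S, v ∈ kelvinNodes w ∧
      ‖v - (kelvinNode w n true i j + (α • e₁ + β • e₂) + (1 / 2 : ℝ) • ez)‖ ^ 2 = R)
    (hxy : ∀ x y : ℤ, (kelvinNode w n true i j + ((x : ℝ) • e₁ + (y : ℝ) • e₂) ∈ S ∧
      kelvinNode w n true i j + ((x : ℝ) • e₁ + (y : ℝ) • e₂) + ez ∈ S) ∨
      R < (x - α) ^ 2 + (x - α) * (y - β) + (y - β) ^ 2 + 1 / 4) :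
    ∃ c, IsDelaunay (kelvinNodes w) S c R := by
  have key : ∀ k l, ∃ x y : ℤ, node e₁ e₂ tetHeight (kelvinShift w) n true k l
      = kelvinNode w n true i j + ((x : ℝ) • e₁ + (y : ℝ) • e₂) := fun k l => by
    refine ⟨k - i, l - j, ?_⟩
    rw [kelvinNode, ← node_add]
    congr 1 <;> ring
  refine ⟨_, isFrame_kelvin.isDelaunay_of_spacer (kelvinShift_apply_two w) (n := n) ?_
    hR hS (fun k l => ?_) fun k l => ?_⟩
  · simp only [PiLp.add_apply, PiLp.smul_apply, ez_apply_two,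
      isFrame_kelvin.node_apply_two (kelvinShift_apply_two w), levelHeight, isFrame_kelvin.apply_two₁,
      isFrame_kelvin.apply_two₂, smul_eq_mul, if_true]
    ring
  · obtain ⟨x, y, h⟩ := key k l
    rw [h]
    refine (hxy x y).imp And.left fun h => h.trans_eq ?_
    have e : kelvinNode w n true i j + ((x : ℝ) • e₁ + (y : ℝ) • e₂)
        - (kelvinNode w n true i j + (α • e₁ + β • e₂) + (1 / 2 : ℝ) • ez)
        = (x - α) • e₁ + (y - β) • e₂ + (-(1 / 2) : ℝ) • ez := by module
    rw [e, isFrame_kelvin.norm_sq]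
    ring
  · obtain ⟨x, y, h⟩ := key k l
    rw [h]
    refine (hxy x y).imp And.right fun h => h.trans_eq ?_
    have e : kelvinNode w n true i j + ((x : ℝ) • e₁ + (y : ℝ) • e₂) + ez
        - (kelvinNode w n true i j + (α • e₁ + β • e₂) + (1 / 2 : ℝ) • ez)
        = (x - α) • e₁ + (y - β) • e₂ + (1 / 2 : ℝ) • ez := by module
    rw [e, isFrame_kelvin.norm_sq]
    ring

theorem exists_isDelaunay {V P S : Set Space} {R : ℝ} (h : ∃ c, IsDelaunay V S c R) (hR : 0 < R)
    (hP : P = convexHull ℝ S) : ∃ S c R, 0 < R ∧ IsDelaunay V S c R ∧ P = convexHull ℝ S := by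
  obtain ⟨c, hc⟩ := h
  exact ⟨S, c, R, hR, hc, hP⟩

theorem isDelaunay_upTetrahedron (w : Word) (n i j : ℤ) : ∃ S c R, 0 < R ∧
    IsDelaunay (kelvinNodes w) S c R ∧
    upTetrahedron (w n).sign (kelvinNode w n false i j) = convexHull ℝ S := by
  set p := kelvinNode w n false i j
  have hh := tetHeight_sq
  have hB := norm_kelvinBot_sub_sq (w n).sign_sq p
  have hT := norm_kelvinTop_sub_sq (w n).sign_sq p
  have mB := kelvinBot_mem w n i j
  have mT := kelvinTop_mem w n i j
  -- The circumcentre of the regular tetrahedron is at a quarter of its height above the centroid of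
  -- the base, and the squared circumradius is `3 / 8`.
  refine exists_isDelaunay (isDelaunay_kelvin_layer w n i j (α := 1 / 3) (β := 1 / 3) (ζ := tetHeight / 4)
    (R := 3 / 8) (S := {kelvinBot (w n).sign p 0 0, kelvinBot (w n).sign p 1 0,
      kelvinBot (w n).sign p 0 1, kelvinTop (w n).sign p 0 0})
    (by linarith [tetHeight_pos]) (by linarith [tetHeight_pos]) (by norm_num) ?_ ?_ ?_) (by norm_num)
    (upTetrahedron_eq _ _)
  · rintro v (rfl | rfl | rfl | rfl)
    · exact ⟨by simpa using mB 0 0, by rw [hB]; linear_combination (1 / 16) * hh⟩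
    · exact ⟨by simpa using mB 1 0, by rw [hB]; linear_combination (1 / 16) * hh⟩
    · exact ⟨by simpa using mB 0 1, by rw [hB]; linear_combination (1 / 16) * hh⟩
    · exact ⟨by simpa using mT 0 0, by rw [hT]; linear_combination (9 / 16) * hh⟩
  · intro x y
    rcases kelvin_form_triangle x y with ⟨rfl, rfl⟩ | ⟨rfl, rfl⟩ | ⟨rfl, rfl⟩ | h
    · left; simp [p]
    · left; simp [p]
    · left; simp [p]
    · right
      have h : (1 : ℝ) ≤ x ^ 2 + x * y + y ^ 2 - x - y := by exact_mod_cast h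
      nlinarith
  · intro x y
    rcases kelvin_form_zero x y with ⟨rfl, rfl⟩ | h
    · left; simp [p]
    · right
      have h : (1 : ℝ) ≤ x ^ 2 + x * y + y ^ 2 := by exact_mod_cast h
      nlinarith

theorem isDelaunay_downTetrahedron (w : Word) (n i j : ℤ) : ∃ S c R, 0 < R ∧
    IsDelaunay (kelvinNodes w) S c R ∧
    downTetrahedron (w n).sign (kelvinNode w n false i j) = convexHull ℝ S := by
  set p := kelvinNode w n false i j
  have hh := tetHeight_sq
  have hB := norm_kelvinBot_sub_sq (w n).sign_sq p
  have hT := norm_kelvinTop_sub_sq (w n).sign_sq p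
  have mB := kelvinBot_mem w n i j
  have mT := kelvinTop_mem w n i j
  -- This tetrahedron stands on its tip, so its centre is above `p` at three quarters of the height.
  refine exists_isDelaunay (isDelaunay_kelvin_layer w n i j (α := 0) (β := 0) (ζ := 3 * tetHeight / 4)
    (R := 3 / 8) (S := {kelvinBot (w n).sign p 0 0, kelvinTop (w n).sign p 0 0,
      kelvinTop (w n).sign p (-1) 0, kelvinTop (w n).sign p 0 (-1)})
    (by linarith [tetHeight_pos]) (by linarith [tetHeight_pos]) (by norm_num) ?_ ?_ ?_) (by norm_num)
    (downTetrahedron_eq _ _)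
  · rintro v (rfl | rfl | rfl | rfl)
    · exact ⟨by simpa using mB 0 0, by rw [hB]; linear_combination (9 / 16) * hh⟩
    · exact ⟨by simpa using mT 0 0, by rw [hT]; linear_combination (1 / 16) * hh⟩
    · exact ⟨by simpa using mT (-1) 0, by rw [hT]; linear_combination (1 / 16) * hh⟩
    · exact ⟨by simpa using mT 0 (-1), by rw [hT]; linear_combination (1 / 16) * hh⟩
  · intro x y
    rcases kelvin_form_zero x y with ⟨rfl, rfl⟩ | h
    · left; simp [p]
    · right
      have h : (1 : ℝ) ≤ x ^ 2 + x * y + y ^ 2 := by exact_mod_cast h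
      nlinarith
  · intro x y
    rcases kelvin_form_triangle (-x) (-y) with ⟨hx, hy⟩ | ⟨hx, hy⟩ | ⟨hx, hy⟩ | h
    · obtain rfl : x = 0 := by omega
      obtain rfl : y = 0 := by omega
      left; simp [p]
    · obtain rfl : x = -1 := by omega
      obtain rfl : y = 0 := by omega
      left; simp [p]
    · obtain rfl : x = 0 := by omega
      obtain rfl : y = -1 := by omega
      left; simp [p]
    · right
      have h : (1 : ℝ) ≤ (-x) ^ 2 + (-x) * (-y) + (-y) ^ 2 - (-x) - (-y) := by exact_mod_cast h
      nlinarith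

theorem isDelaunay_octahedron (w : Word) (n i j : ℤ) : ∃ S c R, 0 < R ∧
    IsDelaunay (kelvinNodes w) S c R ∧
    octahedron (w n).sign (kelvinNode w n false i j) = convexHull ℝ S := by
  set p := kelvinNode w n false i j
  have hh := tetHeight_sq
  have hB := norm_kelvinBot_sub_sq (w n).sign_sq p
  have hT := norm_kelvinTop_sub_sq (w n).sign_sq p
  have mB := kelvinBot_mem w n i j
  have mT := kelvinTop_mem w n i j
  -- The centre of the octahedron is at half height above the centroid of its bottom triangle; the
  -- diagonal has length `√2`, so the squared radius is `1 / 2`.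
  refine exists_isDelaunay (isDelaunay_kelvin_layer w n i j (α := 2 / 3) (β := 2 / 3) (ζ := tetHeight / 2)
    (R := 1 / 2) (S := {kelvinBot (w n).sign p 1 0, kelvinBot (w n).sign p 0 1,
      kelvinBot (w n).sign p 1 1, kelvinTop (w n).sign p 0 0, kelvinTop (w n).sign p 1 0,
      kelvinTop (w n).sign p 0 1})
    (by linarith [tetHeight_pos]) (by linarith [tetHeight_pos]) (by norm_num) ?_ ?_ ?_) (by norm_num)
    (octahedron_eq _ _)
  · rintro v (rfl | rfl | rfl | rfl | rfl | rfl)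
    · exact ⟨by simpa using mB 1 0, by rw [hB]; linear_combination (1 / 4) * hh⟩
    · exact ⟨by simpa using mB 0 1, by rw [hB]; linear_combination (1 / 4) * hh⟩
    · exact ⟨by simpa using mB 1 1, by rw [hB]; linear_combination (1 / 4) * hh⟩
    · exact ⟨by simpa using mT 0 0, by rw [hT]; linear_combination (1 / 4) * hh⟩
    · exact ⟨by simpa using mT 1 0, by rw [hT]; linear_combination (1 / 4) * hh⟩
    · exact ⟨by simpa using mT 0 1, by rw [hT]; linear_combination (1 / 4) * hh⟩
  · intro x y
    rcases kelvin_form_triangle' x y with ⟨rfl, rfl⟩ | ⟨rfl, rfl⟩ | ⟨rfl, rfl⟩ | h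
    · left; simp [p]
    · left; simp [p]
    · left; simp [p]
    · right
      have h : (1 : ℝ) ≤ x ^ 2 + x * y + y ^ 2 - 2 * x - 2 * y + 1 := by exact_mod_cast h
      nlinarith
  · intro x y
    rcases kelvin_form_triangle x y with ⟨rfl, rfl⟩ | ⟨rfl, rfl⟩ | ⟨rfl, rfl⟩ | h
    · left; simp [p]
    · left; simp [p]
    · left; simp [p]
    · right
      have h : (1 : ℝ) ≤ x ^ 2 + x * y + y ^ 2 - x - y := by exact_mod_cast h
      nlinarith

theorem kelvinNode_true_add_mem (w : Word) (n i j x y : ℤ) :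
    kelvinNode w n true i j + ((x : ℝ) • e₁ + (y : ℝ) • e₂) ∈ kelvinNodes w ∧
    kelvinNode w n true i j + ((x : ℝ) • e₁ + (y : ℝ) • e₂) + ez ∈ kelvinNodes w := by
  rw [kelvinNode, ← node_add, ← node_succ_false]
  exact ⟨node_mem .., node_mem ..⟩

theorem norm_kelvin_prism_sub_sq (q : Space) (x y α β s : ℝ) :
    ‖q + (x • e₁ + y • e₂) + s • ez - (q + (α • e₁ + β • e₂) + (1 / 2 : ℝ) • ez)‖ ^ 2
      = (x - α) ^ 2 + (x - α) * (y - β) + (y - β) ^ 2 + (s - 1 / 2) ^ 2 := by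
  have e : q + (x • e₁ + y • e₂) + s • ez - (q + (α • e₁ + β • e₂) + (1 / 2 : ℝ) • ez)
      = (x - α) • e₁ + (y - β) • e₂ + (s - 1 / 2) • ez := by module
  rw [e, isFrame_kelvin.norm_sq]
  ring

theorem isDelaunay_uprightPrism (w : Word) (n i j : ℤ) : ∃ S c R, 0 < R ∧
    IsDelaunay (kelvinNodes w) S c R ∧
    uprightPrism (kelvinNode w n true i j) = convexHull ℝ S := by
  set q := kelvinNode w n true i j
  have hm := kelvinNode_true_add_mem w n i j
  have hn := norm_kelvin_prism_sub_sq q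
  -- The squared radius is `1 / 3 + 1 / 4`, from the circumscribed circle of the base and half the
  -- height.
  refine exists_isDelaunay (isDelaunay_kelvin_spacer w n i j (α := 1 / 3) (β := 1 / 3) (R := 7 / 12)
    (S := {q, q + e₁, q + e₂, q + ez, q + e₁ + ez, q + e₂ + ez}) (by norm_num) ?_ ?_) (by norm_num)
    (rfl)
  · rintro v (rfl | rfl | rfl | rfl | rfl | rfl)
    · exact ⟨by simpa using (hm 0 0).1, by simpa using (hn 0 0 (1 / 3) (1 / 3) 0).trans (by norm_num)⟩
    · exact ⟨by simpa using (hm 1 0).1, by simpa using (hn 1 0 (1 / 3) (1 / 3) 0).trans (by norm_num)⟩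
    · exact ⟨by simpa using (hm 0 1).1, by simpa using (hn 0 1 (1 / 3) (1 / 3) 0).trans (by norm_num)⟩
    · exact ⟨by simpa using (hm 0 0).2, by simpa using (hn 0 0 (1 / 3) (1 / 3) 1).trans (by norm_num)⟩
    · exact ⟨by simpa using (hm 1 0).2, by simpa using (hn 1 0 (1 / 3) (1 / 3) 1).trans (by norm_num)⟩
    · exact ⟨by simpa using (hm 0 1).2, by simpa using (hn 0 1 (1 / 3) (1 / 3) 1).trans (by norm_num)⟩
  · intro x y
    rcases kelvin_form_triangle x y with ⟨rfl, rfl⟩ | ⟨rfl, rfl⟩ | ⟨rfl, rfl⟩ | h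
    · left; simp [q]
    · left; simp [q]
    · left; simp [q]
    · right
      have h : (1 : ℝ) ≤ x ^ 2 + x * y + y ^ 2 - x - y := by exact_mod_cast h
      nlinarith

theorem isDelaunay_uprightPrism' (w : Word) (n i j : ℤ) : ∃ S c R, 0 < R ∧
    IsDelaunay (kelvinNodes w) S c R ∧
    uprightPrism' (kelvinNode w n true i j) = convexHull ℝ S := by
  set q := kelvinNode w n true i j
  have hm := kelvinNode_true_add_mem w n i j
  have hn := norm_kelvin_prism_sub_sq q
  refine exists_isDelaunay (isDelaunay_kelvin_spacer w n i j (α := 2 / 3) (β := 2 / 3) (R := 7 / 12)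
    (S := {q + e₁, q + e₂, q + e₁ + e₂, q + e₁ + ez, q + e₂ + ez, q + e₁ + e₂ + ez})
    (by norm_num) ?_ ?_) (by norm_num)
    (rfl)
  · rintro v (rfl | rfl | rfl | rfl | rfl | rfl)
    · exact ⟨by simpa using (hm 1 0).1, by simpa using (hn 1 0 (2 / 3) (2 / 3) 0).trans (by norm_num)⟩
    · exact ⟨by simpa using (hm 0 1).1, by simpa using (hn 0 1 (2 / 3) (2 / 3) 0).trans (by norm_num)⟩
    · exact ⟨by simpa [add_assoc] using (hm 1 1).1,
        by simpa [q, add_assoc] using (hn 1 1 (2 / 3) (2 / 3) 0).trans (by norm_num : _ = (7 / 12 : ℝ))⟩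
    · exact ⟨by simpa using (hm 1 0).2, by simpa using (hn 1 0 (2 / 3) (2 / 3) 1).trans (by norm_num)⟩
    · exact ⟨by simpa using (hm 0 1).2, by simpa using (hn 0 1 (2 / 3) (2 / 3) 1).trans (by norm_num)⟩
    · exact ⟨by simpa [add_assoc] using (hm 1 1).2,
        by simpa [q, add_assoc] using (hn 1 1 (2 / 3) (2 / 3) 1).trans (by norm_num : _ = (7 / 12 : ℝ))⟩
  · intro x y
    rcases kelvin_form_triangle' x y with ⟨rfl, rfl⟩ | ⟨rfl, rfl⟩ | ⟨rfl, rfl⟩ | h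
    · left; simp [q, add_assoc]
    · left; simp [q]
    · left; simp [q]
    · right
      have h : (1 : ℝ) ≤ x ^ 2 + x * y + y ^ 2 - 2 * x - 2 * y + 1 := by exact_mod_cast h
      nlinarith

theorem isDelaunayFamily_kelvin (w : Word) :
    IsDelaunayFamily (kelvinNodes w) (elongatedKelvin w) := by
  intro P hP
  obtain ⟨n, i, j, rfl | rfl | rfl | rfl | rfl⟩ := mem_elongatedKelvin.1 hP
  exacts [isDelaunay_upTetrahedron w n i j, isDelaunay_downTetrahedron w n i j,
    isDelaunay_octahedron w n i j, isDelaunay_uprightPrism w n i j, isDelaunay_uprightPrism' w n i j]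

/-! ### Elongated Kelvin partitions: shapes of the cells -/

theorem IsFrame.inner_coords {f₁ f₂ : Space} {γ τ : ℝ} (hF : IsFrame f₁ f₂ γ τ)
    (x y z x' y' z' : ℝ) :
    inner ℝ (x • f₁ + y • f₂ + z • ez) (x' • f₁ + y' • f₂ + z' • ez)
      = x * x' + γ * (x * y' + x' * y) + y * y' + z * z' := by
  have h := norm_add_sq_real (x • f₁ + y • f₂ + z • ez) (x' • f₁ + y' • f₂ + z' • ez)
  have e : x • f₁ + y • f₂ + z • ez + (x' • f₁ + y' • f₂ + z' • ez)
      = (x + x') • f₁ + (y + y') • f₂ + (z + z') • ez := by module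
  rw [e, hF.norm_sq, hF.norm_sq, hF.norm_sq] at h
  linarith

theorem IsFrame.dist_eq_one {f₁ f₂ : Space} {γ τ : ℝ} (hF : IsFrame f₁ f₂ γ τ)
    {v v' : Space} (x y z : ℝ) (hv : v - v' = x • f₁ + y • f₂ + z • ez)
    (h : x ^ 2 + 2 * γ * x * y + y ^ 2 + z ^ 2 = 1) : dist v v' = 1 := by
  rw [dist_eq_norm, hv, ← sq_eq_sq₀ (norm_nonneg _) zero_le_one, hF.norm_sq, h, one_pow]

theorem forall_dist_eq_one_of_lt {m : ℕ} {p : Fin m → Space}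
    (h : ∀ i j, i < j → dist (p i) (p j) = 1) : ∀ i j, i ≠ j → dist (p i) (p j) = 1 := by
  intro i j hij
  rcases lt_or_gt_of_ne hij with h' | h'
  · exact h i j h'
  · rw [dist_comm]; exact h j i h'

theorem isRegularTetrahedron_of {a b c d : Space} (hab : dist a b = 1) (hac : dist a c = 1)
    (had : dist a d = 1) (hbc : dist b c = 1) (hbd : dist b d = 1) (hcd : dist c d = 1) :
    IsRegularTetrahedron (convexHull ℝ {a, b, c, d}) := by
  refine ⟨![a, b, c, d], forall_dist_eq_one_of_lt fun i j hij => ?_, ?_⟩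
  · fin_cases i <;> fin_cases j <;> first | exact absurd hij (by decide) | assumption
  · simp only [Matrix.range_cons, Matrix.range_empty, Set.union_empty, Set.singleton_union]

/-- `u`, `v`, `w` are the diagonals, pairwise orthogonal and of length `√2`. Prescribing them
unnormalized keeps the hypotheses free of square roots of two. -/
theorem isRegularOctahedron_of {a b c a' b' c' o u v w : Space}
    (ha : a = o + (1 / 2 : ℝ) • u) (hb : b = o + (1 / 2 : ℝ) • v) (hc : c = o + (1 / 2 : ℝ) • w)
    (ha' : a' = o - (1 / 2 : ℝ) • u) (hb' : b' = o - (1 / 2 : ℝ) • v)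
    (hc' : c' = o - (1 / 2 : ℝ) • w) (huu : inner ℝ u u = (2 : ℝ)) (hvv : inner ℝ v v = (2 : ℝ))
    (hww : inner ℝ w w = (2 : ℝ)) (huv : inner ℝ u v = (0 : ℝ)) (huw : inner ℝ u w = (0 : ℝ))
    (hvw : inner ℝ v w = (0 : ℝ)) :
    IsRegularOctahedron (convexHull ℝ {a, b, c, c', b', a'}) := by
  have h2 : (√2)⁻¹ * (√2)⁻¹ = (1 / 2 : ℝ) := by
    rw [← mul_inv, Real.mul_self_sqrt (by norm_num)]; norm_num
  have e : ∀ x : Space, (1 / √2) • ((1 / √2) • x) = (1 / 2 : ℝ) • x := fun x => by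
    rw [smul_smul, one_div, h2]
  refine ⟨o, fun i => (1 / √2) • ![u, v, w] i, ?_, ?_⟩
  · rw [orthonormal_iff_ite]
    intro i j
    simp only [inner_smul_left, inner_smul_right, one_div, RCLike.conj_to_real, ← mul_assoc, h2]
    have hvu := huv; have hwu := huw; have hwv := hvw
    rw [real_inner_comm] at hvu hwu hwv
    fin_cases i <;> fin_cases j <;>
      simp only [Fin.zero_eta, Fin.mk_one, Fin.reduceFinMk, Matrix.cons_val, huu, hvv, hww, huv, huw,
        hvw, hvu, hwu, hwv] <;> norm_num <;> decide
  · simp only [e]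
    congr 1
    have h1 : (Set.range fun i => o + (1 / 2 : ℝ) • ![u, v, w] i) = {a, b, c} := by
      rw [ha, hb, hc]; ext x; simp [Fin.exists_fin_succ, eq_comm]
    have h2 : (Set.range fun i => o - (1 / 2 : ℝ) • ![u, v, w] i) = {a', b', c'} := by
      rw [ha', hb', hc']; ext x; simp [Fin.exists_fin_succ, eq_comm]
    rw [h1, h2]
    ext x
    simp only [Set.mem_union, Set.mem_insert_iff, Set.mem_singleton_iff]
    tauto

theorem isTriangularPrism_of {a b c a' b' c' u : Space} (ha : a' = a + u) (hb : b' = b + u)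
    (hc : c' = c + u) (hab : dist a b = 1) (hac : dist a c = 1) (hbc : dist b c = 1) (hu : ‖u‖ = 1)
    (hub : inner ℝ u (b - a) = (0 : ℝ)) (huc : inner ℝ u (c - a) = (0 : ℝ)) :
    IsTriangularPrism (convexHull ℝ {a, b, c, a', b', c'}) := by
  refine ⟨![a, b, c], u, forall_dist_eq_one_of_lt fun i j hij => ?_, hu, fun i j => ?_, ?_⟩
  · fin_cases i <;> fin_cases j <;> first | exact absurd hij (by decide) | assumption
  · have h : ∀ i, inner ℝ u (![a, b, c] i - a) = (0 : ℝ) := by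
      intro i; fin_cases i <;> simp [hub, huc]
    rw [← sub_sub_sub_cancel_right _ _ a, inner_sub_right, h, h, sub_zero]
  · congr 1
    rw [ha, hb, hc]; ext x
    simp only [Set.mem_union, Set.mem_insert_iff, Set.mem_singleton_iff, Set.mem_range,
      Fin.exists_fin_succ, Matrix.cons_val_zero, Matrix.cons_val_succ, IsEmpty.exists_iff, or_false,
      @eq_comm _ _ x, or_assoc]

theorem isRegularTetrahedron_upTetrahedron {ε : ℝ} (hε : ε ^ 2 = 1) (p : Space) :
    IsRegularTetrahedron (upTetrahedron ε p) := by
  have hh := tetHeight_sq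
  have hF := isFrame_kelvin
  refine isRegularTetrahedron_of (hF.dist_eq_one (-ε) 0 0 (by module) ?_)
    (hF.dist_eq_one 0 (-ε) 0 (by module) ?_)
    (hF.dist_eq_one (-ε / 3) (-ε / 3) (-tetHeight) (by rw [δ]; module) ?_)
    (hF.dist_eq_one ε (-ε) 0 (by module) ?_)
    (hF.dist_eq_one (2 * ε / 3) (-ε / 3) (-tetHeight) (by rw [δ]; module) ?_)
    (hF.dist_eq_one (-ε / 3) (2 * ε / 3) (-tetHeight) (by rw [δ]; module) ?_)
  · linear_combination hε
  · linear_combination hε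
  · linear_combination (1 / 3) * hε + hh
  · linear_combination hε
  · linear_combination (1 / 3) * hε + hh
  · linear_combination (1 / 3) * hε + hh

theorem isRegularTetrahedron_downTetrahedron {ε : ℝ} (hε : ε ^ 2 = 1) (p : Space) :
    IsRegularTetrahedron (downTetrahedron ε p) := by
  have hh := tetHeight_sq
  have hF := isFrame_kelvin
  refine isRegularTetrahedron_of
    (hF.dist_eq_one (-ε / 3) (-ε / 3) (-tetHeight) (by rw [δ]; module) ?_)
    (hF.dist_eq_one (2 * ε / 3) (-ε / 3) (-tetHeight) (by rw [δ]; module) ?_)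
    (hF.dist_eq_one (-ε / 3) (2 * ε / 3) (-tetHeight) (by rw [δ]; module) ?_)
    (hF.dist_eq_one ε 0 0 (by module) ?_)
    (hF.dist_eq_one 0 ε 0 (by module) ?_)
    (hF.dist_eq_one (-ε) ε 0 (by module) ?_)
  · linear_combination (1 / 3) * hε + hh
  · linear_combination (1 / 3) * hε + hh
  · linear_combination (1 / 3) * hε + hh
  · linear_combination hε
  · linear_combination hε
  · linear_combination hε

theorem isRegularOctahedron_octahedron {ε : ℝ} (hε : ε ^ 2 = 1) (p : Space) :
    IsRegularOctahedron (octahedron ε p) := by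
  have hh := tetHeight_sq
  have hF := isFrame_kelvin
  -- Each of `u`, `v`, `w` leads to a bottom vertex from the opposite top vertex.
  refine isRegularOctahedron_of (o := p + (2 * ε / 3) • (e₁ + e₂) + (tetHeight / 2) • ez)
    (u := (2 * ε / 3) • e₁ + (-4 * ε / 3) • e₂ + (-tetHeight) • ez)
    (v := (-4 * ε / 3) • e₁ + (2 * ε / 3) • e₂ + (-tetHeight) • ez)
    (w := (2 * ε / 3) • e₁ + (2 * ε / 3) • e₂ + (-tetHeight) • ez)
    ?_ ?_ ?_ ?_ ?_ ?_ ?_ ?_ ?_ ?_ ?_ ?_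
  · module
  · module
  · module
  · rw [δ]; module
  · rw [δ]; module
  · rw [δ]; module
  · rw [hF.inner_coords]; linear_combination (4 / 3) * hε + hh
  · rw [hF.inner_coords]; linear_combination (4 / 3) * hε + hh
  · rw [hF.inner_coords]; linear_combination (4 / 3) * hε + hh
  · rw [hF.inner_coords]; linear_combination (-2 / 3) * hε + hh
  · rw [hF.inner_coords]; linear_combination (-2 / 3) * hε + hh
  · rw [hF.inner_coords]; linear_combination (-2 / 3) * hε + hh

theorem isTriangularPrism_uprightPrism (q : Space) : IsTriangularPrism (uprightPrism q) := by
  have hF := isFrame_kelvin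
  refine isTriangularPrism_of (u := ez) rfl rfl rfl (hF.dist_eq_one (-1) 0 0 (by module) (by norm_num))
    (hF.dist_eq_one 0 (-1) 0 (by module) (by norm_num))
    (hF.dist_eq_one 1 (-1) 0 (by module) (by norm_num)) norm_ez ?_ ?_
  · simp [inner_ez, e₁]
  · simp [inner_ez, e₂]

theorem isTriangularPrism_uprightPrism' (q : Space) : IsTriangularPrism (uprightPrism' q) := by
  have hF := isFrame_kelvin
  refine isTriangularPrism_of (u := ez) rfl rfl rfl
    (hF.dist_eq_one 1 (-1) 0 (by module) (by norm_num))
    (hF.dist_eq_one 0 (-1) 0 (by module) (by norm_num))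
    (hF.dist_eq_one (-1) 0 0 (by module) (by norm_num)) norm_ez ?_ ?_
  · simp [inner_ez, e₁, e₂]
  · simp [inner_ez, e₁, e₂]

theorem elongatedKelvin_shapes (w : Word) : ∀ P ∈ elongatedKelvin w,
    IsRegularTetrahedron P ∨ IsRegularOctahedron P ∨ IsTriangularPrism P := by
  intro P hP
  obtain ⟨n, i, j, rfl | rfl | rfl | rfl | rfl⟩ := mem_elongatedKelvin.1 hP
  · exact Or.inl (isRegularTetrahedron_upTetrahedron (w n).sign_sq _)
  · exact Or.inl (isRegularTetrahedron_downTetrahedron (w n).sign_sq _)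
  · exact Or.inr (Or.inl (isRegularOctahedron_octahedron (w n).sign_sq _))
  · exact Or.inr (Or.inr (isTriangularPrism_uprightPrism _))
  · exact Or.inr (Or.inr (isTriangularPrism_uprightPrism' _))

theorem isUniformPolyhedron_of_mem_elongatedKelvin {w : Word} {P : Set Space}
    (hP : P ∈ elongatedKelvin w) : IsUniformPolyhedron P := by
  rcases elongatedKelvin_shapes w P hP with h | h | h
  exacts [h.isUniformPolyhedron, h.isUniformPolyhedron, h.isUniformPolyhedron]

/-! ### Elongated Kelvin partitions: covering -/

/-- The parallelepiped with edges `ε e₁`, `ε e₂`, `ε δ + tetHeight ez` is cut by the planes `x + y +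
t = 1` and `x + y + t = 2` into a tetrahedron, an octahedron and a tetrahedron. The coefficients
here are the barycentric coordinates of the first piece. -/
theorem mem_upTetrahedron (ε : ℝ) (p : Space) {x y t : ℝ} (hx : 0 ≤ x) (hy : 0 ≤ y) (ht : 0 ≤ t)
    (h : x + y + t ≤ 1) :
    p + (x • ε • e₁ + y • ε • e₂) + t • (ε • δ + tetHeight • ez) ∈ upTetrahedron ε p := by
  refine mem_convexHull_of_sum ![p, p + ε • e₁, p + ε • e₂, p + ε • δ + tetHeight • ez]
    ![1 - x - y - t, x, y, t] ?_ ?_ ?_ ?_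
  · simp [Fin.forall_fin_succ]
  · simp only [Fin.forall_fin_succ]
    simp; exact ⟨by linarith, hx, hy, ht⟩
  · simp [Fin.sum_univ_four]; ring
  · simp only [Fin.sum_univ_four]; simp; module

theorem mem_downTetrahedron (ε : ℝ) (p : Space) {x y t : ℝ} (hx : x ≤ 1) (hy : y ≤ 1) (ht : t ≤ 1)
    (h : 2 ≤ x + y + t) :
    p + (x • ε • e₁ + y • ε • e₂) + t • (ε • δ + tetHeight • ez)
      ∈ downTetrahedron ε (p + ε • (e₁ + e₂)) := by
  set p' := p + ε • (e₁ + e₂) with hp'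
  refine mem_convexHull_of_sum ![p', p' + ε • δ + tetHeight • ez,
    p' + ε • (δ - e₁) + tetHeight • ez, p' + ε • (δ - e₂) + tetHeight • ez]
    ![1 - t, x + y + t - 2, 1 - x, 1 - y] ?_ ?_ ?_ ?_
  · simp [Fin.forall_fin_succ]
  · simp only [Fin.forall_fin_succ]
    simp; exact ⟨by linarith, by linarith, by linarith, by linarith⟩
  · simp [Fin.sum_univ_four]; ring
  · simp only [Fin.sum_univ_four]; simp; rw [hp']; module

/-- Along the three diagonals the point has coordinates `1 - y - t`, `1 - x - t` and `x + y - 1`,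
and the octahedron is the region where their absolute values sum to at most one. Each coordinate is
carried by one end of its diagonal, and the slack is divided equally among the six vertices. -/
theorem mem_octahedron (ε : ℝ) (p : Space) {x y t : ℝ} (hx : 0 ≤ x) (hy : 0 ≤ y) (ht : 0 ≤ t)
    (hx1 : x ≤ 1) (hy1 : y ≤ 1) (ht1 : t ≤ 1) (h1 : 1 ≤ x + y + t) (h2 : x + y + t ≤ 2) :
    p + (x • ε • e₁ + y • ε • e₂) + t • (ε • δ + tetHeight • ez) ∈ octahedron ε p := by
  have hle : |y + t - 1| + |x + t - 1| + |x + y - 1| ≤ 1 := by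
    rcases abs_cases (y + t - 1) with h | h <;> rcases abs_cases (x + t - 1) with h' | h' <;>
      rcases abs_cases (x + y - 1) with h'' | h'' <;> linarith
  have ha := neg_abs_le (y + t - 1)
  have ha' := le_abs_self (y + t - 1)
  have hb := neg_abs_le (x + t - 1)
  have hb' := le_abs_self (x + t - 1)
  have hc := neg_abs_le (x + y - 1)
  have hc' := le_abs_self (x + y - 1)
  set A := |y + t - 1|
  set B := |x + t - 1|
  set C := |x + y - 1|
  refine mem_convexHull_of_sum ![p + ε • e₁, p + ε • e₂, p + ε • (e₁ + e₂),
    p + ε • δ + tetHeight • ez, p + ε • (δ + e₁) + tetHeight • ez,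
    p + ε • (δ + e₂) + tetHeight • ez]
    ![(A - (y + t - 1)) / 2 + (1 - A - B - C) / 6, (B - (x + t - 1)) / 2 + (1 - A - B - C) / 6,
      (C + (x + y - 1)) / 2 + (1 - A - B - C) / 6, (C - (x + y - 1)) / 2 + (1 - A - B - C) / 6,
      (B + (x + t - 1)) / 2 + (1 - A - B - C) / 6, (A + (y + t - 1)) / 2 + (1 - A - B - C) / 6]
    ?_ ?_ ?_ ?_
  · simp [Fin.forall_fin_succ]
  · simp only [Fin.forall_fin_succ]
    simp; refine ⟨?_, ?_, ?_, ?_, ?_, ?_⟩ <;> linarith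
  · simp [Fin.sum_univ_succ]; ring
  · simp only [Fin.sum_univ_six]; simp; module

theorem mem_uprightPrism (q : Space) {x y t : ℝ} (hx : 0 ≤ x) (hy : 0 ≤ y) (ht : 0 ≤ t)
    (ht1 : t ≤ 1) (h : x + y ≤ 1) :
    q + (x • e₁ + y • e₂) + t • ez ∈ uprightPrism q := by
  refine add_smul_mem_convexHull ht ht1 (S := {q, q + e₁, q + e₂})
    (mem_convexHull_of_sum ![q, q + e₁, q + e₂] ![1 - x - y, x, y] ?_ ?_ ?_ ?_) ?_ ?_
  · simp [Fin.forall_fin_succ]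
  · simp only [Fin.forall_fin_succ]
    simp; exact ⟨by linarith, hx, hy⟩
  · simp [Fin.sum_univ_three]; ring
  · simp only [Fin.sum_univ_three]; simp; module
  · rintro v (rfl | rfl | rfl) <;> simp
  · rintro v (rfl | rfl | rfl) <;> simp

theorem mem_uprightPrism' (q : Space) {x y t : ℝ} (hx : x ≤ 1) (hy : y ≤ 1) (ht : 0 ≤ t)
    (ht1 : t ≤ 1) (h : 1 ≤ x + y) :
    q + (x • e₁ + y • e₂) + t • ez ∈ uprightPrism' q := by
  refine add_smul_mem_convexHull ht ht1 (S := {q + e₁, q + e₂, q + e₁ + e₂})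
    (mem_convexHull_of_sum ![q + e₁, q + e₂, q + e₁ + e₂] ![1 - y, 1 - x, x + y - 1] ?_ ?_ ?_ ?_) ?_ ?_
  · simp [Fin.forall_fin_succ]
  · simp only [Fin.forall_fin_succ]
    simp; exact ⟨by linarith, by linarith, by linarith⟩
  · simp [Fin.sum_univ_three]; ring
  · simp only [Fin.sum_univ_three]; simp; module
  · rintro v (rfl | rfl | rfl) <;> simp
  · rintro v (rfl | rfl | rfl) <;> simp

theorem sUnion_elongatedKelvin (w : Word) : ⋃₀ elongatedKelvin w = Set.univ := by
  refine Set.eq_univ_of_forall fun v => ?_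
  obtain ⟨n, i, j, x, y, t, hx, hx1, hy, hy1, ht, ht1, hv | hv⟩ := isFrame_kelvin.exists_layer_coords
    (kelvinShift_apply_two w) (η := fun n => (w n).intSign) (fun n => (w n).intSign_eq_or) v
  · rw [Letter.cast_intSign, ← kelvinNode, kelvinShift] at hv
    rcases le_total (x + y + t) 1 with h | h
    · exact ⟨_, mem_elongatedKelvin.2 ⟨n, i, j, Or.inl rfl⟩, hv ▸ mem_upTetrahedron _ _ hx hy ht h⟩
    rcases le_total (x + y + t) 2 with h' | h'
    · exact ⟨_, mem_elongatedKelvin.2 ⟨n, i, j, Or.inr (Or.inr (Or.inl rfl))⟩,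
        hv ▸ mem_octahedron _ _ hx hy ht hx1 hy1 ht1 h h'⟩
    -- The last piece of the parallelepiped is the tetrahedron whose tip is the opposite corner of
    -- the base cell.
    · have := kelvinNode_add_sign w n n false i j 1 1
      simp only [Int.cast_one, one_smul] at this
      refine ⟨_, mem_elongatedKelvin.2 ⟨n, i + (w n).intSign * 1, j + (w n).intSign * 1, Or.inr (Or.inl rfl)⟩, ?_⟩
      rw [← this, hv]
      exact mem_downTetrahedron _ _ hx1 hy1 ht1 h'
  · rw [← kelvinNode] at hv
    rcases le_total (x + y) 1 with h | h
    · exact ⟨_, mem_elongatedKelvin.2 ⟨n, i, j, Or.inr (Or.inr (Or.inr (Or.inl rfl)))⟩,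
        hv ▸ mem_uprightPrism _ hx hy ht ht1 h⟩
    · exact ⟨_, mem_elongatedKelvin.2 ⟨n, i, j, Or.inr (Or.inr (Or.inr (Or.inr rfl)))⟩,
        hv ▸ mem_uprightPrism' _ hx1 hy1 ht ht1 h⟩

theorem isNormalPartition_elongatedKelvin (w : Word) : IsNormalPartition (elongatedKelvin w) :=
  (isDelaunayFamily_kelvin w).isNormalPartition
    (fun _ hP => (isUniformPolyhedron_of_mem_elongatedKelvin hP).1)
    (isFrame_kelvin.finite_nodes_inter_closedBall (kelvinShift_apply_two w))
    (sUnion_elongatedKelvin w)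

theorem vertices_elongatedKelvin (w : Word) : vertices (elongatedKelvin w) = kelvinNodes w := by
  refine (isDelaunayFamily_kelvin w).vertices_eq ?_
  rintro v -
  have := Set.mem_univ v
  rwa [← sUnion_elongatedKelvin w] at this

theorem isLayeredFamily_elongatedKelvin :
    IsLayeredFamily e₁ e₂ (1 / 2) tetHeight kelvinShift elongatedKelvin :=
  ⟨isFrame_kelvin, kelvinShift_apply_two, vertices_elongatedKelvin⟩

/-! ### Nodes contained in a given cell -/

namespace IsFrame

variable {f₁ f₂ : Space} {γ τ : ℝ} {s : ℤ → Space}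

/-- Nodes in a cell of layer `n` lie on the boundary of layer `n`. -/
theorem eq_of_mem_layer (hF : IsFrame f₁ f₂ γ τ) (hs : ∀ n, s n 2 = 0) {S : Set Space} {n m : ℤ}
    {b : Bool} {i j : ℤ} (hS : ∀ x ∈ S, levelHeight τ n false ≤ x 2 ∧ x 2 ≤ levelHeight τ n true)
    (h : node f₁ f₂ τ s m b i j ∈ convexHull ℝ S) : m = n := by
  obtain ⟨h1, h2⟩ := apply_two_mem_of_mem_convexHull hS h
  rw [hF.node_apply_two hs] at h1 h2
  have := hF.le_τ
  rcases lt_trichotomy m n with h | h | h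
  · have h' : (m : ℝ) + 1 ≤ n := by exact_mod_cast h
    cases b <;> simp only [levelHeight, if_true, Bool.false_eq_true, if_false] at h1 h2 <;>
      exfalso <;> nlinarith
  · exact h
  · have h' : (n : ℝ) + 1 ≤ m := by exact_mod_cast h
    cases b <;> simp only [levelHeight, if_true, Bool.false_eq_true, if_false] at h1 h2 <;>
      exfalso <;> nlinarith

/-- Nodes in a cell between layers `n` and `n + 1` lie on the boundary of these layers. -/
theorem eq_of_mem_spacer (hF : IsFrame f₁ f₂ γ τ) (hs : ∀ n, s n 2 = 0) {S : Set Space} {n m : ℤ}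
    {b : Bool} {i j : ℤ}
    (hS : ∀ x ∈ S, levelHeight τ n true ≤ x 2 ∧ x 2 ≤ levelHeight τ (n + 1) false)
    (h : node f₁ f₂ τ s m b i j ∈ convexHull ℝ S) : (m = n ∧ b = true) ∨ (m = n + 1 ∧ b = false) := by
  obtain ⟨h1, h2⟩ := apply_two_mem_of_mem_convexHull hS h
  rw [hF.node_apply_two hs] at h1 h2
  have := hF.le_τ
  rcases lt_trichotomy m n with h | h | h
  · have h' : (m : ℝ) + 1 ≤ n := by exact_mod_cast h
    cases b <;> simp only [levelHeight, if_true, Bool.false_eq_true, if_false] at h1 h2 <;>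
      exfalso <;> nlinarith
  · subst h
    cases b <;> simp only [levelHeight, if_true, Bool.false_eq_true, if_false] at h1 h2
    · exfalso; linarith
    · simp
  · rcases eq_or_lt_of_le (Int.add_one_le_iff.2 h) with h' | h'
    · subst h'
      cases b <;> simp only [levelHeight, if_true, Bool.false_eq_true, if_false] at h1 h2
      · simp
      · push_cast at h2; exfalso; linarith
    · have h' : (n : ℝ) + 1 + 1 ≤ m := by exact_mod_cast h'
      cases b <;> simp only [levelHeight, if_true, Bool.false_eq_true, if_false] at h1 h2 <;>
        push_cast at h2 <;> exfalso <;> nlinarith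

end IsFrame

/-! ### Elongated Kelvin partitions: the cells around a vertex -/

theorem upTetrahedron_mem (w : Word) (n i j : ℤ) :
    upTetrahedron (w n).sign (kelvinNode w n false i j) ∈ elongatedKelvin w :=
  mem_elongatedKelvin.2 ⟨n, i, j, Or.inl rfl⟩

theorem downTetrahedron_mem (w : Word) (n i j : ℤ) :
    downTetrahedron (w n).sign (kelvinNode w n false i j) ∈ elongatedKelvin w :=
  mem_elongatedKelvin.2 ⟨n, i, j, Or.inr (Or.inl rfl)⟩

theorem octahedron_mem (w : Word) (n i j : ℤ) :
    octahedron (w n).sign (kelvinNode w n false i j) ∈ elongatedKelvin w :=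
  mem_elongatedKelvin.2 ⟨n, i, j, Or.inr (Or.inr (Or.inl rfl))⟩

theorem uprightPrism_mem (w : Word) (n i j : ℤ) :
    uprightPrism (kelvinNode w n true i j) ∈ elongatedKelvin w :=
  mem_elongatedKelvin.2 ⟨n, i, j, Or.inr (Or.inr (Or.inr (Or.inl rfl)))⟩

theorem uprightPrism'_mem (w : Word) (n i j : ℤ) :
    uprightPrism' (kelvinNode w n true i j) ∈ elongatedKelvin w :=
  mem_elongatedKelvin.2 ⟨n, i, j, Or.inr (Or.inr (Or.inr (Or.inr rfl)))⟩

theorem kelvinNode_false_sub_ez (w : Word) (n i j : ℤ) :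
    kelvinNode w n false i j - ez = kelvinNode w (n - 1) true i j := by
  rw [sub_eq_iff_eq_add, ← node_succ_false, sub_add_cancel]

theorem eq_of_mem_kelvin_layer {w : Word} {n m i j k l : ℤ} {b : Bool}
    (h : kelvinNode w m b i j ∈ upTetrahedron (w n).sign (kelvinNode w n false k l) ∨
      kelvinNode w m b i j ∈ downTetrahedron (w n).sign (kelvinNode w n false k l) ∨
      kelvinNode w m b i j ∈ octahedron (w n).sign (kelvinNode w n false k l)) : m = n := by
  have hh := tetHeight_pos
  have hn := isFrame_kelvin.node_apply_two (kelvinShift_apply_two w) n false k l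
  have h1 := isFrame_kelvin.apply_two₁
  have h2 := isFrame_kelvin.apply_two₂
  rcases h with h | h | h <;> refine isFrame_kelvin.eq_of_mem_layer (kelvinShift_apply_two w) ?_ h
  · rintro x (rfl | rfl | rfl | rfl) <;>
      simp [hn, δ, h1, h2, ez_apply_two, levelHeight, hh.le]
  · rintro x (rfl | rfl | rfl | rfl) <;>
      simp [hn, δ, h1, h2, ez_apply_two, levelHeight, hh.le]
  · rintro x (rfl | rfl | rfl | rfl | rfl | rfl) <;>
      simp [hn, δ, h1, h2, ez_apply_two, levelHeight, hh.le]

theorem eq_of_mem_kelvin_spacer {w : Word} {n m i j k l : ℤ} {b : Bool}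
    (h : kelvinNode w m b i j ∈ uprightPrism (kelvinNode w n true k l) ∨
      kelvinNode w m b i j ∈ uprightPrism' (kelvinNode w n true k l)) :
    (m = n ∧ b = true) ∨ (m = n + 1 ∧ b = false) := by
  have hn := isFrame_kelvin.node_apply_two (kelvinShift_apply_two w) n true k l
  have h1 := isFrame_kelvin.apply_two₁
  have h2 := isFrame_kelvin.apply_two₂
  have e : levelHeight tetHeight (n + 1) false = levelHeight tetHeight n true + 1 := by
    simp only [levelHeight, if_true, Bool.false_eq_true, if_false]; push_cast; ring
  rcases h with h | h <;> refine isFrame_kelvin.eq_of_mem_spacer (kelvinShift_apply_two w) ?_ h <;>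
    rintro x (rfl | rfl | rfl | rfl | rfl | rfl) <;> simp [hn, h1, h2, ez_apply_two, e]

/-- Heights leave only the cells of layer `n` and of the spacer below it, so the star depends on the
single letter `w n`. This locality is why all stars can be congruent. -/
theorem kelvin_star_false {w : Word} {n i j : ℤ} {P : Set Space} (hP : P ∈ elongatedKelvin w)
    (h : kelvinNode w n false i j ∈ P) : ∃ k l : ℤ,
    P = upTetrahedron (w n).sign (kelvinNode w n false k l) ∨
    P = downTetrahedron (w n).sign (kelvinNode w n false k l) ∨
    P = octahedron (w n).sign (kelvinNode w n false k l) ∨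
    P = uprightPrism (kelvinNode w n false k l - ez) ∨
    P = uprightPrism' (kelvinNode w n false k l - ez) := by
  simp only [kelvinNode_false_sub_ez]
  obtain ⟨m, k, l, rfl | rfl | rfl | rfl | rfl⟩ := mem_elongatedKelvin.1 hP
  · obtain rfl := eq_of_mem_kelvin_layer (Or.inl h); exact ⟨k, l, by simp⟩
  · obtain rfl := eq_of_mem_kelvin_layer (Or.inr (Or.inl h)); exact ⟨k, l, by simp⟩
  · obtain rfl := eq_of_mem_kelvin_layer (Or.inr (Or.inr h)); exact ⟨k, l, by simp⟩
  · obtain ⟨-, h⟩ | ⟨rfl, -⟩ := eq_of_mem_kelvin_spacer (Or.inl h)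
    · cases h
    · exact ⟨k, l, by simp⟩
  · obtain ⟨-, h⟩ | ⟨rfl, -⟩ := eq_of_mem_kelvin_spacer (Or.inr h)
    · cases h
    · exact ⟨k, l, by simp⟩

theorem kelvin_star_true {w : Word} {n i j : ℤ} {P : Set Space} (hP : P ∈ elongatedKelvin w)
    (h : kelvinNode w n true i j ∈ P) : ∃ k l : ℤ,
    P = upTetrahedron (w n).sign (kelvinNode w n false k l) ∨
    P = downTetrahedron (w n).sign (kelvinNode w n false k l) ∨
    P = octahedron (w n).sign (kelvinNode w n false k l) ∨
    P = uprightPrism (kelvinNode w n true k l) ∨ P = uprightPrism' (kelvinNode w n true k l) := by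
  obtain ⟨m, k, l, rfl | rfl | rfl | rfl | rfl⟩ := mem_elongatedKelvin.1 hP
  · obtain rfl := eq_of_mem_kelvin_layer (Or.inl h); exact ⟨k, l, by simp⟩
  · obtain rfl := eq_of_mem_kelvin_layer (Or.inr (Or.inl h)); exact ⟨k, l, by simp⟩
  · obtain rfl := eq_of_mem_kelvin_layer (Or.inr (Or.inr h)); exact ⟨k, l, by simp⟩
  · obtain ⟨rfl, -⟩ | ⟨-, h⟩ := eq_of_mem_kelvin_spacer (Or.inl h)
    · exact ⟨k, l, by simp⟩
    · cases h
  · obtain ⟨rfl, -⟩ | ⟨-, h⟩ := eq_of_mem_kelvin_spacer (Or.inr h)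
    · exact ⟨k, l, by simp⟩
    · cases h

/-! ### Elongated Kelvin partitions: images of cells -/

section Images

variable {g : Space ≃ᵃⁱ[ℝ] Space} {L : Space ≃ₗᵢ[ℝ] Space} {κ : ℝ}

/-- An isometry that keeps `ez` and acts on the horizontal generators as `κ` multiplies the sign of
the cell by `κ`; with `κ = -1` it interchanges the two letters. -/
theorem image_upTetrahedron (hg : ∀ x u, g (x + u) = g x + L u) (h1 : L e₁ = κ • e₁)
    (h2 : L e₂ = κ • e₂) (h3 : L ez = ez) (ε : ℝ) (p : Space) :
    g '' upTetrahedron ε p = upTetrahedron (κ * ε) (g p) := by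
  have hδ : L δ = κ • δ := by simp only [δ, map_add, map_smul, h1, h2]; module
  have e : ∀ x : Space, ε • κ • x = (κ * ε) • x := fun x => by rw [smul_smul, mul_comm]
  simp only [upTetrahedron, image_convexHull_isometry, Set.image_insert_eq, Set.image_singleton, hg,
    map_smul, hδ, h1, h2, h3, e]

theorem image_downTetrahedron (hg : ∀ x u, g (x + u) = g x + L u) (h1 : L e₁ = κ • e₁)
    (h2 : L e₂ = κ • e₂) (h3 : L ez = ez) (ε : ℝ) (p : Space) :
    g '' downTetrahedron ε p = downTetrahedron (κ * ε) (g p) := by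
  have hδ : L δ = κ • δ := by simp only [δ, map_add, map_smul, h1, h2]; module
  have e : ∀ x : Space, ε • κ • x = (κ * ε) • x := fun x => by rw [smul_smul, mul_comm]
  simp only [downTetrahedron, image_convexHull_isometry, Set.image_insert_eq, Set.image_singleton,
    hg, map_sub, map_smul, hδ, h1, h2, h3, e, ← smul_sub]

theorem image_octahedron (hg : ∀ x u, g (x + u) = g x + L u) (h1 : L e₁ = κ • e₁)
    (h2 : L e₂ = κ • e₂) (h3 : L ez = ez) (ε : ℝ) (p : Space) :
    g '' octahedron ε p = octahedron (κ * ε) (g p) := by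
  have hδ : L δ = κ • δ := by simp only [δ, map_add, map_smul, h1, h2]; module
  have e : ∀ x : Space, ε • κ • x = (κ * ε) • x := fun x => by rw [smul_smul, mul_comm]
  simp only [octahedron, image_convexHull_isometry, Set.image_insert_eq, Set.image_singleton,
    hg, map_add, map_smul, hδ, h1, h2, h3, e, ← smul_add]

theorem image_uprightPrism (hg : ∀ x u, g (x + u) = g x + L u) (h1 : L e₁ = e₁)
    (h2 : L e₂ = e₂) (h3 : L ez = ez) (q : Space) :
    g '' uprightPrism q = uprightPrism (g q) ∧ g '' uprightPrism' q = uprightPrism' (g q) := by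
  simp only [uprightPrism, uprightPrism', image_convexHull_isometry, Set.image_insert_eq,
    Set.image_singleton, hg, h1, h2, h3, and_self]

/-- A half turn reverses the orientation of lattice triangles, so it exchanges the two kinds of
prisms. -/
theorem image_uprightPrism_of_neg (hg : ∀ x u, g (x + u) = g x + L u) (h1 : L e₁ = -e₁)
    (h2 : L e₂ = -e₂) (h3 : L ez = ez) (q : Space) :
    g '' uprightPrism q = uprightPrism' (g q - e₁ - e₂) ∧
      g '' uprightPrism' q = uprightPrism (g q - e₁ - e₂) := by
  have a1 : g q - e₁ - e₂ + e₁ = g q + -e₂ := by abel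
  have a2 : g q - e₁ - e₂ + e₂ = g q + -e₁ := by abel
  have a3 : g q - e₁ - e₂ = g q + -e₁ + -e₂ := by abel
  have a4 : g q + -e₂ + e₂ = g q := by abel
  simp only [uprightPrism, uprightPrism', image_convexHull_isometry, Set.image_insert_eq,
    Set.image_singleton, hg, h1, h2, h3, a1, a2, a4]
  rw [a3]
  constructor <;> congr 1 <;> ext x <;>
    simp only [Set.mem_insert_iff, Set.mem_singleton_iff] <;> tauto

/-- A point reflection exchanges the two kinds of tetrahedra. -/
theorem image_kelvin_layer_of_neg (hg : ∀ x u, g (x + u) = g x - u) (ε : ℝ) (p : Space) :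
    g '' upTetrahedron ε p = downTetrahedron ε (g p - (ε • δ + tetHeight • ez)) ∧
    g '' downTetrahedron ε p = upTetrahedron ε (g p - (ε • δ + tetHeight • ez)) ∧
    g '' octahedron ε p
      = octahedron ε (g p - (ε • δ + tetHeight • ez) + ε • ((-1 : ℝ) • e₁ + (-1 : ℝ) • e₂)) := by
  simp only [upTetrahedron, downTetrahedron, octahedron, image_convexHull_isometry,
    Set.image_insert_eq, Set.image_singleton, hg]
  refine ⟨?_, ?_, ?_⟩
  · congr 1
    have a1 : g p - ε • δ - tetHeight • ez = g p - (ε • δ + tetHeight • ez) := by abel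
    have a2 : g p - (ε • δ + tetHeight • ez) + ε • δ + tetHeight • ez = g p := by abel
    have a3 : g p - (ε • δ + tetHeight • ez) + ε • (δ - e₁) + tetHeight • ez = g p - ε • e₁ := by
      module
    have a4 : g p - (ε • δ + tetHeight • ez) + ε • (δ - e₂) + tetHeight • ez = g p - ε • e₂ := by
      module
    rw [a1, a2, a3, a4]
    ext x; simp only [Set.mem_insert_iff, Set.mem_singleton_iff]; tauto
  · congr 1
    have a1 : g p - ε • δ - tetHeight • ez = g p - (ε • δ + tetHeight • ez) := by abel
    have a2 : g p - (ε • δ + tetHeight • ez) + ε • δ + tetHeight • ez = g p := by abel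
    have a3 : g p - ε • (δ - e₁) - tetHeight • ez = g p - (ε • δ + tetHeight • ez) + ε • e₁ := by
      module
    have a4 : g p - ε • (δ - e₂) - tetHeight • ez = g p - (ε • δ + tetHeight • ez) + ε • e₂ := by
      module
    rw [a1, a2, a3, a4]
    ext x; simp only [Set.mem_insert_iff, Set.mem_singleton_iff]; tauto
  · congr 1
    set p' := g p - (ε • δ + tetHeight • ez) + ε • ((-1 : ℝ) • e₁ + (-1 : ℝ) • e₂) with hp'
    have a1 : g p - ε • e₁ = p' + ε • (δ + e₂) + tetHeight • ez := by rw [hp']; module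
    have a2 : g p - ε • e₂ = p' + ε • (δ + e₁) + tetHeight • ez := by rw [hp']; module
    have a3 : g p - ε • (e₁ + e₂) = p' + ε • δ + tetHeight • ez := by rw [hp']; module
    have a4 : g p - ε • δ - tetHeight • ez = p' + ε • (e₁ + e₂) := by rw [hp']; module
    have a5 : g p - ε • (δ + e₁) - tetHeight • ez = p' + ε • e₂ := by rw [hp']; module
    have a6 : g p - ε • (δ + e₂) - tetHeight • ez = p' + ε • e₁ := by rw [hp']; module
    rw [a1, a2, a3, a4, a5, a6]
    ext x; simp only [Set.mem_insert_iff, Set.mem_singleton_iff]; tauto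

theorem image_kelvin_spacer_of_neg (hg : ∀ x u, g (x + u) = g x - u) (q : Space) :
    g '' uprightPrism q = uprightPrism' (g q - ez + ((-1 : ℝ) • e₁ + (-1 : ℝ) • e₂)) ∧
    g '' uprightPrism' q = uprightPrism (g q - ez + ((-1 : ℝ) • e₁ + (-1 : ℝ) • e₂)) := by
  set q' := g q - ez + ((-1 : ℝ) • e₁ + (-1 : ℝ) • e₂) with hq'
  have b : g q = q' + e₁ + e₂ + ez := by rw [hq']; module
  simp only [uprightPrism, uprightPrism', image_convexHull_isometry,
    Set.image_insert_eq, Set.image_singleton, hg, b]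
  have a1 : q' + e₁ + e₂ + ez - e₁ = q' + e₂ + ez := by abel
  have a2 : q' + e₁ + e₂ + ez - e₂ = q' + e₁ + ez := by abel
  have a3 : q' + e₁ + e₂ + ez - ez = q' + e₁ + e₂ := by abel
  have a4 : q' + e₂ + ez - ez = q' + e₂ := by abel
  have a5 : q' + e₁ + ez - ez = q' + e₁ := by abel
  have a6 : q' + e₂ + ez - e₂ = q' + ez := by abel
  have a7 : q' + ez - ez = q' := by abel
  simp only [a1, a2, a3, a4, a5, a6, a7]
  constructor <;> congr 1 <;> ext x <;>
    simp only [Set.mem_insert_iff, Set.mem_singleton_iff] <;> tauto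

end Images

/-! ### Elongated Kelvin partitions: congruence of stars -/

/-- For `κ = -1` this is the reflection in the vertical line through the origin, that is, the half
turn about it. -/
theorem exists_halfTurn {κ : ℤ} (hκ : κ = 1 ∨ κ = -1) : ∃ L : Space ≃ₗᵢ[ℝ] Space,
    (∀ x, L (L x) = x) ∧ (∀ x : Space, x 2 = 0 → L x = (κ : ℝ) • x) ∧ L ez = ez := by
  rcases hκ with rfl | rfl
  · exact ⟨LinearIsometryEquiv.refl ℝ Space, by simp, by simp, by simp⟩
  · refine ⟨(Submodule.span ℝ {ez}).reflection, fun x => Submodule.reflection_reflection _ x,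
      fun x hx => ?_, ?_⟩
    · rw [Submodule.reflection_mem_subspace_orthogonalComplement_eq_neg]
      · simp
      · rwa [Submodule.mem_orthogonal_singleton_iff_inner_right, inner_ez]
    · exact Submodule.reflection_mem_subspace_eq_self (Submodule.mem_span_singleton_self ez)

/-- Only cells at the given vertex are claimed to go to cells: their layer has the right letter
after multiplication by `κ`, and the adjacent prism layer is invariant under the half turn. Nothing
is known about other layers. -/
theorem kelvin_star_map {w w' : Word} {n n' i j i' j' : ℤ} {g : Space ≃ᵃⁱ[ℝ] Space}
    {L : Space ≃ₗᵢ[ℝ] Space} {κ : ℤ} (hκ : κ = 1 ∨ κ = -1)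
    (hsign : κ * (w n).intSign = (w' n').intSign) (hg : ∀ x u, g (x + u) = g x + L u)
    (h0 : ∀ x : Space, x 2 = 0 → L x = (κ : ℝ) • x) (h3 : L ez = ez)
    (hv : g (kelvinNode w n false i j) = kelvinNode w' n' false i' j') {P : Set Space}
    (hP : P ∈ elongatedKelvin w) (hvP : kelvinNode w n false i j ∈ P) :
    g '' P ∈ elongatedKelvin w' := by
  have h1 : L e₁ = (κ : ℝ) • e₁ := h0 _ isFrame_kelvin.apply_two₁
  have h2 : L e₂ = (κ : ℝ) • e₂ := h0 _ isFrame_kelvin.apply_two₂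
  have hs : (κ : ℝ) * (w n).sign = (w' n').sign := by
    rw [← Letter.cast_intSign, ← Letter.cast_intSign, ← hsign, Int.cast_mul]
  have hnode : ∀ k l, g (kelvinNode w n false k l)
      = kelvinNode w' n' false (i' + κ * (k - i)) (j' + κ * (l - j)) := fun k l => by
    have e := node_add e₁ e₂ tetHeight (kelvinShift w) n false i j (k - i) (l - j)
    rw [add_sub_cancel, add_sub_cancel] at e
    rw [kelvinNode, e, hg, ← kelvinNode, hv, kelvinNode, kelvinNode, node_add, map_add, map_smul,
      map_smul, h1, h2]
    push_cast
    module
  have hez : ∀ x, g (x - ez) = g x - ez := fun x => by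
    rw [sub_eq_add_neg, hg, map_neg, h3, sub_eq_add_neg]
  obtain ⟨k, l, rfl | rfl | rfl | rfl | rfl⟩ := kelvin_star_false hP hvP
  · rw [image_upTetrahedron hg h1 h2 h3, hs, hnode]
    exact upTetrahedron_mem ..
  · rw [image_downTetrahedron hg h1 h2 h3, hs, hnode]
    exact downTetrahedron_mem ..
  · rw [image_octahedron hg h1 h2 h3, hs, hnode]
    exact octahedron_mem ..
  · rcases hκ with rfl | rfl
    · simp only [Int.cast_one, one_smul] at h1 h2
      rw [(image_uprightPrism hg h1 h2 h3 _).1, hez, hnode, kelvinNode_false_sub_ez]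
      exact uprightPrism_mem ..
    · simp only [Int.cast_neg, Int.cast_one, neg_smul, one_smul] at h1 h2
      rw [(image_uprightPrism_of_neg hg h1 h2 h3 _).1, hez, hnode, kelvinNode_false_sub_ez]
      have := uprightPrism'_mem w' (n' - 1) (i' + -1 * (k - i) + -1) (j' + -1 * (l - j) + -1)
      rw [kelvinNode, node_add] at this
      convert this using 2
      push_cast
      module
  · rcases hκ with rfl | rfl
    · simp only [Int.cast_one, one_smul] at h1 h2
      rw [(image_uprightPrism hg h1 h2 h3 _).2, hez, hnode, kelvinNode_false_sub_ez]
      exact uprightPrism'_mem ..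
    · simp only [Int.cast_neg, Int.cast_one, neg_smul, one_smul] at h1 h2
      rw [(image_uprightPrism_of_neg hg h1 h2 h3 _).2, hez, hnode, kelvinNode_false_sub_ez]
      have := uprightPrism_mem w' (n' - 1) (i' + -1 * (k - i) + -1) (j' + -1 * (l - j) + -1)
      rw [kelvinNode, node_add] at this
      convert this using 2
      push_cast
      module

theorem starsCongruent_kelvin_false (w w' : Word) (n n' i j i' j' : ℤ) :
    StarsCongruent (elongatedKelvin w) (kelvinNode w n false i j)
      (elongatedKelvin w') (kelvinNode w' n' false i' j') := by
  obtain ⟨κ, hκ, h1, h2⟩ : ∃ κ : ℤ, (κ = 1 ∨ κ = -1) ∧ κ * (w n).intSign = (w' n').intSign ∧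
      κ * (w' n').intSign = (w n).intSign := by
    -- Equal letters need only a translation, different letters a half turn.
    refine ⟨(w n).intSign * (w' n').intSign, ?_⟩
    rcases (w n).intSign_eq_or with h | h <;> rcases (w' n').intSign_eq_or with h' | h' <;>
      rw [h, h'] <;> norm_num
  obtain ⟨L, hL, h0, h3⟩ := exists_halfTurn hκ
  set v := kelvinNode w n false i j with hv
  set v' := kelvinNode w' n' false i' j' with hv'
  have e : isom L (v' - L v) v = v' := by simp
  have e' : isom L (v - L v') v' = v := by simp
  refine StarsCongruent.of_maps (g := isom L (v' - L v)) (g' := isom L (v - L v')) (fun x => ?_) e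
    (fun P hP hvP => kelvin_star_map hκ h1 (fun x u => ?_) h0 h3 e hP hvP)
    (fun P hP hvP => kelvin_star_map hκ h2 (fun x u => ?_) h0 h3 e' hP hvP)
  · simp only [isom_apply, map_add, map_sub, hL]; abel
  · simp only [isom_apply, map_add]; abel
  · simp only [isom_apply, map_add]; abel

theorem kelvinNode_add_neg_one (w : Word) (n : ℤ) (b : Bool) (k l : ℤ) :
    kelvinNode w n b k l + ((-1 : ℝ) • e₁ + (-1 : ℝ) • e₂) = kelvinNode w n b (k + -1) (l + -1) := by
  rw [kelvinNode, kelvinNode, node_add]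
  push_cast
  rfl

/-- The point reflection in the midpoint of the two nodes maps layer `n` to itself with bottom and
top exchanged, and it maps the adjacent spacers to each other. -/
theorem starsCongruent_kelvin_true (w : Word) (n i j : ℤ) :
    StarsCongruent (elongatedKelvin w) (kelvinNode w n false i j)
      (elongatedKelvin w) (kelvinNode w n true i j) := by
  set g : Space ≃ᵃⁱ[ℝ] Space := isom (LinearIsometryEquiv.neg ℝ)
    (kelvinNode w n false i j + kelvinNode w n true i j) with hgdef
  have happ : ∀ x, g x = kelvinNode w n false i j + kelvinNode w n true i j - x := fun x => by
    simp [hgdef]; abel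
  have hg : ∀ x u, g (x + u) = g x - u := fun x u => by rw [happ, happ]; abel
  have hnode : ∀ k l, g (kelvinNode w n false k l) - ((w n).sign • δ + tetHeight • ez)
      = kelvinNode w n false (2 * i - k) (2 * j - l) := fun k l => by
    rw [happ, kelvinNode, kelvinNode, kelvinNode, kelvinNode, node_true, kelvinShift]
    simp only [node, Bool.false_eq_true, if_false]
    push_cast
    module
  have hnode' : ∀ k l, g (kelvinNode w n false k l - ez) - ez + ((-1 : ℝ) • e₁ + (-1 : ℝ) • e₂)
      = kelvinNode w n true (2 * i - k + -1) (2 * j - l + -1) := fun k l => by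
    rw [kelvinNode, kelvinNode, node_true, ← kelvinNode, ← kelvinNode, ← kelvinNode_add_neg_one,
      ← hnode, sub_eq_add_neg (kelvinNode w n false k l) ez, hg, kelvinShift]
    module
  have hnode'' : ∀ k l, g (kelvinNode w n true k l) - ez + ((-1 : ℝ) • e₁ + (-1 : ℝ) • e₂)
      = kelvinNode w (n - 1) true (2 * i - k + -1) (2 * j - l + -1) := fun k l => by
    rw [← kelvinNode_false_sub_ez, ← kelvinNode_add_neg_one, ← hnode]
    rw [kelvinNode, node_true, hg, kelvinShift]
    module
  have hoct : ∀ k l, octahedron (w n).sign (kelvinNode w n false k l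
      + (w n).sign • ((-1 : ℝ) • e₁ + (-1 : ℝ) • e₂)) ∈ elongatedKelvin w := fun k l => by
    have := kelvinNode_add_sign w n n false k l (-1) (-1)
    simp only [Int.cast_neg, Int.cast_one] at this
    rw [this]
    exact octahedron_mem ..
  refine StarsCongruent.of_maps (g := g) (g' := g) (fun x => by rw [happ, happ]; abel)
    (by rw [happ]; abel) (fun P hP hvP => ?_) (fun P hP hvP => ?_)
  · obtain ⟨k, l, rfl | rfl | rfl | rfl | rfl⟩ := kelvin_star_false hP hvP
    · rw [(image_kelvin_layer_of_neg hg _ _).1, hnode]; exact downTetrahedron_mem ..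
    · rw [(image_kelvin_layer_of_neg hg _ _).2.1, hnode]; exact upTetrahedron_mem ..
    · rw [(image_kelvin_layer_of_neg hg _ _).2.2, hnode]; exact hoct ..
    · rw [(image_kelvin_spacer_of_neg hg _).1, hnode']; exact uprightPrism'_mem ..
    · rw [(image_kelvin_spacer_of_neg hg _).2, hnode']; exact uprightPrism_mem ..
  · obtain ⟨k, l, rfl | rfl | rfl | rfl | rfl⟩ := kelvin_star_true hP hvP
    · rw [(image_kelvin_layer_of_neg hg _ _).1, hnode]; exact downTetrahedron_mem ..
    · rw [(image_kelvin_layer_of_neg hg _ _).2.1, hnode]; exact upTetrahedron_mem ..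
    · rw [(image_kelvin_layer_of_neg hg _ _).2.2, hnode]; exact hoct ..
    · rw [(image_kelvin_spacer_of_neg hg _).1, hnode'']; exact uprightPrism'_mem ..
    · rw [(image_kelvin_spacer_of_neg hg _).2, hnode'']; exact uprightPrism_mem ..

theorem starsCongruent_kelvin {w w' : Word} {v v' : Space} (hv : v ∈ vertices (elongatedKelvin w))
    (hv' : v' ∈ vertices (elongatedKelvin w')) :
    StarsCongruent (elongatedKelvin w) v (elongatedKelvin w') v' := by
  have key : ∀ {w v}, v ∈ vertices (elongatedKelvin w) → ∃ n i j,
      StarsCongruent (elongatedKelvin w) (kelvinNode w n false i j) (elongatedKelvin w) v := by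
    intro w v hv
    rw [vertices_elongatedKelvin] at hv
    obtain ⟨n, b, i, j, rfl⟩ := hv
    cases b
    · exact ⟨n, i, j, starsCongruent_kelvin_false ..⟩
    · exact ⟨n, i, j, starsCongruent_kelvin_true ..⟩
  obtain ⟨n, i, j, h⟩ := key hv
  obtain ⟨n', i', j', h'⟩ := key hv'
  exact (h.symm.trans (starsCongruent_kelvin_false w w' n n' i j i' j')).trans h'

/-! ### Elongated Kelvin partitions: number of cells around a vertex -/

section Count

open Finset

/-- Indices of the vertices of the cells in the partition of the constant sequence `a`. -/
def upIndex (n k l : ℤ) : Finset (ℤ × Bool × ℤ × ℤ) :=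
  {(n, false, k, l), (n, false, k + 1, l), (n, false, k, l + 1), (n, true, k, l)}

def downIndex (n k l : ℤ) : Finset (ℤ × Bool × ℤ × ℤ) :=
  {(n, false, k, l), (n, true, k, l), (n, true, k - 1, l), (n, true, k, l - 1)}

def octIndex (n k l : ℤ) : Finset (ℤ × Bool × ℤ × ℤ) :=
  {(n, false, k + 1, l), (n, false, k, l + 1), (n, false, k + 1, l + 1),
    (n, true, k, l), (n, true, k + 1, l), (n, true, k, l + 1)}

def prismIndex (n k l : ℤ) : Finset (ℤ × Bool × ℤ × ℤ) :=
  {(n, true, k, l), (n, true, k + 1, l), (n, true, k, l + 1),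
    (n + 1, false, k, l), (n + 1, false, k + 1, l), (n + 1, false, k, l + 1)}

def prismIndex' (n k l : ℤ) : Finset (ℤ × Bool × ℤ × ℤ) :=
  {(n, true, k + 1, l), (n, true, k, l + 1), (n, true, k + 1, l + 1),
    (n + 1, false, k + 1, l), (n + 1, false, k, l + 1), (n + 1, false, k + 1, l + 1)}

theorem convexHull_congr₄ {a b c d a' b' c' d' : Space} (ha : a = a') (hb : b = b') (hc : c = c')
    (hd : d = d') : convexHull ℝ {a, b, c, d} = convexHull ℝ {a', b', c', d'} := by
  rw [ha, hb, hc, hd]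

theorem convexHull_congr₆ {a b c d e f a' b' c' d' e' f' : Space} (ha : a = a') (hb : b = b')
    (hc : c = c') (hd : d = d') (he : e = e') (hf : f = f') :
    convexHull ℝ {a, b, c, d, e, f} = convexHull ℝ {a', b', c', d', e', f'} := by
  rw [ha, hb, hc, hd, he, hf]

theorem cell_upIndex (n k l : ℤ) : cell e₁ e₂ tetHeight (kelvinShift fun _ => .a) (upIndex n k l)
    = upTetrahedron (Letter.sign .a) (kelvinNode (fun _ => .a) n false k l) := by
  simp only [cell, upIndex, coe_insert, coe_singleton, Set.image_insert_eq, Set.image_singleton,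
    upTetrahedron]
  apply convexHull_congr₄ <;>
    simp only [node, kelvinShift, Letter.sign, Bool.false_eq_true, if_false, if_true] <;>
    push_cast <;> module

theorem cell_downIndex (n k l : ℤ) :
    cell e₁ e₂ tetHeight (kelvinShift fun _ => .a) (downIndex n k l)
    = downTetrahedron (Letter.sign .a) (kelvinNode (fun _ => .a) n false k l) := by
  simp only [cell, downIndex, coe_insert, coe_singleton, Set.image_insert_eq, Set.image_singleton,
    downTetrahedron]
  apply convexHull_congr₄ <;>
    simp only [node, kelvinShift, Letter.sign, Bool.false_eq_true, if_false, if_true] <;>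
    push_cast <;> module

theorem cell_octIndex (n k l : ℤ) :
    cell e₁ e₂ tetHeight (kelvinShift fun _ => .a) (octIndex n k l)
    = octahedron (Letter.sign .a) (kelvinNode (fun _ => .a) n false k l) := by
  simp only [cell, octIndex, coe_insert, coe_singleton, Set.image_insert_eq, Set.image_singleton,
    octahedron]
  apply convexHull_congr₆ <;>
    simp only [node, kelvinShift, Letter.sign, Bool.false_eq_true, if_false, if_true] <;>
    push_cast <;> module

theorem cell_prismIndex (n k l : ℤ) :
    cell e₁ e₂ tetHeight (kelvinShift fun _ => .a) (prismIndex n k l)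
    = uprightPrism (kelvinNode (fun _ => .a) n true k l) := by
  simp only [cell, prismIndex, coe_insert, coe_singleton, Set.image_insert_eq, Set.image_singleton,
    uprightPrism, node_succ_false]
  apply convexHull_congr₆ <;>
    simp only [node, kelvinShift, Letter.sign, if_true] <;>
    push_cast <;> module

theorem cell_prismIndex' (n k l : ℤ) :
    cell e₁ e₂ tetHeight (kelvinShift fun _ => .a) (prismIndex' n k l)
    = uprightPrism' (kelvinNode (fun _ => .a) n true k l) := by
  simp only [cell, prismIndex', coe_insert, coe_singleton, Set.image_insert_eq, Set.image_singleton,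
    uprightPrism', node_succ_false]
  apply convexHull_congr₆ <;>
    simp only [node, kelvinShift, Letter.sign, if_true] <;>
    push_cast <;> module

theorem mem_elongatedKelvin_const {P : Set Space} (hP : P ∈ elongatedKelvin fun _ => .a) :
    ∃ n k l : ℤ,
    (IsRegularTetrahedron P ∧
      (P = cell e₁ e₂ tetHeight (kelvinShift fun _ => .a) (upIndex n k l) ∨
      P = cell e₁ e₂ tetHeight (kelvinShift fun _ => .a) (downIndex n k l))) ∨
    (IsRegularOctahedron P ∧
      P = cell e₁ e₂ tetHeight (kelvinShift fun _ => .a) (octIndex n k l)) ∨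
    (IsTriangularPrism P ∧
      (P = cell e₁ e₂ tetHeight (kelvinShift fun _ => .a) (prismIndex n k l) ∨
      P = cell e₁ e₂ tetHeight (kelvinShift fun _ => .a) (prismIndex' n k l))) := by
  simp only [cell_upIndex, cell_downIndex, cell_octIndex, cell_prismIndex, cell_prismIndex']
  obtain ⟨n, k, l, rfl | rfl | rfl | rfl | rfl⟩ := mem_elongatedKelvin.1 hP <;>
    refine ⟨n, k, l, ?_⟩
  · simp [isRegularTetrahedron_upTetrahedron (Letter.sign_sq _)]
  · simp [isRegularTetrahedron_downTetrahedron (Letter.sign_sq _)]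
  · simp [isRegularOctahedron_octahedron (Letter.sign_sq _)]
  · simp [isTriangularPrism_uprightPrism]
  · simp [isTriangularPrism_uprightPrism']

/-- For the constant word all signs are `1` and the cells have explicit indices. A bottom node is a
base corner of three tetrahedra and the tip of one more. -/
theorem ncard_tetrahedra_const :
    {P ∈ delaunayStar (elongatedKelvin fun _ => .a) (kelvinNode (fun _ => .a) 0 false 0 0) |
      IsRegularTetrahedron P}.ncard = 4 := by
  rw [isFrame_kelvin.ncard_star (kelvinShift_apply_two _) (isDelaunayFamily_kelvin _)
    IsRegularTetrahedron {upIndex 0 0 0, upIndex 0 (-1) 0, upIndex 0 0 (-1), downIndex 0 0 0}]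
  · decide
  · intro I hI
    simp only [mem_insert, mem_singleton] at hI
    obtain rfl | rfl | rfl | rfl := hI
    · rw [cell_upIndex]
      exact ⟨upTetrahedron_mem (fun _ => .a) .., isRegularTetrahedron_upTetrahedron (Letter.sign_sq _) _,
        by decide⟩
    · rw [cell_upIndex]
      exact ⟨upTetrahedron_mem (fun _ => .a) .., isRegularTetrahedron_upTetrahedron (Letter.sign_sq _) _,
        by decide⟩
    · rw [cell_upIndex]
      exact ⟨upTetrahedron_mem (fun _ => .a) .., isRegularTetrahedron_upTetrahedron (Letter.sign_sq _) _,
        by decide⟩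
    · rw [cell_downIndex]
      exact ⟨downTetrahedron_mem (fun _ => .a) ..,
        isRegularTetrahedron_downTetrahedron (Letter.sign_sq _) _, by decide⟩
  · intro P hP hp
    obtain ⟨n, k, l, ⟨-, h | h⟩ | ⟨h, -⟩ | ⟨h, -⟩⟩ := mem_elongatedKelvin_const hP
    · refine ⟨_, h, fun hI => ?_⟩
      simp only [upIndex, mem_insert, mem_singleton, Prod.mk.injEq, Bool.false_eq_true, false_and,
        and_false, or_false, true_and] at hI
      obtain ⟨rfl, rfl, rfl⟩ | ⟨rfl, h1, rfl⟩ | ⟨rfl, rfl, h1⟩ := hI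
      · simp
      · obtain rfl : k = -1 := by omega
        simp
      · obtain rfl : l = -1 := by omega
        simp
    · refine ⟨_, h, fun hI => ?_⟩
      simp only [downIndex, mem_insert, mem_singleton, Prod.mk.injEq, Bool.false_eq_true, false_and,
        and_false, or_false, true_and] at hI
      obtain ⟨rfl, rfl, rfl⟩ := hI
      simp
    · exact absurd h hp.not_isRegularOctahedron
    · exact absurd h hp.not_isTriangularPrism

theorem ncard_octahedra_const :
    {P ∈ delaunayStar (elongatedKelvin fun _ => .a) (kelvinNode (fun _ => .a) 0 false 0 0) |
      IsRegularOctahedron P}.ncard = 3 := by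
  rw [isFrame_kelvin.ncard_star (kelvinShift_apply_two _) (isDelaunayFamily_kelvin _)
    IsRegularOctahedron {octIndex 0 (-1) 0, octIndex 0 0 (-1), octIndex 0 (-1) (-1)}]
  · decide
  · intro I hI
    obtain ⟨k, l, rfl, h⟩ : ∃ k l, I = octIndex 0 k l ∧ (0, false, 0, 0) ∈ octIndex 0 k l := by
      simp only [mem_insert, mem_singleton] at hI
      obtain rfl | rfl | rfl := hI <;> exact ⟨_, _, rfl, by decide⟩
    rw [cell_octIndex]
    exact ⟨octahedron_mem (fun _ => .a) .., isRegularOctahedron_octahedron (Letter.sign_sq _) _, h⟩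
  · intro P hP hp
    obtain ⟨n, k, l, ⟨h, -⟩ | ⟨-, h⟩ | ⟨h, -⟩⟩ := mem_elongatedKelvin_const hP
    · exact absurd hp h.not_isRegularOctahedron
    · refine ⟨_, h, fun hI => ?_⟩
      simp only [octIndex, mem_insert, mem_singleton, Prod.mk.injEq, Bool.false_eq_true, false_and,
        and_false, or_false, true_and] at hI
      obtain ⟨rfl, h1, h2⟩ | ⟨rfl, h1, h2⟩ | ⟨rfl, h1, h2⟩ := hI
      · obtain rfl : k = -1 := by omega
        subst h2; simp
      · obtain rfl : l = -1 := by omega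
        subst h1; simp
      · obtain rfl : k = -1 := by omega
        obtain rfl : l = -1 := by omega
        simp
    · exact absurd h hp.not_isTriangularPrism

/-- The prisms are those under the six lattice triangles at the node; they belong to the spacer of
index `-1`. -/
theorem ncard_prisms_const :
    {P ∈ delaunayStar (elongatedKelvin fun _ => .a) (kelvinNode (fun _ => .a) 0 false 0 0) |
      IsTriangularPrism P}.ncard = 6 := by
  rw [isFrame_kelvin.ncard_star (kelvinShift_apply_two _) (isDelaunayFamily_kelvin _)
    IsTriangularPrism {prismIndex (-1) 0 0, prismIndex (-1) (-1) 0, prismIndex (-1) 0 (-1),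
      prismIndex' (-1) (-1) 0, prismIndex' (-1) 0 (-1), prismIndex' (-1) (-1) (-1)}]
  · decide
  · intro I hI
    obtain ⟨k, l, rfl | rfl, h⟩ : ∃ k l, (I = prismIndex (-1) k l ∨ I = prismIndex' (-1) k l) ∧
        (0, false, 0, 0) ∈ I := by
      simp only [mem_insert, mem_singleton] at hI
      obtain rfl | rfl | rfl | rfl | rfl | rfl := hI
      exacts [⟨_, _, Or.inl rfl, by decide⟩, ⟨_, _, Or.inl rfl, by decide⟩,
        ⟨_, _, Or.inl rfl, by decide⟩, ⟨_, _, Or.inr rfl, by decide⟩,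
        ⟨_, _, Or.inr rfl, by decide⟩, ⟨_, _, Or.inr rfl, by decide⟩]
    · refine ⟨?_, ?_, h⟩ <;> rw [cell_prismIndex]
      exacts [uprightPrism_mem (fun _ => .a) .., isTriangularPrism_uprightPrism _]
    · refine ⟨?_, ?_, h⟩ <;> rw [cell_prismIndex']
      exacts [uprightPrism'_mem (fun _ => .a) .., isTriangularPrism_uprightPrism' _]
  · intro P hP hp
    obtain ⟨n, k, l, ⟨h, -⟩ | ⟨h, -⟩ | ⟨-, h | h⟩⟩ := mem_elongatedKelvin_const hP
    · exact absurd hp h.not_isTriangularPrism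
    · exact absurd hp h.not_isTriangularPrism
    · refine ⟨_, h, fun hI => ?_⟩
      simp only [prismIndex, mem_insert, mem_singleton, Prod.mk.injEq, Bool.false_eq_true, false_and,
        and_false, false_or, true_and] at hI
      obtain ⟨rfl, rfl, rfl⟩ | ⟨rfl, rfl, rfl⟩ | ⟨rfl, rfl, rfl⟩ : (n = -1 ∧ k = 0 ∧ l = 0) ∨
        (n = -1 ∧ k = -1 ∧ l = 0) ∨ (n = -1 ∧ k = 0 ∧ l = -1) := by omega
      all_goals simp
    · refine ⟨_, h, fun hI => ?_⟩
      simp only [prismIndex', mem_insert, mem_singleton, Prod.mk.injEq, Bool.false_eq_true, false_and,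
        and_false, false_or, true_and] at hI
      obtain ⟨rfl, rfl, rfl⟩ | ⟨rfl, rfl, rfl⟩ | ⟨rfl, rfl, rfl⟩ : (n = -1 ∧ k = -1 ∧ l = 0) ∨
        (n = -1 ∧ k = 0 ∧ l = -1) ∨ (n = -1 ∧ k = -1 ∧ l = -1) := by omega
      all_goals simp

/-- Congruence of stars does not need properness, so a single node of a constant partition may serve
as the model. -/
theorem ncard_kelvin_star {w : Word} {v : Space} (hv : v ∈ vertices (elongatedKelvin w)) :
    {P ∈ delaunayStar (elongatedKelvin w) v | IsTriangularPrism P}.ncard = 6 ∧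
    {P ∈ delaunayStar (elongatedKelvin w) v | IsRegularTetrahedron P}.ncard = 4 ∧
    {P ∈ delaunayStar (elongatedKelvin w) v | IsRegularOctahedron P}.ncard = 3 := by
  have h := starsCongruent_kelvin (w := fun _ => .a) (v := kelvinNode (fun _ => .a) 0 false 0 0)
    (by rw [vertices_elongatedKelvin]; exact node_mem ..) hv
  rw [← h.ncard_eq (p := IsTriangularPrism) fun g P hP => hP.image g,
    ← h.ncard_eq (p := IsRegularTetrahedron) fun g P hP => hP.image g,
    ← h.ncard_eq (p := IsRegularOctahedron) fun g P hP => hP.image g]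
  exact ⟨ncard_prisms_const, ncard_tetrahedra_const, ncard_octahedra_const⟩

end Count

/-! ### Elongated Kelvin partitions: symmetry -/

/-- For different letters the shifts differ by `2 δ` up to sign, whose coordinates `2 / 3` are not
integers. -/
theorem kelvinShift_sub_mem_iff {w w' : Word} {n m : ℤ} :
    kelvinShift w n - kelvinShift w' m ∈ lattice e₁ e₂ ↔ w n = w' m := by
  constructor
  · intro h
    have e : kelvinShift w n - kelvinShift w' m
        = (((w n).sign - (w' m).sign) / 3) • e₁ + (((w n).sign - (w' m).sign) / 3) • e₂ := by
      simp only [kelvinShift, δ]; module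
    rw [e] at h
    obtain ⟨i, -, hi, -⟩ := isFrame_kelvin.mem_lattice_coords h
    have hi : (w n).sign - (w' m).sign = 3 * i := by linarith
    rw [← Letter.cast_intSign, ← Letter.cast_intSign] at hi
    have hi : (w n).intSign - (w' m).intSign = 3 * i := by exact_mod_cast hi
    generalize w n = x at hi ⊢
    generalize w' m = y at hi ⊢
    cases x <;> cases y <;> first | rfl | (simp only [Letter.intSign] at hi; omega)
  · intro h
    simp only [kelvinShift, h, sub_self]
    exact zero_mem _

theorem elongatedKelvin_injective : Function.Injective elongatedKelvin :=
  isLayeredFamily_elongatedKelvin.injective fun _ _ h =>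
    funext fun n => kelvinShift_sub_mem_iff.1 (h n)

theorem wordsEquivalent_of_elongatedKelvin_eq (w w' : Word) (g : Space ≃ᵃⁱ[ℝ] Space)
    (h : elongatedKelvin w' = moved g (elongatedKelvin w)) : WordsEquivalent w w' := by
  obtain ⟨σ, k, hσ, hk⟩ := isLayeredFamily_elongatedKelvin.exists_shift_sub_mem_iff h
  exact ⟨σ, k, hσ, fun n m => by rw [← kelvinShift_sub_mem_iff, hk, kelvinShift_sub_mem_iff]⟩

/-- Transitivity would allow moving all layers up by one, so equality of neighbouring letters would
hold everywhere or nowhere; both cases are excluded. -/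
theorem not_isVertexTransitive_elongatedKelvin {w : Word} (hw : IsProperKelvin w) :
    ¬ IsVertexTransitive (elongatedKelvin w) := by
  intro h
  have h1 : ∀ n, w (n + 1) = w n ↔ w (n + 1 + 1) = w (n + 1) := fun n => by
    rw [← kelvinShift_sub_mem_iff, isLayeredFamily_elongatedKelvin.shift_sub_mem_iff_succ h,
      kelvinShift_sub_mem_iff]
  have h2 : ∀ n, w (n + 1) = w n ↔ w (0 + 1) = w 0 := fun n => by
    induction n using Int.induction_on with
    | zero => rfl
    | succ n ih => rw [← h1, ih]
    | pred n ih =>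
      rw [h1, sub_add_cancel, ih]
  by_cases h0 : w (0 + 1) = w 0
  · exact hw.1 fun n => (h2 n).2 h0
  · exact hw.2 fun n => fun hn => h0 ((h2 n).1 hn)

theorem image_constVAdd_mem_elongatedKelvin {w : Word} {t : Space} {p a c : ℤ}
    (hw : Function.Periodic w p) (ht : ∀ n b i j,
      kelvinNode w n b i j + t = kelvinNode w (n + p) b (i + a) (j + c)) {P : Set Space}
    (hP : P ∈ elongatedKelvin w) : AffineIsometryEquiv.constVAdd ℝ Space t '' P ∈ elongatedKelvin w := by
  have hg : ∀ x u, AffineIsometryEquiv.constVAdd ℝ Space t (x + u)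
      = AffineIsometryEquiv.constVAdd ℝ Space t x + LinearIsometryEquiv.refl ℝ Space u := by
    intro x u; simp [add_assoc]
  have happ : ∀ n b i j, AffineIsometryEquiv.constVAdd ℝ Space t (kelvinNode w n b i j)
      = kelvinNode w (n + p) b (i + a) (j + c) := fun n b i j => by
    rw [← ht]; simp [add_comm]
  obtain ⟨n, i, j, rfl | rfl | rfl | rfl | rfl⟩ := mem_elongatedKelvin.1 hP
  · rw [image_upTetrahedron hg (κ := 1) (by simp) (by simp) (by simp), one_mul, happ, ← hw n]
    exact upTetrahedron_mem ..
  · rw [image_downTetrahedron hg (κ := 1) (by simp) (by simp) (by simp), one_mul, happ, ← hw n]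
    exact downTetrahedron_mem ..
  · rw [image_octahedron hg (κ := 1) (by simp) (by simp) (by simp), one_mul, happ, ← hw n]
    exact octahedron_mem ..
  · rw [(image_uprightPrism hg (by simp) (by simp) (by simp) _).1, happ]
    exact uprightPrism_mem ..
  · rw [(image_uprightPrism hg (by simp) (by simp) (by simp) _).2, happ]
    exact uprightPrism'_mem ..

theorem moved_constVAdd_elongatedKelvin {w : Word} {t : Space} {p a c : ℤ}
    (hw : Function.Periodic w p) (ht : ∀ n b i j,
      kelvinNode w n b i j + t = kelvinNode w (n + p) b (i + a) (j + c)) :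
    moved (AffineIsometryEquiv.constVAdd ℝ Space t) (elongatedKelvin w) = elongatedKelvin w := by
  refine moved_constVAdd_eq (fun P hP => image_constVAdd_mem_elongatedKelvin hw ht hP)
    fun P hP => image_constVAdd_mem_elongatedKelvin (p := -p) (a := -a) (c := -c) hw.neg ?_ hP
  intro n b i j
  rw [← sub_eq_add_neg, sub_eq_iff_eq_add, ht]
  simp

theorem node_add_period (f₁ f₂ : Space) (τ : ℝ) {s : ℤ → Space} {p : ℤ} (hs : ∀ n, s (n + p) = s n)
    (n : ℤ) (b : Bool) (i j : ℤ) :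
    node f₁ f₂ τ s n b i j + (partialSum s p + ((p : ℝ) * (τ + 1)) • ez)
      = node f₁ f₂ τ s (n + p) b i j := by
  simp only [node, partialSum_add_period hs, hs]
  push_cast
  module

/-- For a word of period `p` the third translation is the total displacement accumulated over `p`
layers and spacers; it is not horizontal because `p ≠ 0`. -/
theorem isPeriodic_elongatedKelvin_iff (w : Word) :
    IsPeriodic (elongatedKelvin w) ↔ IsPeriodicWord w := by
  refine ⟨isLayeredFamily_elongatedKelvin.isPeriodicWord fun w k h n =>
    (kelvinShift_sub_mem_iff.1 (h n)).symm, ?_⟩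
  rintro ⟨p, hp, hw⟩
  have h0 : Function.Periodic w 0 := fun n => by rw [add_zero]
  have hs : ∀ n, kelvinShift w (n + p) = kelvinShift w n := fun n => by rw [kelvinShift, hw n]; rfl
  refine isFrame_kelvin.isPeriodic_of
    (t := partialSum (kelvinShift w) p + ((p : ℝ) * (tetHeight + 1)) • ez)
    (moved_constVAdd_elongatedKelvin (p := 0) (a := 1) (c := 0) h0 fun n b i j => ?_)
    (moved_constVAdd_elongatedKelvin (p := 0) (a := 0) (c := 1) h0 fun n b i j => ?_)
    (moved_constVAdd_elongatedKelvin (p := p) (a := 0) (c := 0) hw fun n b i j => ?_) ?_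
  · rw [add_zero n, kelvinNode, kelvinNode, node_add]; simp
  · rw [add_zero n, kelvinNode, kelvinNode, node_add]; simp
  · rw [kelvinNode, node_add_period _ _ _ hs]; simp
  · have := tetHeight_pos
    have hp' : (p : ℝ) ≠ 0 := by exact_mod_cast hp
    simp [partialSum_apply_two (kelvinShift_apply_two w), ez_apply_two, hp]
    positivity

/-- A constant word has period `1`, an alternating one period `2`. -/
theorem isPeriodicWord_of_not_isProperKelvin (w : Word) (hw : ¬ IsProperKelvin w) :
    IsPeriodicWord w := by
  rw [IsProperKelvin, not_and_or, not_not, not_not] at hw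
  rcases hw with h | h
  · exact ⟨1, one_ne_zero, h⟩
  · refine ⟨2, two_ne_zero, fun n => ?_⟩
    have h1 := h n
    have h2 := h (n + 1)
    rw [show n + 1 + 1 = n + 2 by ring] at h2
    revert h1 h2
    cases w n <;> cases w (n + 1) <;> cases w (n + 2) <;> simp

theorem isProperKelvin_sparseWord (p : ℤ) (hp : 3 ≤ p) : IsProperKelvin (sparseWord p) := by
  refine ⟨fun h => ?_, fun h => ?_⟩
  · have := h 0
    rw [zero_add, sparseWord_zero, sparseWord_one (by omega)] at this
    cases this
  · have := h 1
    rw [show (1 : ℤ) + 1 = 2 by rfl, sparseWord_two hp, sparseWord_one (by omega)] at this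
    exact this rfl

theorem isAlmostUniform_elongatedKelvin {w : Word} (hw : IsProperKelvin w) :
    IsAlmostUniform (elongatedKelvin w) :=
  ⟨isNormalPartition_elongatedKelvin w, fun _ => isUniformPolyhedron_of_mem_elongatedKelvin,
    not_isVertexTransitive_elongatedKelvin hw, fun _ hv _ hv' => starsCongruent_kelvin hv hv'⟩

/-! ### Elongated Grünbaum partitions: cells and vertices -/

theorem triHeight_sq : triHeight ^ 2 = 3 / 4 := by
  rw [triHeight, div_pow, Real.sq_sqrt (by norm_num)]; norm_num

theorem triHeight_pos : 0 < triHeight := by rw [triHeight]; positivity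

/-- `u` and `a` are the two generators of the horizontal square lattice. -/
def IsAxes (u a : Space) : Prop := (u = ex ∧ a = ey) ∨ (u = ey ∧ a = ex)

theorem isFrame_grunbaum : IsFrame ex ey 0 triHeight where
  apply_two₁ := by simp [ex]
  apply_two₂ := by simp [ey]
  norm_sq x y z := by
    simp [EuclideanSpace.norm_sq_eq, Fin.sum_univ_three, ex, ey, ez]
  exists_coords v := by
    refine ⟨v 0, v 1, v 2, ?_⟩
    ext i
    fin_cases i <;> simp [ex, ey, ez]
  γ_nonneg := le_rfl
  γ_le := by norm_num
  le_τ := by nlinarith [triHeight_sq, triHeight_pos]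
  τ_lt := by nlinarith [triHeight_sq, triHeight_pos]

/-- The prism heights run along either generator, so the coordinate formulas are needed in both
orders. -/
theorem IsFrame.swap {f₁ f₂ : Space} {γ τ : ℝ} (hF : IsFrame f₁ f₂ γ τ) : IsFrame f₂ f₁ γ τ where
  apply_two₁ := hF.apply_two₂
  apply_two₂ := hF.apply_two₁
  norm_sq x y z := by rw [add_comm (x • f₂), hF.norm_sq]; ring
  exists_coords v := by
    obtain ⟨x, y, z, h⟩ := hF.exists_coords v
    exact ⟨y, x, z, by rw [h, add_comm (x • f₁)]⟩
  γ_nonneg := hF.γ_nonneg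
  γ_le := hF.γ_le
  le_τ := hF.le_τ
  τ_lt := hF.τ_lt

namespace IsAxes

variable {u a : Space}

theorem isFrame (h : IsAxes u a) : IsFrame u a 0 triHeight := by
  rcases h with ⟨rfl, rfl⟩ | ⟨rfl, rfl⟩
  exacts [isFrame_grunbaum, isFrame_grunbaum.swap]

theorem exists_coords (h : IsAxes u a) (x y : ℤ) :
    ∃ k l : ℤ, (x : ℝ) • u + (y : ℝ) • a = (k : ℝ) • ex + (l : ℝ) • ey := by
  rcases h with ⟨rfl, rfl⟩ | ⟨rfl, rfl⟩
  exacts [⟨x, y, rfl⟩, ⟨y, x, add_comm _ _⟩]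

theorem exists_coords' (h : IsAxes u a) (k l : ℤ) :
    ∃ x y : ℤ, (k : ℝ) • ex + (l : ℝ) • ey = (x : ℝ) • u + (y : ℝ) • a := by
  rcases h with ⟨rfl, rfl⟩ | ⟨rfl, rfl⟩
  exacts [⟨k, l, rfl⟩, ⟨l, k, add_comm _ _⟩]

end IsAxes

theorem isAxes (w : Word) (n : ℤ) : IsAxes (crossDir w n) (axisDir w n) := by
  by_cases h : Even (turns w n) <;> simp [IsAxes, crossDir, axisDir, h]

noncomputable def grunbaumShift (w : Word) (n : ℤ) : Space := (1 / 2 : ℝ) • crossDir w n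

theorem grunbaumShift_apply_two (w : Word) (n : ℤ) : grunbaumShift w n 2 = 0 := by
  simp [grunbaumShift, (isAxes w n).isFrame.apply_two₁]

/-- Nodes of an elongated Grünbaum partition. -/
noncomputable abbrev grunbaumNode (w : Word) (n : ℤ) (b : Bool) (i j : ℤ) : Space :=
  node ex ey triHeight (grunbaumShift w) n b i j

abbrev grunbaumNodes (w : Word) : Set Space := nodes ex ey triHeight (grunbaumShift w)

theorem grunbaumPoint_eq (w : Word) (n i j : ℤ) :
    grunbaumPoint w n i j = grunbaumNode w n false i j := by
  simp only [node, grunbaumPoint, Bool.false_eq_true, if_false, add_zero]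
  rfl

theorem mem_elongatedGrunbaum {w : Word} {P : Set Space} : P ∈ elongatedGrunbaum w ↔ ∃ n i j : ℤ,
    P = lyingPrism (crossDir w n) (axisDir w n) (grunbaumNode w n false i j) ∨
    P = lyingPrism' (crossDir w n) (axisDir w n) (grunbaumNode w n false i j) ∨
    P = cubeAt (grunbaumNode w n true i j) := by
  have e : ∀ n i j, grunbaumNode w n false i j + (1 / 2 : ℝ) • crossDir w n + triHeight • ez
      = grunbaumNode w n true i j := fun n i j => by
    rw [grunbaumNode, grunbaumNode, node_true, grunbaumShift, ← add_assoc]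
  simp only [elongatedGrunbaum, Set.mem_ofPred_eq, grunbaumPoint_eq, e]

theorem lyingPrism_mem (w : Word) (n i j : ℤ) :
    lyingPrism (crossDir w n) (axisDir w n) (grunbaumNode w n false i j) ∈ elongatedGrunbaum w :=
  mem_elongatedGrunbaum.2 ⟨n, i, j, Or.inl rfl⟩

theorem lyingPrism'_mem (w : Word) (n i j : ℤ) :
    lyingPrism' (crossDir w n) (axisDir w n) (grunbaumNode w n false i j) ∈ elongatedGrunbaum w :=
  mem_elongatedGrunbaum.2 ⟨n, i, j, Or.inr (Or.inl rfl)⟩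

theorem cubeAt_mem (w : Word) (n i j : ℤ) :
    cubeAt (grunbaumNode w n true i j) ∈ elongatedGrunbaum w :=
  mem_elongatedGrunbaum.2 ⟨n, i, j, Or.inr (Or.inr rfl)⟩

theorem exists_grunbaumNode_add {u a : Space} (h : IsAxes u a) (w : Word) (n : ℤ) (b : Bool)
    (i j x y : ℤ) : ∃ k l : ℤ,
    grunbaumNode w n b i j + ((x : ℝ) • u + (y : ℝ) • a) = grunbaumNode w n b k l := by
  obtain ⟨k, l, e⟩ := h.exists_coords x y
  exact ⟨i + k, j + l, by rw [e, grunbaumNode, ← node_add]⟩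

theorem exists_grunbaumNode_eq {u a : Space} (h : IsAxes u a) (w : Word) (n : ℤ) (b : Bool)
    (i j k l : ℤ) : ∃ x y : ℤ,
    grunbaumNode w n b k l = grunbaumNode w n b i j + ((x : ℝ) • u + (y : ℝ) • a) := by
  obtain ⟨x, y, e⟩ := h.exists_coords' (k - i) (l - j)
  exact ⟨x, y, by rw [← e, grunbaumNode, ← node_add]; congr 1 <;> ring⟩

/-- The quantity is `(x - 1 / 2)² - 1 / 4`: it vanishes at the ends of the unit interval and is at
least two at all other integers. -/
theorem unit_interval_form (x : ℤ) : x = 0 ∨ x = 1 ∨ 2 ≤ x ^ 2 - x := by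
  rcases lt_trichotomy x 0 with h | h | h
  · right; right; nlinarith
  · exact Or.inl h
  · rcases eq_or_lt_of_le (Int.add_one_le_iff.2 h) with h' | h'
    · right; left; omega
    · right; right; nlinarith

theorem unit_interval_form_nonneg (x : ℤ) : 0 ≤ x ^ 2 - x := by
  rcases unit_interval_form x with rfl | rfl | h
  · simp
  · simp
  · omega

theorem zero_form (x : ℤ) : x = 0 ∨ 1 ≤ x ^ 2 := by
  rcases eq_or_ne x 0 with h | h
  · exact Or.inl h
  · right; have := sq_pos_of_ne_zero h; omega

/-- The bottom point with coordinates `x`, `y` relative to `p`. -/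
noncomputable def grunbaumBot (u a p : Space) (x y : ℝ) : Space := p + (x • u + y • a)

/-- The top point with coordinates `x`, `y` relative to `p`. -/
noncomputable def grunbaumTop (u a p : Space) (x y : ℝ) : Space :=
  p + (x • u + y • a) + ((1 / 2 : ℝ) • u + triHeight • ez)

theorem lyingPrism_eq (u a p : Space) : lyingPrism u a p = convexHull ℝ
    {grunbaumBot u a p 0 0, grunbaumBot u a p 1 0, grunbaumTop u a p 0 0,
      grunbaumBot u a p 0 1, grunbaumBot u a p 1 1, grunbaumTop u a p 0 1} := by
  rw [lyingPrism]
  apply convexHull_congr₆ <;> simp only [grunbaumBot, grunbaumTop] <;> module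

theorem lyingPrism'_eq (u a p : Space) : lyingPrism' u a p = convexHull ℝ
    {grunbaumBot u a p 1 0, grunbaumTop u a p 0 0, grunbaumTop u a p 1 0,
      grunbaumBot u a p 1 1, grunbaumTop u a p 0 1, grunbaumTop u a p 1 1} := by
  rw [lyingPrism']
  apply convexHull_congr₆ <;> simp only [grunbaumBot, grunbaumTop] <;> module

theorem norm_grunbaumBot_sub_sq {u a : Space} (h : IsAxes u a) (p : Space) (x y α β ζ : ℝ) :
    ‖grunbaumBot u a p x y - (grunbaumBot u a p α β + ζ • ez)‖ ^ 2
      = (x - α) ^ 2 + (y - β) ^ 2 + ζ ^ 2 := by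
  have : grunbaumBot u a p x y - (grunbaumBot u a p α β + ζ • ez)
      = (x - α) • u + (y - β) • a + (-ζ) • ez := by
    simp only [grunbaumBot]; module
  rw [this, h.isFrame.norm_sq]
  ring

theorem norm_grunbaumTop_sub_sq {u a : Space} (h : IsAxes u a) (p : Space) (x y α β ζ : ℝ) :
    ‖grunbaumTop u a p x y - (grunbaumBot u a p α β + ζ • ez)‖ ^ 2
      = (x + 1 / 2 - α) ^ 2 + (y - β) ^ 2 + (triHeight - ζ) ^ 2 := by
  have : grunbaumTop u a p x y - (grunbaumBot u a p α β + ζ • ez)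
      = (x + 1 / 2 - α) • u + (y - β) • a + (triHeight - ζ) • ez := by
    simp only [grunbaumBot, grunbaumTop]; module
  rw [this, h.isFrame.norm_sq]
  ring

theorem grunbaumBot_mem (w : Word) (n i j x y : ℤ) :
    grunbaumBot (crossDir w n) (axisDir w n) (grunbaumNode w n false i j) x y ∈ grunbaumNodes w := by
  obtain ⟨k, l, h⟩ := exists_grunbaumNode_add (isAxes w n) w n false i j x y
  rw [grunbaumBot, h]; exact node_mem ..

theorem grunbaumTop_mem (w : Word) (n i j x y : ℤ) :
    grunbaumTop (crossDir w n) (axisDir w n) (grunbaumNode w n false i j) x y ∈ grunbaumNodes w := by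
  obtain ⟨k, l, h⟩ := exists_grunbaumNode_add (isAxes w n) w n false i j x y
  have := node_mem ex ey triHeight (grunbaumShift w) n true k l
  rwa [node_true, ← grunbaumNode, ← h] at this

theorem isDelaunay_grunbaum_layer (w : Word) (n i j : ℤ) {α β ζ R : ℝ} {S : Set Space}
    (h0 : 0 ≤ ζ) (h1 : ζ ≤ triHeight) (hR : R < 1)
    (hS : ∀ v ∈ S, v ∈ grunbaumNodes w ∧
      ‖v - (grunbaumBot (crossDir w n) (axisDir w n) (grunbaumNode w n false i j) α β + ζ • ez)‖ ^ 2
        = R)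
    (hbot : ∀ x y : ℤ,
      grunbaumBot (crossDir w n) (axisDir w n) (grunbaumNode w n false i j) x y ∈ S ∨
      R < (x - α) ^ 2 + (y - β) ^ 2 + ζ ^ 2)
    (htop : ∀ x y : ℤ,
      grunbaumTop (crossDir w n) (axisDir w n) (grunbaumNode w n false i j) x y ∈ S ∨
      R < (x + 1 / 2 - α) ^ 2 + (y - β) ^ 2 + (triHeight - ζ) ^ 2) :
    ∃ c, IsDelaunay (grunbaumNodes w) S c R := by
  have ha := isAxes w n
  refine ⟨_, isFrame_grunbaum.isDelaunay_of_layer (grunbaumShift_apply_two w) (n := n) (ζ := ζ) ?_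
    h0 h1 hR hS (fun k l => ?_) fun k l => ?_⟩
  · simp only [grunbaumBot, PiLp.add_apply, PiLp.smul_apply, ez_apply_two,
      isFrame_grunbaum.node_apply_two (grunbaumShift_apply_two w), levelHeight, ha.isFrame.apply_two₁,
      ha.isFrame.apply_two₂, smul_eq_mul, Bool.false_eq_true, if_false]
    ring
  · obtain ⟨x, y, h⟩ := exists_grunbaumNode_eq ha w n false i j k l
    rw [grunbaumNode, ← grunbaumBot] at h
    rw [h, norm_grunbaumBot_sub_sq ha]
    exact hbot x y
  · obtain ⟨x, y, h⟩ := exists_grunbaumNode_eq ha w n false i j k l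
    have h2 : node ex ey triHeight (grunbaumShift w) n true k l
        = grunbaumTop (crossDir w n) (axisDir w n) (grunbaumNode w n false i j) x y := by
      rw [node_true, ← grunbaumNode, h]; rfl
    rw [h2, norm_grunbaumTop_sub_sq ha]
    exact htop x y

theorem isDelaunay_lyingPrism (w : Word) (n i j : ℤ) : ∃ S c R, 0 < R ∧
    IsDelaunay (grunbaumNodes w) S c R ∧
    lyingPrism (crossDir w n) (axisDir w n) (grunbaumNode w n false i j) = convexHull ℝ S := by
  have hh := triHeight_sq
  have hB := norm_grunbaumBot_sub_sq (isAxes w n) (grunbaumNode w n false i j)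
  have hT := norm_grunbaumTop_sub_sq (isAxes w n) (grunbaumNode w n false i j)
  have mB := grunbaumBot_mem w n i j
  have mT := grunbaumTop_mem w n i j
  -- The centre is halfway along the prism, at the centroid of the triangle, which is one third up.
  -- The squared radius is again `1 / 3 + 1 / 4`.
  refine exists_isDelaunay (isDelaunay_grunbaum_layer w n i j (α := 1 / 2) (β := 1 / 2)
    (ζ := triHeight / 3) (R := 7 / 12) (by linarith [triHeight_pos]) (by linarith [triHeight_pos])
    (by norm_num) ?_ ?_ ?_) (by norm_num) (lyingPrism_eq _ _ _)
  · rintro v (rfl | rfl | rfl | rfl | rfl | rfl)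
    · exact ⟨by simpa using mB 0 0, by rw [hB]; linear_combination (1 / 9) * hh⟩
    · exact ⟨by simpa using mB 1 0, by rw [hB]; linear_combination (1 / 9) * hh⟩
    · exact ⟨by simpa using mT 0 0, by rw [hT]; linear_combination (4 / 9) * hh⟩
    · exact ⟨by simpa using mB 0 1, by rw [hB]; linear_combination (1 / 9) * hh⟩
    · exact ⟨by simpa using mB 1 1, by rw [hB]; linear_combination (1 / 9) * hh⟩
    · exact ⟨by simpa using mT 0 1, by rw [hT]; linear_combination (4 / 9) * hh⟩
  · intro x y
    have hx0 : (0 : ℝ) ≤ x ^ 2 - x := by exact_mod_cast unit_interval_form_nonneg x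
    have hy0 : (0 : ℝ) ≤ y ^ 2 - y := by exact_mod_cast unit_interval_form_nonneg y
    rcases unit_interval_form x with rfl | rfl | h
    · rcases unit_interval_form y with rfl | rfl | h
      · left; simp
      · left; simp
      · right
        have h : (2 : ℝ) ≤ y ^ 2 - y := by exact_mod_cast h
        nlinarith
    · rcases unit_interval_form y with rfl | rfl | h
      · left; simp
      · left; simp
      · right
        have h : (2 : ℝ) ≤ y ^ 2 - y := by exact_mod_cast h
        nlinarith
    · right
      have h : (2 : ℝ) ≤ x ^ 2 - x := by exact_mod_cast h
      nlinarith
  · intro x y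
    have hy0 : (0 : ℝ) ≤ y ^ 2 - y := by exact_mod_cast unit_interval_form_nonneg y
    rcases zero_form x with rfl | h
    · rcases unit_interval_form y with rfl | rfl | h
      · left; simp
      · left; simp
      · right
        have h : (2 : ℝ) ≤ y ^ 2 - y := by exact_mod_cast h
        nlinarith
    · right
      have h : (1 : ℝ) ≤ x ^ 2 := by exact_mod_cast h
      nlinarith

theorem isDelaunay_lyingPrism' (w : Word) (n i j : ℤ) : ∃ S c R, 0 < R ∧
    IsDelaunay (grunbaumNodes w) S c R ∧
    lyingPrism' (crossDir w n) (axisDir w n) (grunbaumNode w n false i j) = convexHull ℝ S := by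
  have hh := triHeight_sq
  have hB := norm_grunbaumBot_sub_sq (isAxes w n) (grunbaumNode w n false i j)
  have hT := norm_grunbaumTop_sub_sq (isAxes w n) (grunbaumNode w n false i j)
  have mB := grunbaumBot_mem w n i j
  have mT := grunbaumTop_mem w n i j
  -- Here the triangle points downwards over the lattice edge `x = 1`, so its centroid is two thirds
  -- up.
  refine exists_isDelaunay (isDelaunay_grunbaum_layer w n i j (α := 1) (β := 1 / 2)
    (ζ := 2 * triHeight / 3) (R := 7 / 12) (by linarith [triHeight_pos])
    (by linarith [triHeight_pos]) (by norm_num) ?_ ?_ ?_) (by norm_num) (lyingPrism'_eq _ _ _)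
  · rintro v (rfl | rfl | rfl | rfl | rfl | rfl)
    · exact ⟨by simpa using mB 1 0, by rw [hB]; linear_combination (4 / 9) * hh⟩
    · exact ⟨by simpa using mT 0 0, by rw [hT]; linear_combination (1 / 9) * hh⟩
    · exact ⟨by simpa using mT 1 0, by rw [hT]; linear_combination (1 / 9) * hh⟩
    · exact ⟨by simpa using mB 1 1, by rw [hB]; linear_combination (4 / 9) * hh⟩
    · exact ⟨by simpa using mT 0 1, by rw [hT]; linear_combination (1 / 9) * hh⟩
    · exact ⟨by simpa using mT 1 1, by rw [hT]; linear_combination (1 / 9) * hh⟩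
  · intro x y
    have hy0 : (0 : ℝ) ≤ y ^ 2 - y := by exact_mod_cast unit_interval_form_nonneg y
    rcases zero_form (x - 1) with h | h
    · obtain rfl : x = 1 := by omega
      rcases unit_interval_form y with rfl | rfl | h
      · left; simp
      · left; simp
      · right
        have h : (2 : ℝ) ≤ y ^ 2 - y := by exact_mod_cast h
        nlinarith
    · right
      have h : (1 : ℝ) ≤ (x - 1) ^ 2 := by exact_mod_cast h
      nlinarith
  · intro x y
    have hx0 : (0 : ℝ) ≤ x ^ 2 - x := by exact_mod_cast unit_interval_form_nonneg x
    have hy0 : (0 : ℝ) ≤ y ^ 2 - y := by exact_mod_cast unit_interval_form_nonneg y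
    rcases unit_interval_form x with rfl | rfl | h
    · rcases unit_interval_form y with rfl | rfl | h
      · left; simp
      · left; simp
      · right
        have h : (2 : ℝ) ≤ y ^ 2 - y := by exact_mod_cast h
        nlinarith
    · rcases unit_interval_form y with rfl | rfl | h
      · left; simp
      · left; simp
      · right
        have h : (2 : ℝ) ≤ y ^ 2 - y := by exact_mod_cast h
        nlinarith
    · right
      have h : (2 : ℝ) ≤ x ^ 2 - x := by exact_mod_cast h
      nlinarith

theorem convexHull_congr₈ {a b c d e f g h a' b' c' d' e' f' g' h' : Space} (ha : a = a')
    (hb : b = b') (hc : c = c') (hd : d = d') (he : e = e') (hf : f = f') (hg : g = g')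
    (hh : h = h') : convexHull ℝ {a, b, c, d, e, f, g, h}
      = convexHull ℝ {a', b', c', d', e', f', g', h'} := by
  rw [ha, hb, hc, hd, he, hf, hg, hh]

/-- The point with coordinates `x`, `y`, `z` relative to `q`. -/
noncomputable def cubePoint (q : Space) (x y z : ℝ) : Space := q + (x • ex + y • ey) + z • ez

theorem cubeAt_eq (q : Space) : cubeAt q = convexHull ℝ
    {cubePoint q 0 0 0, cubePoint q 1 0 0, cubePoint q 0 1 0, cubePoint q 1 1 0,
      cubePoint q 0 0 1, cubePoint q 1 0 1, cubePoint q 0 1 1, cubePoint q 1 1 1} := by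
  rw [cubeAt]
  apply convexHull_congr₈ <;> simp only [cubePoint] <;> module

theorem isDelaunay_cubeAt (w : Word) (n i j : ℤ) : ∃ S c R, 0 < R ∧
    IsDelaunay (grunbaumNodes w) S c R ∧
    cubeAt (grunbaumNode w n true i j) = convexHull ℝ S := by
  have hn : ∀ x y z : ℝ, ‖cubePoint (grunbaumNode w n true i j) x y z
      - cubePoint (grunbaumNode w n true i j) (1 / 2) (1 / 2) (1 / 2)‖ ^ 2
      = (x - 1 / 2) ^ 2 + (y - 1 / 2) ^ 2 + (z - 1 / 2) ^ 2 := fun x y z => by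
    have e : cubePoint (grunbaumNode w n true i j) x y z
        - cubePoint (grunbaumNode w n true i j) (1 / 2) (1 / 2) (1 / 2)
        = (x - 1 / 2) • ex + (y - 1 / 2) • ey + (z - 1 / 2) • ez := by
      simp only [cubePoint]; module
    rw [e, isFrame_grunbaum.norm_sq]; ring
  have hm : ∀ x y : ℤ, cubePoint (grunbaumNode w n true i j) x y 0 ∈ grunbaumNodes w ∧
      cubePoint (grunbaumNode w n true i j) x y 1 ∈ grunbaumNodes w := fun x y => by
    rw [cubePoint, cubePoint, grunbaumNode, ← node_add, zero_smul, add_zero, one_smul,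
      ← node_succ_false]
    exact ⟨node_mem .., node_mem ..⟩
  have hcoord : ∀ k l, ∃ x y : ℤ, node ex ey triHeight (grunbaumShift w) n true k l
      = cubePoint (grunbaumNode w n true i j) x y 0 := fun k l => by
    refine ⟨k - i, l - j, ?_⟩
    rw [cubePoint, grunbaumNode, ← node_add, zero_smul, add_zero]
    congr 1 <;> ring
  have hez : ∀ x y : ℝ, cubePoint (grunbaumNode w n true i j) x y 0 + ez
      = cubePoint (grunbaumNode w n true i j) x y 1 := fun x y => by
    simp [cubePoint]
  have hfar : ∀ x y : ℤ, ((x = 0 ∨ x = 1) ∧ (y = 0 ∨ y = 1)) ∨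
      (3 / 4 : ℝ) < (x - 1 / 2) ^ 2 + (y - 1 / 2) ^ 2 + 1 / 4 := fun x y => by
    have hx0 : (0 : ℝ) ≤ x ^ 2 - x := by exact_mod_cast unit_interval_form_nonneg x
    have hy0 : (0 : ℝ) ≤ y ^ 2 - y := by exact_mod_cast unit_interval_form_nonneg y
    rcases or_assoc.2 (unit_interval_form x) with hx | hx
    · rcases or_assoc.2 (unit_interval_form y) with hy | hy
      · exact Or.inl ⟨hx, hy⟩
      · right
        have hy : (2 : ℝ) ≤ y ^ 2 - y := by exact_mod_cast hy
        nlinarith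
    · right
      have hx : (2 : ℝ) ≤ x ^ 2 - x := by exact_mod_cast hx
      nlinarith
  -- `3 / 4` is the square of half the space diagonal of the unit cube.
  refine exists_isDelaunay ⟨_, isFrame_grunbaum.isDelaunay_of_spacer (grunbaumShift_apply_two w)
    (n := n) (c := cubePoint (grunbaumNode w n true i j) (1 / 2) (1 / 2) (1 / 2)) (R := 3 / 4)
    ?_ (by norm_num) ?_ ?_ ?_⟩ (by norm_num) (cubeAt_eq _)
  · simp only [cubePoint, PiLp.add_apply, PiLp.smul_apply, ez_apply_two,
      isFrame_grunbaum.node_apply_two (grunbaumShift_apply_two w), levelHeight,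
      isFrame_grunbaum.apply_two₁, isFrame_grunbaum.apply_two₂, smul_eq_mul, if_true]
    ring
  · rintro v (rfl | rfl | rfl | rfl | rfl | rfl | rfl | rfl)
    · exact ⟨by simpa using (hm 0 0).1, by rw [hn]; norm_num⟩
    · exact ⟨by simpa using (hm 1 0).1, by rw [hn]; norm_num⟩
    · exact ⟨by simpa using (hm 0 1).1, by rw [hn]; norm_num⟩
    · exact ⟨by simpa using (hm 1 1).1, by rw [hn]; norm_num⟩
    · exact ⟨by simpa using (hm 0 0).2, by rw [hn]; norm_num⟩
    · exact ⟨by simpa using (hm 1 0).2, by rw [hn]; norm_num⟩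
    · exact ⟨by simpa using (hm 0 1).2, by rw [hn]; norm_num⟩
    · exact ⟨by simpa using (hm 1 1).2, by rw [hn]; norm_num⟩
  · intro k l
    obtain ⟨x, y, h⟩ := hcoord k l
    rw [h, hn]
    rcases hfar x y with ⟨rfl | rfl, rfl | rfl⟩ | h
    · left; simp
    · left; simp
    · left; simp
    · left; simp
    · right; linarith
  · intro k l
    obtain ⟨x, y, h⟩ := hcoord k l
    rw [h, hez, hn]
    rcases hfar x y with ⟨rfl | rfl, rfl | rfl⟩ | h
    · left; simp
    · left; simp
    · left; simp
    · left; simp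
    · right; linarith

theorem isDelaunayFamily_grunbaum (w : Word) :
    IsDelaunayFamily (grunbaumNodes w) (elongatedGrunbaum w) := by
  intro P hP
  obtain ⟨n, i, j, rfl | rfl | rfl⟩ := mem_elongatedGrunbaum.1 hP
  exacts [isDelaunay_lyingPrism w n i j, isDelaunay_lyingPrism' w n i j, isDelaunay_cubeAt w n i j]

/-! ### Elongated Grünbaum partitions: shapes of the cells -/

theorem isTriangularPrism_lyingPrism {u a : Space} (h : IsAxes u a) (p : Space) :
    IsTriangularPrism (lyingPrism u a p) := by
  have hF := h.isFrame
  have hh := triHeight_sq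
  have e : ∀ x z : ℝ, inner ℝ a (x • u + z • ez) = (0 : ℝ) := fun x z => by
    have := hF.inner_coords 0 1 0 x 0 z
    simpa using this
  refine isTriangularPrism_of (u := a) rfl rfl rfl
    (hF.dist_eq_one (-1) 0 0 (by module) (by norm_num))
    (hF.dist_eq_one (-1 / 2) 0 (-triHeight) (by module) (by linear_combination hh))
    (hF.dist_eq_one (1 / 2) 0 (-triHeight) (by module) (by linear_combination hh)) ?_ ?_ ?_
  · have := hF.norm_sq 0 1 0
    rw [← sq_eq_sq₀ (norm_nonneg _) zero_le_one]
    simpa using this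
  · convert e 1 0 using 2; module
  · convert e (1 / 2) triHeight using 2; module

theorem isTriangularPrism_lyingPrism' {u a : Space} (h : IsAxes u a) (p : Space) :
    IsTriangularPrism (lyingPrism' u a p) := by
  have hF := h.isFrame
  have hh := triHeight_sq
  have e : ∀ x z : ℝ, inner ℝ a (x • u + z • ez) = (0 : ℝ) := fun x z => by
    have := hF.inner_coords 0 1 0 x 0 z
    simpa using this
  refine isTriangularPrism_of (u := a) rfl rfl rfl
    (hF.dist_eq_one (1 / 2) 0 (-triHeight) (by module) (by linear_combination hh))
    (hF.dist_eq_one (-1 / 2) 0 (-triHeight) (by module) (by linear_combination hh))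
    (hF.dist_eq_one (-1) 0 0 (by module) (by norm_num)) ?_ ?_ ?_
  · have := hF.norm_sq 0 1 0
    rw [← sq_eq_sq₀ (norm_nonneg _) zero_le_one]
    simpa using this
  · convert e (-1 / 2) triHeight using 2; module
  · convert e (1 / 2) triHeight using 2; module

theorem isCube_cubeAt (q : Space) : IsCube (cubeAt q) := by
  refine ⟨q, ![ex, ey, ez], ?_, ?_⟩
  · rw [orthonormal_iff_ite]
    have h : ∀ i j : Fin 3, inner ℝ (![ex, ey, ez] i) (![ex, ey, ez] j)
        = if i = j then (1 : ℝ) else 0 := by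
      intro i j
      fin_cases i <;> fin_cases j <;>
        simp [ex, ey, ez, PiLp.inner_apply, Fin.sum_univ_three, EuclideanSpace.norm_eq]
    exact h
  · rw [cube_vertices, cubeAt_eq]
    congr 1
    ext y
    constructor
    · rintro (rfl | rfl | rfl | rfl | rfl | rfl | rfl | rfl)
      · exact ⟨![0, 0, 0], by simp [Fin.forall_fin_succ],
          by simp [Fin.sum_univ_three, cubePoint]⟩
      · exact ⟨![1, 0, 0], by simp [Fin.forall_fin_succ],
          by simp [Fin.sum_univ_three, cubePoint]⟩
      · exact ⟨![0, 1, 0], by simp [Fin.forall_fin_succ],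
          by simp [Fin.sum_univ_three, cubePoint]⟩
      · exact ⟨![1, 1, 0], by simp [Fin.forall_fin_succ],
          by simp [Fin.sum_univ_three, cubePoint]⟩
      · exact ⟨![0, 0, 1], by simp [Fin.forall_fin_succ],
          by simp [Fin.sum_univ_three, cubePoint]⟩
      · exact ⟨![1, 0, 1], by simp [Fin.forall_fin_succ],
          by simp [Fin.sum_univ_three, cubePoint, add_assoc]⟩
      · exact ⟨![0, 1, 1], by simp [Fin.forall_fin_succ],
          by simp [Fin.sum_univ_three, cubePoint, add_assoc]⟩
      · exact ⟨![1, 1, 1], by simp [Fin.forall_fin_succ],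
          by simp [Fin.sum_univ_three, cubePoint, add_assoc]⟩
    · rintro ⟨t, ht, rfl⟩
      have e : q + ∑ i, t i • ![ex, ey, ez] i = cubePoint q (t 0) (t 1) (t 2) := by
        simp [Fin.sum_univ_three, cubePoint, add_assoc]
      rw [e]
      rcases ht 0 with h0 | h0 <;> rcases ht 1 with h1 | h1 <;> rcases ht 2 with h2 | h2 <;>
        simp [h0, h1, h2]

theorem elongatedGrunbaum_shapes (w : Word) : ∀ P ∈ elongatedGrunbaum w,
    IsTriangularPrism P ∨ IsCube P := by
  intro P hP
  obtain ⟨n, i, j, rfl | rfl | rfl⟩ := mem_elongatedGrunbaum.1 hP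
  · exact Or.inl (isTriangularPrism_lyingPrism (isAxes w n) _)
  · exact Or.inl (isTriangularPrism_lyingPrism' (isAxes w n) _)
  · exact Or.inr (isCube_cubeAt _)

theorem isUniformPolyhedron_of_mem_elongatedGrunbaum {w : Word} {P : Set Space}
    (hP : P ∈ elongatedGrunbaum w) : IsUniformPolyhedron P := by
  rcases elongatedGrunbaum_shapes w P hP with h | h
  exacts [h.isUniformPolyhedron, h.isUniformPolyhedron]

/-! ### Elongated Grünbaum partitions: covering -/

/-- In the parallelepiped over a lattice square the plane `x + t = 1` separates the two prisms. The
triangle contains the cross section, and sweeping it along `a` gives the point. -/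
theorem mem_lyingPrism (u a p : Space) {x y t : ℝ} (hx : 0 ≤ x) (hy : 0 ≤ y) (hy1 : y ≤ 1)
    (ht : 0 ≤ t) (h : x + t ≤ 1) :
    p + (x • u + y • a) + t • ((1 / 2 : ℝ) • u + triHeight • ez) ∈ lyingPrism u a p := by
  have e : p + (x • u + y • a) + t • ((1 / 2 : ℝ) • u + triHeight • ez)
      = (p + x • u + t • ((1 / 2 : ℝ) • u + triHeight • ez)) + y • a := by module
  rw [e]
  refine add_smul_mem_convexHull hy hy1 (S := {p, p + u, p + (1 / 2 : ℝ) • u + triHeight • ez})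
    (mem_convexHull_of_sum ![p, p + u, p + (1 / 2 : ℝ) • u + triHeight • ez] ![1 - x - t, x, t]
      ?_ ?_ ?_ ?_) ?_ ?_
  · simp [Fin.forall_fin_succ]
  · simp only [Fin.forall_fin_succ]
    simp; exact ⟨by linarith, hx, ht⟩
  · simp [Fin.sum_univ_three]; ring
  · simp only [Fin.sum_univ_three]; simp; module
  · rintro v (rfl | rfl | rfl) <;> simp
  · rintro v (rfl | rfl | rfl) <;> simp

theorem mem_lyingPrism' (u a p : Space) {x y t : ℝ} (hx : x ≤ 1) (hy : 0 ≤ y) (hy1 : y ≤ 1)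
    (ht : t ≤ 1) (h : 1 ≤ x + t) :
    p + (x • u + y • a) + t • ((1 / 2 : ℝ) • u + triHeight • ez) ∈ lyingPrism' u a p := by
  have e : p + (x • u + y • a) + t • ((1 / 2 : ℝ) • u + triHeight • ez)
      = (p + x • u + t • ((1 / 2 : ℝ) • u + triHeight • ez)) + y • a := by module
  rw [e]
  refine add_smul_mem_convexHull hy hy1 (S := {p + u, p + (1 / 2 : ℝ) • u + triHeight • ez,
    p + (3 / 2 : ℝ) • u + triHeight • ez})
    (mem_convexHull_of_sum ![p + u, p + (1 / 2 : ℝ) • u + triHeight • ez,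
      p + (3 / 2 : ℝ) • u + triHeight • ez] ![1 - t, 1 - x, x + t - 1] ?_ ?_ ?_ ?_) ?_ ?_
  · simp [Fin.forall_fin_succ]
  · simp only [Fin.forall_fin_succ]
    simp; exact ⟨by linarith, by linarith, by linarith⟩
  · simp [Fin.sum_univ_three]; ring
  · simp only [Fin.sum_univ_three]; simp; module
  · rintro v (rfl | rfl | rfl) <;> simp
  · rintro v (rfl | rfl | rfl) <;> simp

theorem mem_cubeAt (q : Space) {x y t : ℝ} (hx : 0 ≤ x) (hx1 : x ≤ 1) (hy : 0 ≤ y) (hy1 : y ≤ 1)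
    (ht : 0 ≤ t) (ht1 : t ≤ 1) : q + (x • ex + y • ey) + t • ez ∈ cubeAt q := by
  rw [← add_assoc]
  refine add_smul_mem_convexHull ht ht1 (S := {q, q + ex, q + ey, q + ex + ey})
    (add_smul_mem_convexHull hy hy1 (S := {q, q + ex})
      (add_smul_mem_convexHull hx hx1 (S := {q}) (by simp) ?_ ?_) ?_ ?_) ?_ ?_
  · rintro v rfl; simp
  · rintro v rfl; simp
  · rintro v (rfl | rfl) <;> simp
  · rintro v (rfl | rfl) <;> simp
  · rintro v (rfl | rfl | rfl | rfl) <;> simp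
  · rintro v (rfl | rfl | rfl | rfl) <;> simp

theorem sUnion_elongatedGrunbaum (w : Word) : ⋃₀ elongatedGrunbaum w = Set.univ := by
  refine Set.eq_univ_of_forall fun v => ?_
  obtain ⟨n, i, j, x, y, t, hx, hx1, hy, hy1, ht, ht1, hv | hv⟩ :=
    isFrame_grunbaum.exists_layer_coords (grunbaumShift_apply_two w) (η := fun _ => 1)
      (fun _ => Or.inl rfl) v
  -- The coordinates are renamed so that the first one runs across the prisms of this layer.
  · obtain ⟨x', y', hx, hx1, hy, hy1, e⟩ : ∃ x' y' : ℝ, 0 ≤ x' ∧ x' ≤ 1 ∧ 0 ≤ y' ∧ y' ≤ 1 ∧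
        x • ex + y • ey = x' • crossDir w n + y' • axisDir w n := by
      rcases isAxes w n with ⟨h1, h2⟩ | ⟨h1, h2⟩ <;> rw [h1, h2]
      exacts [⟨x, y, hx, hx1, hy, hy1, rfl⟩, ⟨y, x, hy, hy1, hx, hx1, add_comm _ _⟩]
    simp only [Int.cast_one, one_smul] at hv
    rw [← grunbaumNode, grunbaumShift, e] at hv
    rcases le_total (x' + t) 1 with h | h
    · exact ⟨_, lyingPrism_mem w n i j, hv ▸ mem_lyingPrism _ _ _ hx hy hy1 ht h⟩
    · exact ⟨_, lyingPrism'_mem w n i j, hv ▸ mem_lyingPrism' _ _ _ hx1 hy hy1 ht1 h⟩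
  · exact ⟨_, cubeAt_mem w n i j, hv ▸ mem_cubeAt _ hx hx1 hy hy1 ht ht1⟩

theorem isNormalPartition_elongatedGrunbaum (w : Word) : IsNormalPartition (elongatedGrunbaum w) :=
  (isDelaunayFamily_grunbaum w).isNormalPartition
    (fun _ hP => (isUniformPolyhedron_of_mem_elongatedGrunbaum hP).1)
    (isFrame_grunbaum.finite_nodes_inter_closedBall (grunbaumShift_apply_two w))
    (sUnion_elongatedGrunbaum w)

theorem vertices_elongatedGrunbaum (w : Word) :
    vertices (elongatedGrunbaum w) = grunbaumNodes w := by
  refine (isDelaunayFamily_grunbaum w).vertices_eq ?_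
  rintro v -
  have := Set.mem_univ v
  rwa [← sUnion_elongatedGrunbaum w] at this

theorem isLayeredFamily_elongatedGrunbaum :
    IsLayeredFamily ex ey 0 triHeight grunbaumShift elongatedGrunbaum :=
  ⟨isFrame_grunbaum, grunbaumShift_apply_two, vertices_elongatedGrunbaum⟩

/-! ### Elongated Grünbaum partitions: the cells around a vertex -/

theorem grunbaumNode_false_sub_ez (w : Word) (n i j : ℤ) :
    grunbaumNode w n false i j - ez = grunbaumNode w (n - 1) true i j := by
  rw [sub_eq_iff_eq_add, ← node_succ_false, sub_add_cancel]

theorem eq_of_mem_grunbaum_layer {w : Word} {n m i j k l : ℤ} {b : Bool}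
    (h : grunbaumNode w m b i j ∈
        lyingPrism (crossDir w n) (axisDir w n) (grunbaumNode w n false k l) ∨
      grunbaumNode w m b i j ∈
        lyingPrism' (crossDir w n) (axisDir w n) (grunbaumNode w n false k l)) : m = n := by
  have hh := triHeight_pos
  have hn := isFrame_grunbaum.node_apply_two (grunbaumShift_apply_two w) n false k l
  have h1 := (isAxes w n).isFrame.apply_two₁
  have h2 := (isAxes w n).isFrame.apply_two₂
  rcases h with h | h <;> refine isFrame_grunbaum.eq_of_mem_layer (grunbaumShift_apply_two w) ?_ h <;>
    rintro x (rfl | rfl | rfl | rfl | rfl | rfl) <;>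
      simp [hn, h1, h2, ez_apply_two, levelHeight, hh.le]

theorem eq_of_mem_cubeAt {w : Word} {n m i j k l : ℤ} {b : Bool}
    (h : grunbaumNode w m b i j ∈ cubeAt (grunbaumNode w n true k l)) :
    (m = n ∧ b = true) ∨ (m = n + 1 ∧ b = false) := by
  have hn := isFrame_grunbaum.node_apply_two (grunbaumShift_apply_two w) n true k l
  have h1 := isFrame_grunbaum.apply_two₁
  have h2 := isFrame_grunbaum.apply_two₂
  have e : levelHeight triHeight (n + 1) false = levelHeight triHeight n true + 1 := by
    simp only [levelHeight, if_true, Bool.false_eq_true, if_false]; push_cast; ring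
  refine isFrame_grunbaum.eq_of_mem_spacer (grunbaumShift_apply_two w) ?_ h
  rintro x (rfl | rfl | rfl | rfl | rfl | rfl | rfl | rfl) <;> simp [hn, h1, h2, ez_apply_two, e]

/-- As in the Kelvin case, only layer `n` and the cubes below it matter, so the star depends on
nothing but the direction of the prisms in layer `n`. -/
theorem grunbaum_star_false {w : Word} {n i j : ℤ} {P : Set Space} (hP : P ∈ elongatedGrunbaum w)
    (h : grunbaumNode w n false i j ∈ P) : ∃ k l : ℤ,
    P = lyingPrism (crossDir w n) (axisDir w n) (grunbaumNode w n false k l) ∨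
    P = lyingPrism' (crossDir w n) (axisDir w n) (grunbaumNode w n false k l) ∨
    P = cubeAt (grunbaumNode w n false k l - ez) := by
  simp only [grunbaumNode_false_sub_ez]
  obtain ⟨m, k, l, rfl | rfl | rfl⟩ := mem_elongatedGrunbaum.1 hP
  · obtain rfl := eq_of_mem_grunbaum_layer (Or.inl h); exact ⟨k, l, by simp⟩
  · obtain rfl := eq_of_mem_grunbaum_layer (Or.inr h); exact ⟨k, l, by simp⟩
  · obtain ⟨-, h⟩ | ⟨rfl, -⟩ := eq_of_mem_cubeAt h
    · cases h
    · exact ⟨k, l, by simp⟩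

theorem grunbaum_star_true {w : Word} {n i j : ℤ} {P : Set Space} (hP : P ∈ elongatedGrunbaum w)
    (h : grunbaumNode w n true i j ∈ P) : ∃ k l : ℤ,
    P = lyingPrism (crossDir w n) (axisDir w n) (grunbaumNode w n false k l) ∨
    P = lyingPrism' (crossDir w n) (axisDir w n) (grunbaumNode w n false k l) ∨
    P = cubeAt (grunbaumNode w n true k l) := by
  obtain ⟨m, k, l, rfl | rfl | rfl⟩ := mem_elongatedGrunbaum.1 hP
  · obtain rfl := eq_of_mem_grunbaum_layer (Or.inl h); exact ⟨k, l, by simp⟩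
  · obtain rfl := eq_of_mem_grunbaum_layer (Or.inr h); exact ⟨k, l, by simp⟩
  · obtain ⟨rfl, -⟩ | ⟨-, h⟩ := eq_of_mem_cubeAt h
    · exact ⟨k, l, by simp⟩
    · cases h

/-! ### Elongated Grünbaum partitions: images of cells -/

section Images

variable {g : Space ≃ᵃⁱ[ℝ] Space} {L : Space ≃ₗᵢ[ℝ] Space}

theorem image_lyingPrism (hg : ∀ x u, g (x + u) = g x + L u) (h3 : L ez = ez) (u a p : Space) :
    g '' lyingPrism u a p = lyingPrism (L u) (L a) (g p) ∧
      g '' lyingPrism' u a p = lyingPrism' (L u) (L a) (g p) := by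
  simp only [lyingPrism, lyingPrism', image_convexHull_isometry, Set.image_insert_eq,
    Set.image_singleton, hg, map_smul, h3, and_self]

theorem image_cubeAt (hg : ∀ x u, g (x + u) = g x + L u) (h : IsAxes (L ex) (L ey))
    (h3 : L ez = ez) (q : Space) : g '' cubeAt q = cubeAt (g q) := by
  simp only [cubeAt, image_convexHull_isometry, Set.image_insert_eq, Set.image_singleton, hg, h3]
  rcases h with ⟨h1, h2⟩ | ⟨h1, h2⟩
  · rw [h1, h2]
  · rw [h1, h2, add_right_comm _ ey ex]
    congr 1
    ext x; simp only [Set.mem_insert_iff, Set.mem_singleton_iff]; tauto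

/-- A point reflection exchanges the two kinds of lying prisms. -/
theorem image_lyingPrism_of_neg (hg : ∀ x u, g (x + u) = g x - u) (u a p : Space) :
    g '' lyingPrism u a p
      = lyingPrism' u a (g p - ((1 / 2 : ℝ) • u + triHeight • ez) - (u + a)) ∧
    g '' lyingPrism' u a p
      = lyingPrism u a (g p - ((1 / 2 : ℝ) • u + triHeight • ez) - (u + a)) := by
  set p' := g p - ((1 / 2 : ℝ) • u + triHeight • ez) - (u + a) with hp'
  have b : g p = p' + ((1 / 2 : ℝ) • u + triHeight • ez) + (u + a) := by rw [hp']; abel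
  simp only [lyingPrism, lyingPrism', image_convexHull_isometry,
    Set.image_insert_eq, Set.image_singleton, hg, b]
  have a1 : p' + ((1 / 2 : ℝ) • u + triHeight • ez) + (u + a)
      = p' + (3 / 2 : ℝ) • u + triHeight • ez + a := by module
  have a2 : p' + (3 / 2 : ℝ) • u + triHeight • ez + a - u
      = p' + (1 / 2 : ℝ) • u + triHeight • ez + a := by module
  have a3 : p' + (3 / 2 : ℝ) • u + triHeight • ez + a - (1 / 2 : ℝ) • u - triHeight • ez
      = p' + u + a := by module
  have a4 : p' + (3 / 2 : ℝ) • u + triHeight • ez + a - a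
      = p' + (3 / 2 : ℝ) • u + triHeight • ez := by module
  have a5 : p' + (1 / 2 : ℝ) • u + triHeight • ez + a - a
      = p' + (1 / 2 : ℝ) • u + triHeight • ez := by module
  have a6 : p' + u + a - a = p' + u := by module
  have a7 : p' + (3 / 2 : ℝ) • u + triHeight • ez + a - (3 / 2 : ℝ) • u - triHeight • ez
      = p' + a := by module
  have a8 : p' + a - a = p' := by module
  rw [a1, a2, a3, a4, a5, a6, a7, a8]
  constructor <;> congr 1 <;> ext x <;>
    simp only [Set.mem_insert_iff, Set.mem_singleton_iff] <;> tauto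

theorem image_cubeAt_of_neg (hg : ∀ x u, g (x + u) = g x - u) (q : Space) :
    g '' cubeAt q = cubeAt (g q - ez - (ex + ey)) := by
  set q' := g q - ez - (ex + ey) with hq'
  have b : g q = q' + ex + ey + ez := by rw [hq']; abel
  simp only [cubeAt, image_convexHull_isometry, Set.image_insert_eq, Set.image_singleton, hg, b]
  have a1 : q' + ex + ey + ez - ex = q' + ey + ez := by abel
  have a2 : q' + ex + ey + ez - ey = q' + ex + ez := by abel
  have a3 : q' + ey + ez - ey = q' + ez := by abel
  have a4 : q' + ex + ey + ez - ez = q' + ex + ey := by abel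
  have a5 : q' + ey + ez - ez = q' + ey := by abel
  have a6 : q' + ex + ez - ez = q' + ex := by abel
  have a7 : q' + ez - ez = q' := by abel
  rw [a1, a2, a3, a4, a5, a6, a7]
  congr 1
  ext x; simp only [Set.mem_insert_iff, Set.mem_singleton_iff]; tauto

end Images

/-! ### Elongated Grünbaum partitions: congruence of stars -/

/-- An isometry that takes one pair of axes to another one. -/
theorem IsAxes.exists_map {u a u' a' : Space} (h : IsAxes u a) (h' : IsAxes u' a') :
    ∃ L : Space ≃ₗᵢ[ℝ] Space, (∀ x, L (L x) = x) ∧ L u = u' ∧ L a = a' ∧ IsAxes (L ex) (L ey) ∧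
      L ez = ez := by
  have hswap : ∃ L : Space ≃ₗᵢ[ℝ] Space, (∀ x, L (L x) = x) ∧ L ex = ey ∧ L ey = ex ∧ L ez = ez := by
    -- The mirror exchanging `ex` and `ey` is known to fix `ex + ey` and `ez`; its action on `ex -
    -- ey` follows from the exchange of the two points.
    obtain ⟨g, L, hg, hxy, hgg, -, hL⟩ := exists_reflection ex ey
    have h0 : L (ex + ey) = ex + ey := hL _ (by
      simp [ex, ey, PiLp.inner_apply, Fin.sum_univ_three])
    have h1 : g ey = ex := by rw [← hxy, hgg]
    have h2 : L (ex - ey) = ey - ex := by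
      have := hg ey (ex - ey)
      rw [add_sub_cancel, hxy, h1] at this
      exact eq_sub_iff_add_eq'.2 this.symm
    rw [map_add] at h0
    rw [map_sub] at h2
    refine ⟨L, fun x => ?_, ?_, ?_, hL _ (by simp [ex, ey, ez, PiLp.inner_apply, Fin.sum_univ_three])⟩
    · have e1 := hgg (0 + x)
      have e0 := hgg 0
      have e2 := hg 0 x
      have e3 := hg (g 0) (L x)
      rw [e2, e3, e0] at e1
      simpa using e1
    · have : L ex = (1 / 2 : ℝ) • ((L ex + L ey) + (L ex - L ey)) := by module
      rw [this, h0, h2]; module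
    · have : L ey = (1 / 2 : ℝ) • ((L ex + L ey) - (L ex - L ey)) := by module
      rw [this, h0, h2]; module
  obtain ⟨L, hL, h1, h2, h3⟩ := hswap
  rcases h with ⟨rfl, rfl⟩ | ⟨rfl, rfl⟩ <;> rcases h' with ⟨rfl, rfl⟩ | ⟨rfl, rfl⟩
  · exact ⟨LinearIsometryEquiv.refl ℝ Space, by simp [IsAxes]⟩
  · exact ⟨L, hL, h1, h2, Or.inr ⟨h1, h2⟩, h3⟩
  · exact ⟨L, hL, h2, h1, Or.inr ⟨h1, h2⟩, h3⟩
  · exact ⟨LinearIsometryEquiv.refl ℝ Space, by simp [IsAxes]⟩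

theorem grunbaum_star_map {w w' : Word} {n n' i j i' j' : ℤ} {g : Space ≃ᵃⁱ[ℝ] Space}
    {L : Space ≃ₗᵢ[ℝ] Space} (hg : ∀ x u, g (x + u) = g x + L u)
    (hu : L (crossDir w n) = crossDir w' n') (ha : L (axisDir w n) = axisDir w' n')
    (h0 : IsAxes (L ex) (L ey)) (h3 : L ez = ez)
    (hv : g (grunbaumNode w n false i j) = grunbaumNode w' n' false i' j') {P : Set Space}
    (hP : P ∈ elongatedGrunbaum w) (hvP : grunbaumNode w n false i j ∈ P) :
    g '' P ∈ elongatedGrunbaum w' := by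
  have hnode : ∀ k l, ∃ k' l', g (grunbaumNode w n false k l) = grunbaumNode w' n' false k' l' := by
    intro k l
    obtain ⟨x, y, e⟩ := exists_grunbaumNode_eq (isAxes w n) w n false i j k l
    obtain ⟨k', l', e'⟩ := exists_grunbaumNode_add (isAxes w' n') w' n' false i' j' x y
    exact ⟨k', l', by rw [e, hg, map_add, map_smul, map_smul, hu, ha, hv, e']⟩
  obtain ⟨k, l, rfl | rfl | rfl⟩ := grunbaum_star_false hP hvP <;> obtain ⟨k', l', e⟩ := hnode k l
  · rw [(image_lyingPrism hg h3 _ _ _).1, hu, ha, e]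
    exact lyingPrism_mem ..
  · rw [(image_lyingPrism hg h3 _ _ _).2, hu, ha, e]
    exact lyingPrism'_mem ..
  · rw [image_cubeAt hg h0 h3, sub_eq_add_neg, hg, map_neg, h3, ← sub_eq_add_neg, e,
      grunbaumNode_false_sub_ez]
    exact cubeAt_mem ..

/-- A translation suffices if the prisms are parallel; otherwise the axes are swapped as well, and
this keeps the cubes. -/
theorem starsCongruent_grunbaum_false (w w' : Word) (n n' i j i' j' : ℤ) :
    StarsCongruent (elongatedGrunbaum w) (grunbaumNode w n false i j)
      (elongatedGrunbaum w') (grunbaumNode w' n' false i' j') := by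
  obtain ⟨L, hL, hu, ha, h0, h3⟩ := (isAxes w n).exists_map (isAxes w' n')
  have hu' : L (crossDir w' n') = crossDir w n := by rw [← hu, hL]
  have ha' : L (axisDir w' n') = axisDir w n := by rw [← ha, hL]
  set v := grunbaumNode w n false i j with hv
  set v' := grunbaumNode w' n' false i' j' with hv'
  have e : isom L (v' - L v) v = v' := by simp
  have e' : isom L (v - L v') v' = v := by simp
  refine StarsCongruent.of_maps (g := isom L (v' - L v)) (g' := isom L (v - L v')) (fun x => ?_) e
    (fun P hP hvP => grunbaum_star_map (fun x u => ?_) hu ha h0 h3 e hP hvP)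
    (fun P hP hvP => grunbaum_star_map (fun x u => ?_) hu' ha' h0 h3 e' hP hvP)
  · simp only [isom_apply, map_add, map_sub, hL]; abel
  · simp only [isom_apply, map_add]; abel
  · simp only [isom_apply, map_add]; abel

/-- The point reflection in the midpoint of the two nodes preserves the prism layer, exchanging the
two kinds of prisms, and exchanges the adjacent layers of cubes. -/
theorem starsCongruent_grunbaum_true (w : Word) (n i j : ℤ) :
    StarsCongruent (elongatedGrunbaum w) (grunbaumNode w n false i j)
      (elongatedGrunbaum w) (grunbaumNode w n true i j) := by
  set g : Space ≃ᵃⁱ[ℝ] Space := isom (LinearIsometryEquiv.neg ℝ)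
    (grunbaumNode w n false i j + grunbaumNode w n true i j) with hgdef
  have happ : ∀ x, g x = grunbaumNode w n false i j + grunbaumNode w n true i j - x := fun x => by
    simp [hgdef]; abel
  have hg : ∀ x u, g (x + u) = g x - u := fun x u => by rw [happ, happ]; abel
  have hsum : crossDir w n + axisDir w n = ex + ey := by
    rcases isAxes w n with ⟨h1, h2⟩ | ⟨h1, h2⟩ <;> rw [h1, h2]
    exact add_comm _ _
  have hsub : ∀ m b k l, grunbaumNode w m b k l - (ex + ey)
      = grunbaumNode w m b (k + -1) (l + -1) := fun m b k l => by
    rw [grunbaumNode, grunbaumNode, node_add]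
    push_cast
    module
  have hnode : ∀ k l, g (grunbaumNode w n false k l)
      - ((1 / 2 : ℝ) • crossDir w n + triHeight • ez)
      = grunbaumNode w n false (2 * i - k) (2 * j - l) := fun k l => by
    rw [happ, grunbaumNode, grunbaumNode, grunbaumNode, grunbaumNode, node_true, grunbaumShift]
    simp only [node, Bool.false_eq_true, if_false]
    push_cast
    module
  have hnode' : ∀ k l, g (grunbaumNode w n false k l - ez) - ez
      = grunbaumNode w n true (2 * i - k) (2 * j - l) := fun k l => by
    rw [grunbaumNode, grunbaumNode, node_true, ← grunbaumNode, ← grunbaumNode,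
      ← hnode, sub_eq_add_neg (grunbaumNode w n false k l) ez, hg, grunbaumShift]
    module
  have hnode'' : ∀ k l, g (grunbaumNode w n true k l) - ez
      = grunbaumNode w (n - 1) true (2 * i - k) (2 * j - l) := fun k l => by
    rw [← grunbaumNode_false_sub_ez, ← hnode]
    rw [grunbaumNode, node_true, hg, grunbaumShift]
  refine StarsCongruent.of_maps (g := g) (g' := g) (fun x => by rw [happ, happ]; abel)
    (by rw [happ]; abel) (fun P hP hvP => ?_) (fun P hP hvP => ?_)
  · obtain ⟨k, l, rfl | rfl | rfl⟩ := grunbaum_star_false hP hvP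
    · rw [(image_lyingPrism_of_neg hg _ _ _).1, hnode, hsum, hsub]; exact lyingPrism'_mem ..
    · rw [(image_lyingPrism_of_neg hg _ _ _).2, hnode, hsum, hsub]; exact lyingPrism_mem ..
    · rw [image_cubeAt_of_neg hg, hnode', hsub]; exact cubeAt_mem ..
  · obtain ⟨k, l, rfl | rfl | rfl⟩ := grunbaum_star_true hP hvP
    · rw [(image_lyingPrism_of_neg hg _ _ _).1, hnode, hsum, hsub]; exact lyingPrism'_mem ..
    · rw [(image_lyingPrism_of_neg hg _ _ _).2, hnode, hsum, hsub]; exact lyingPrism_mem ..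
    · rw [image_cubeAt_of_neg hg, hnode'', hsub]; exact cubeAt_mem ..

theorem starsCongruent_grunbaum {w w' : Word} {v v' : Space}
    (hv : v ∈ vertices (elongatedGrunbaum w)) (hv' : v' ∈ vertices (elongatedGrunbaum w')) :
    StarsCongruent (elongatedGrunbaum w) v (elongatedGrunbaum w') v' := by
  have key : ∀ {w v}, v ∈ vertices (elongatedGrunbaum w) → ∃ n i j,
      StarsCongruent (elongatedGrunbaum w) (grunbaumNode w n false i j) (elongatedGrunbaum w) v := by
    intro w v hv
    rw [vertices_elongatedGrunbaum] at hv
    obtain ⟨n, b, i, j, rfl⟩ := hv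
    cases b
    · exact ⟨n, i, j, starsCongruent_grunbaum_false ..⟩
    · exact ⟨n, i, j, starsCongruent_grunbaum_true ..⟩
  obtain ⟨n, i, j, h⟩ := key hv
  obtain ⟨n', i', j', h'⟩ := key hv'
  exact (h.symm.trans (starsCongruent_grunbaum_false w w' n n' i j i' j')).trans h'

/-! ### Elongated Grünbaum partitions: number of cells around a vertex -/

theorem turns_zero (w : Word) : turns w 0 = 0 := partialSum_zero _

theorem even_turns_succ (w : Word) (n : ℤ) :
    Even (turns w (n + 1)) ↔ (w n = .a ↔ Even (turns w n)) := by
  have : turns w (n + 1) = turns w n + (w n).turn := partialSum_succ _ n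
  rw [this, Int.even_add]
  cases w n <;> simp [Letter.turn]

theorem even_turns_const (n : ℤ) : Even (turns (fun _ => .a) n) := by
  induction n using Int.induction_on with
  | zero => rw [turns_zero]; exact Even.zero
  | succ n ih => rw [even_turns_succ]; simpa using ih
  | pred n ih =>
    have := even_turns_succ (fun _ => .a) (-n - 1)
    rw [sub_add_cancel] at this
    simpa using this.1 ih

theorem crossDir_const (n : ℤ) : crossDir (fun _ => .a) n = ex := by
  simp [crossDir, even_turns_const]

theorem axisDir_const (n : ℤ) : axisDir (fun _ => .a) n = ey := by
  simp [axisDir, even_turns_const]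

section Count

open Finset

/-- Indices of the vertices of the cells in the partition of the constant sequence `a`. -/
def lyingIndex (n k l : ℤ) : Finset (ℤ × Bool × ℤ × ℤ) :=
  {(n, false, k, l), (n, false, k + 1, l), (n, true, k, l),
    (n, false, k, l + 1), (n, false, k + 1, l + 1), (n, true, k, l + 1)}

def lyingIndex' (n k l : ℤ) : Finset (ℤ × Bool × ℤ × ℤ) :=
  {(n, false, k + 1, l), (n, true, k, l), (n, true, k + 1, l),
    (n, false, k + 1, l + 1), (n, true, k, l + 1), (n, true, k + 1, l + 1)}

def cubeIndex (n k l : ℤ) : Finset (ℤ × Bool × ℤ × ℤ) :=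
  {(n, true, k, l), (n, true, k + 1, l), (n, true, k, l + 1), (n, true, k + 1, l + 1),
    (n + 1, false, k, l), (n + 1, false, k + 1, l), (n + 1, false, k, l + 1),
    (n + 1, false, k + 1, l + 1)}

theorem cell_lyingIndex (n k l : ℤ) :
    cell ex ey triHeight (grunbaumShift fun _ => .a) (lyingIndex n k l)
    = lyingPrism ex ey (grunbaumNode (fun _ => .a) n false k l) := by
  simp only [cell, lyingIndex, coe_insert, coe_singleton, Set.image_insert_eq, Set.image_singleton,
    lyingPrism]
  apply convexHull_congr₆ <;>
    simp only [node, grunbaumShift, crossDir_const, Bool.false_eq_true, if_false, if_true] <;>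
    push_cast <;> module

theorem cell_lyingIndex' (n k l : ℤ) :
    cell ex ey triHeight (grunbaumShift fun _ => .a) (lyingIndex' n k l)
    = lyingPrism' ex ey (grunbaumNode (fun _ => .a) n false k l) := by
  simp only [cell, lyingIndex', coe_insert, coe_singleton, Set.image_insert_eq, Set.image_singleton,
    lyingPrism']
  apply convexHull_congr₆ <;>
    simp only [node, grunbaumShift, crossDir_const, Bool.false_eq_true, if_false, if_true] <;>
    push_cast <;> module

theorem cell_cubeIndex (n k l : ℤ) :
    cell ex ey triHeight (grunbaumShift fun _ => .a) (cubeIndex n k l)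
    = cubeAt (grunbaumNode (fun _ => .a) n true k l) := by
  simp only [cell, cubeIndex, coe_insert, coe_singleton, Set.image_insert_eq, Set.image_singleton,
    cubeAt, node_succ_false]
  apply convexHull_congr₈ <;>
    simp only [node, grunbaumShift, crossDir_const, if_true] <;> push_cast <;> module

theorem lyingPrism_mem_const (n k l : ℤ) :
    lyingPrism ex ey (grunbaumNode (fun _ => .a) n false k l) ∈ elongatedGrunbaum fun _ => .a := by
  have := lyingPrism_mem (fun _ => .a) n k l
  rwa [crossDir_const, axisDir_const] at this

theorem lyingPrism'_mem_const (n k l : ℤ) :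
    lyingPrism' ex ey (grunbaumNode (fun _ => .a) n false k l) ∈ elongatedGrunbaum fun _ => .a := by
  have := lyingPrism'_mem (fun _ => .a) n k l
  rwa [crossDir_const, axisDir_const] at this

theorem mem_elongatedGrunbaum_const {P : Set Space} (hP : P ∈ elongatedGrunbaum fun _ => .a) :
    ∃ n k l : ℤ,
    (IsTriangularPrism P ∧
      (P = cell ex ey triHeight (grunbaumShift fun _ => .a) (lyingIndex n k l) ∨
      P = cell ex ey triHeight (grunbaumShift fun _ => .a) (lyingIndex' n k l))) ∨
    (IsCube P ∧ P = cell ex ey triHeight (grunbaumShift fun _ => .a) (cubeIndex n k l)) := by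
  have h : IsAxes ex ey := Or.inl ⟨rfl, rfl⟩
  simp only [cell_lyingIndex, cell_lyingIndex', cell_cubeIndex]
  obtain ⟨n, k, l, rfl | rfl | rfl⟩ := mem_elongatedGrunbaum.1 hP <;> refine ⟨n, k, l, ?_⟩
  · simp [crossDir_const, axisDir_const, isTriangularPrism_lyingPrism h]
  · simp [crossDir_const, axisDir_const, isTriangularPrism_lyingPrism' h]
  · simp [isCube_cubeAt]

theorem ncard_cubes_const :
    {P ∈ delaunayStar (elongatedGrunbaum fun _ => .a) (grunbaumNode (fun _ => .a) 0 false 0 0) |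
      IsCube P}.ncard = 4 := by
  rw [isFrame_grunbaum.ncard_star (grunbaumShift_apply_two _) (isDelaunayFamily_grunbaum _)
    IsCube {cubeIndex (-1) 0 0, cubeIndex (-1) (-1) 0, cubeIndex (-1) 0 (-1),
      cubeIndex (-1) (-1) (-1)}]
  · decide
  · intro I hI
    obtain ⟨k, l, rfl, h⟩ : ∃ k l, I = cubeIndex (-1) k l ∧ (0, false, 0, 0) ∈ cubeIndex (-1) k l := by
      simp only [mem_insert, mem_singleton] at hI
      obtain rfl | rfl | rfl | rfl := hI <;> exact ⟨_, _, rfl, by decide⟩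
    rw [cell_cubeIndex]
    exact ⟨cubeAt_mem (fun _ => .a) .., isCube_cubeAt _, h⟩
  · intro P hP hp
    obtain ⟨n, k, l, ⟨h, -⟩ | ⟨-, h⟩⟩ := mem_elongatedGrunbaum_const hP
    · exact absurd h hp.not_isTriangularPrism
    · refine ⟨_, h, fun hI => ?_⟩
      simp only [cubeIndex, mem_insert, mem_singleton, Prod.mk.injEq, Bool.false_eq_true, false_and,
        and_false, false_or, true_and] at hI
      obtain ⟨rfl, rfl, rfl⟩ | ⟨rfl, rfl, rfl⟩ | ⟨rfl, rfl, rfl⟩ | ⟨rfl, rfl, rfl⟩ :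
        (n = -1 ∧ k = 0 ∧ l = 0) ∨ (n = -1 ∧ k = -1 ∧ l = 0) ∨ (n = -1 ∧ k = 0 ∧ l = -1) ∨
        (n = -1 ∧ k = -1 ∧ l = -1) := by omega
      all_goals simp

theorem ncard_lyingPrisms_const :
    {P ∈ delaunayStar (elongatedGrunbaum fun _ => .a) (grunbaumNode (fun _ => .a) 0 false 0 0) |
      IsTriangularPrism P}.ncard = 6 := by
  have hax : IsAxes ex ey := Or.inl ⟨rfl, rfl⟩
  rw [isFrame_grunbaum.ncard_star (grunbaumShift_apply_two _) (isDelaunayFamily_grunbaum _)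
    IsTriangularPrism {lyingIndex 0 0 0, lyingIndex 0 (-1) 0, lyingIndex 0 0 (-1),
      lyingIndex 0 (-1) (-1), lyingIndex' 0 (-1) 0, lyingIndex' 0 (-1) (-1)}]
  · decide
  · intro I hI
    obtain ⟨k, l, rfl | rfl, h⟩ : ∃ k l, (I = lyingIndex 0 k l ∨ I = lyingIndex' 0 k l) ∧
        (0, false, 0, 0) ∈ I := by
      simp only [mem_insert, mem_singleton] at hI
      obtain rfl | rfl | rfl | rfl | rfl | rfl := hI
      exacts [⟨_, _, Or.inl rfl, by decide⟩, ⟨_, _, Or.inl rfl, by decide⟩,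
        ⟨_, _, Or.inl rfl, by decide⟩, ⟨_, _, Or.inl rfl, by decide⟩,
        ⟨_, _, Or.inr rfl, by decide⟩, ⟨_, _, Or.inr rfl, by decide⟩]
    · refine ⟨?_, ?_, h⟩ <;> rw [cell_lyingIndex]
      exacts [lyingPrism_mem_const .., isTriangularPrism_lyingPrism hax _]
    · refine ⟨?_, ?_, h⟩ <;> rw [cell_lyingIndex']
      exacts [lyingPrism'_mem_const .., isTriangularPrism_lyingPrism' hax _]
  · intro P hP hp
    obtain ⟨n, k, l, ⟨-, h | h⟩ | ⟨h, -⟩⟩ := mem_elongatedGrunbaum_const hP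
    · refine ⟨_, h, fun hI => ?_⟩
      simp only [lyingIndex, mem_insert, mem_singleton, Prod.mk.injEq, Bool.false_eq_true, false_and,
        and_false, false_or, or_false, true_and] at hI
      obtain ⟨rfl, rfl, rfl⟩ | ⟨rfl, rfl, rfl⟩ | ⟨rfl, rfl, rfl⟩ | ⟨rfl, rfl, rfl⟩ :
        (n = 0 ∧ k = 0 ∧ l = 0) ∨ (n = 0 ∧ k = -1 ∧ l = 0) ∨ (n = 0 ∧ k = 0 ∧ l = -1) ∨
        (n = 0 ∧ k = -1 ∧ l = -1) := by omega
      all_goals simp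
    · refine ⟨_, h, fun hI => ?_⟩
      simp only [lyingIndex', mem_insert, mem_singleton, Prod.mk.injEq, Bool.false_eq_true, false_and,
        and_false, false_or, or_false, true_and] at hI
      obtain ⟨rfl, rfl, rfl⟩ | ⟨rfl, rfl, rfl⟩ : (n = 0 ∧ k = -1 ∧ l = 0) ∨
        (n = 0 ∧ k = -1 ∧ l = -1) := by omega
      all_goals simp
    · exact absurd hp h.not_isTriangularPrism

theorem ncard_grunbaum_star {w : Word} {v : Space} (hv : v ∈ vertices (elongatedGrunbaum w)) :
    {P ∈ delaunayStar (elongatedGrunbaum w) v | IsCube P}.ncard = 4 ∧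
    {P ∈ delaunayStar (elongatedGrunbaum w) v | IsTriangularPrism P}.ncard = 6 := by
  have h := starsCongruent_grunbaum (w := fun _ => .a) (v := grunbaumNode (fun _ => .a) 0 false 0 0)
    (by rw [vertices_elongatedGrunbaum]; exact node_mem ..) hv
  rw [← h.ncard_eq (p := IsCube) fun g P hP => hP.image g,
    ← h.ncard_eq (p := IsTriangularPrism) fun g P hP => hP.image g]
  exact ⟨ncard_cubes_const, ncard_lyingPrisms_const⟩

end Count

/-! ### Elongated Grünbaum partitions: symmetry -/

theorem ex_ne_ey : ex ≠ ey := fun h => by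
  have := congrArg (fun v : Space => v 0) h
  simp [ex, ey] at this

theorem crossDir_eq_iff {w w' : Word} {n m : ℤ} :
    crossDir w n = crossDir w' m ↔ (Even (turns w n) ↔ Even (turns w' m)) := by
  by_cases h : Even (turns w n) <;> by_cases h' : Even (turns w' m) <;>
    simp [crossDir, h, h', ex_ne_ey, ex_ne_ey.symm]

theorem axisDir_eq_of_crossDir_eq {w w' : Word} {n m : ℤ} (h : crossDir w n = crossDir w' m) :
    axisDir w n = axisDir w' m := by
  simp only [axisDir, crossDir_eq_iff.1 h]

/-- Recovers the word from the directions alone, which are what isometries see. -/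
theorem eq_a_iff (w : Word) (n : ℤ) : w n = .a ↔ crossDir w (n + 1) = crossDir w n := by
  rw [crossDir_eq_iff, even_turns_succ]; tauto

theorem Letter.eq_of_iff {x y : Letter} (h : x = .a ↔ y = .a) : x = y := by
  cases x <;> cases y <;> simp_all

/-- For perpendicular layers the shifts differ by half of `ex - ey` up to sign, which has
half-integral coordinates. -/
theorem grunbaumShift_sub_mem_iff {w w' : Word} {n m : ℤ} :
    grunbaumShift w n - grunbaumShift w' m ∈ lattice ex ey ↔ crossDir w n = crossDir w' m := by
  constructor
  · intro h
    by_contra hne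
    have hhalf : ∃ x y : ℝ, (x = 1 / 2 ∨ x = -1 / 2) ∧
        grunbaumShift w n - grunbaumShift w' m = x • ex + y • ey := by
      rcases isAxes w n with ⟨h1, -⟩ | ⟨h1, -⟩ <;> rcases isAxes w' m with ⟨h2, -⟩ | ⟨h2, -⟩ <;>
        rw [h1, h2] at hne <;> simp only [grunbaumShift, h1, h2]
      · exact absurd rfl hne
      · exact ⟨1 / 2, -1 / 2, Or.inl rfl, by module⟩
      · exact ⟨-1 / 2, 1 / 2, Or.inr rfl, by module⟩
      · exact absurd rfl hne
    obtain ⟨x, y, hx, e⟩ := hhalf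
    rw [e] at h
    obtain ⟨i, -, rfl, -⟩ := isFrame_grunbaum.mem_lattice_coords h
    have hx : (2 * i : ℝ) = 1 ∨ (2 * i : ℝ) = -1 := by
      rcases hx with hx | hx
      · left; linarith
      · right; linarith
    have hx : 2 * i = 1 ∨ 2 * i = -1 := by exact_mod_cast hx
    omega
  · intro h
    simp only [grunbaumShift, h, sub_self]
    exact zero_mem _

theorem elongatedGrunbaum_injective : Function.Injective elongatedGrunbaum := by
  refine isLayeredFamily_elongatedGrunbaum.injective fun w w' h => funext fun n => ?_
  simp only [grunbaumShift_sub_mem_iff] at h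
  exact Letter.eq_of_iff (by rw [eq_a_iff, eq_a_iff, h, h])

/-- The isometry preserves parallelism between layers, and a letter records whether two neighbouring
layers are parallel. -/
theorem wordsEquivalent_of_elongatedGrunbaum_eq (w w' : Word) (g : Space ≃ᵃⁱ[ℝ] Space)
    (h : elongatedGrunbaum w' = moved g (elongatedGrunbaum w)) : WordsEquivalent w w' := by
  obtain ⟨σ, k, hσ, hk⟩ := isLayeredFamily_elongatedGrunbaum.exists_shift_sub_mem_iff h
  simp only [grunbaumShift_sub_mem_iff] at hk
  rcases hσ with rfl | rfl
  · have e : ∀ n, w n = w' (1 * n + k) := fun n => Letter.eq_of_iff (by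
      rw [eq_a_iff, eq_a_iff, hk, show 1 * (n + 1) + k = 1 * n + k + 1 by ring])
    exact ⟨1, k, Or.inl rfl, fun n m => by rw [e n, e m]⟩
  -- The letter with index `n` belongs to the pair of layers `n`, `n + 1`. A reversal makes the
  -- image of `n + 1` the lower layer of the pair, whence `k - 1` instead of `k`.
  · have e : ∀ n, w n = w' (-1 * n + (k - 1)) := fun n => Letter.eq_of_iff (by
      rw [eq_a_iff, eq_a_iff, hk, show -1 * (n + 1) + k = -1 * n + (k - 1) by ring,
        show -1 * n + k = -1 * n + (k - 1) + 1 by ring, eq_comm])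
    exact ⟨-1, k - 1, Or.inr rfl, fun n m => by rw [e n, e m]⟩

/-- Transitivity would move every layer to the next one and preserve parallelism, so all letters
would be equal. -/
theorem not_isVertexTransitive_elongatedGrunbaum {w : Word} (hw : IsProperGrunbaum w) :
    ¬ IsVertexTransitive (elongatedGrunbaum w) := by
  intro h
  have h1 : ∀ n, w n = .a ↔ w (n + 1) = .a := fun n => by
    rw [eq_a_iff, eq_a_iff, ← grunbaumShift_sub_mem_iff,
      isLayeredFamily_elongatedGrunbaum.shift_sub_mem_iff_succ h, grunbaumShift_sub_mem_iff]
  have h2 : ∀ n, w n = .a ↔ w 0 = .a := fun n => by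
    induction n using Int.induction_on with
    | zero => rfl
    | succ n ih => rw [← h1, ih]
    | pred n ih => rw [h1, sub_add_cancel, ih]
  by_cases h0 : w 0 = .a
  · exact hw.1 fun n => (h2 n).2 h0
  · refine hw.2 fun n => ?_
    have := (h2 n).not.2 h0
    revert this
    cases w n <;> simp

theorem image_constVAdd_mem_elongatedGrunbaum {w : Word} {t : Space} {p a c : ℤ}
    (hw : ∀ n, crossDir w (n + p) = crossDir w n) (ht : ∀ n b i j,
      grunbaumNode w n b i j + t = grunbaumNode w (n + p) b (i + a) (j + c)) {P : Set Space}
    (hP : P ∈ elongatedGrunbaum w) :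
    AffineIsometryEquiv.constVAdd ℝ Space t '' P ∈ elongatedGrunbaum w := by
  have hg : ∀ x u, AffineIsometryEquiv.constVAdd ℝ Space t (x + u)
      = AffineIsometryEquiv.constVAdd ℝ Space t x + LinearIsometryEquiv.refl ℝ Space u := by
    intro x u; simp [add_assoc]
  have happ : ∀ n b i j, AffineIsometryEquiv.constVAdd ℝ Space t (grunbaumNode w n b i j)
      = grunbaumNode w (n + p) b (i + a) (j + c) := fun n b i j => by
    rw [← ht]; simp [add_comm]
  have ha : ∀ n, axisDir w (n + p) = axisDir w n := fun n => axisDir_eq_of_crossDir_eq (hw n)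
  obtain ⟨n, i, j, rfl | rfl | rfl⟩ := mem_elongatedGrunbaum.1 hP
  · rw [(image_lyingPrism hg (by simp) _ _ _).1, happ, LinearIsometryEquiv.coe_refl, id, id, ← hw,
      ← ha]
    exact lyingPrism_mem ..
  · rw [(image_lyingPrism hg (by simp) _ _ _).2, happ, LinearIsometryEquiv.coe_refl, id, id, ← hw,
      ← ha]
    exact lyingPrism'_mem ..
  · rw [image_cubeAt hg (Or.inl ⟨by simp, by simp⟩) (by simp), happ]
    exact cubeAt_mem ..

theorem moved_constVAdd_elongatedGrunbaum {w : Word} {t : Space} {p a c : ℤ}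
    (hw : ∀ n, crossDir w (n + p) = crossDir w n) (ht : ∀ n b i j,
      grunbaumNode w n b i j + t = grunbaumNode w (n + p) b (i + a) (j + c)) :
    moved (AffineIsometryEquiv.constVAdd ℝ Space t) (elongatedGrunbaum w)
      = elongatedGrunbaum w := by
  refine moved_constVAdd_eq (fun P hP => image_constVAdd_mem_elongatedGrunbaum hw ht hP)
    fun P hP => image_constVAdd_mem_elongatedGrunbaum (p := -p) (a := -a) (c := -c)
      (fun n => ?_) ?_ hP
  · rw [← hw (n + -p), neg_add_cancel_right]
  · intro n b i j
    rw [← sub_eq_add_neg, sub_eq_iff_eq_add, ht]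
    simp

theorem isPeriodic_elongatedGrunbaum_iff (w : Word) :
    IsPeriodic (elongatedGrunbaum w) ↔ IsPeriodicWord w := by
  refine ⟨isLayeredFamily_elongatedGrunbaum.isPeriodicWord fun w k h n => ?_, ?_⟩
  · simp only [grunbaumShift_sub_mem_iff] at h
    exact Letter.eq_of_iff (by
      rw [eq_a_iff, eq_a_iff, h n, h (n + 1), show n + 1 + k = n + k + 1 by ring])
  rintro ⟨p, hp, hw⟩
  have ht : ∀ n, turns w (n + p) = turns w n + turns w p :=
    partialSum_add_period fun n => by rw [hw n]
  -- One period of the word may contain an odd number of quarter turns; after two periods the number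
  -- is even and the directions recur.
  have hc : ∀ n, crossDir w (n + 2 * p) = crossDir w n := fun n => by
    rw [crossDir_eq_iff, two_mul, ← add_assoc, ht, ht, add_assoc, Int.even_add]
    simp
  have hs : ∀ n, grunbaumShift w (n + 2 * p) = grunbaumShift w n := fun n => by
    rw [grunbaumShift, hc]; rfl
  refine isFrame_grunbaum.isPeriodic_of
    (t := partialSum (grunbaumShift w) (2 * p) + (((2 * p : ℤ) : ℝ) * (triHeight + 1)) • ez)
    (moved_constVAdd_elongatedGrunbaum (p := 0) (a := 1) (c := 0) (fun n => by rw [add_zero])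
      fun n b i j => ?_)
    (moved_constVAdd_elongatedGrunbaum (p := 0) (a := 0) (c := 1) (fun n => by rw [add_zero])
      fun n b i j => ?_)
    (moved_constVAdd_elongatedGrunbaum (p := 2 * p) (a := 0) (c := 0) hc fun n b i j => ?_) ?_
  · rw [add_zero n, grunbaumNode, grunbaumNode, node_add]; simp
  · rw [add_zero n, grunbaumNode, grunbaumNode, node_add]; simp
  · rw [grunbaumNode, node_add_period _ _ _ hs]; simp
  · have := triHeight_pos
    have hp' : (p : ℝ) ≠ 0 := by exact_mod_cast hp
    simp [partialSum_apply_two (grunbaumShift_apply_two w), ez_apply_two, hp]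
    positivity

theorem isPeriodicWord_of_not_isProperGrunbaum (w : Word) (hw : ¬ IsProperGrunbaum w) :
    IsPeriodicWord w := by
  rw [IsProperGrunbaum, not_and_or, not_not, not_not] at hw
  rcases hw with h | h <;> exact ⟨1, one_ne_zero, fun n => by rw [h, h]⟩

theorem isProperGrunbaum_sparseWord (p : ℤ) (hp : 3 ≤ p) : IsProperGrunbaum (sparseWord p) := by
  refine ⟨fun h => ?_, fun h => ?_⟩
  · have := h 1
    rw [sparseWord_one (by omega)] at this
    cases this
  · have := h 0
    rw [sparseWord_zero] at this
    cases this

theorem isAlmostUniform_elongatedGrunbaum {w : Word} (hw : IsProperGrunbaum w) :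
    IsAlmostUniform (elongatedGrunbaum w) :=
  ⟨isNormalPartition_elongatedGrunbaum w, fun _ => isUniformPolyhedron_of_mem_elongatedGrunbaum,
    not_isVertexTransitive_elongatedGrunbaum hw, fun _ hv _ hv' => starsCongruent_grunbaum hv hv'⟩

end LayeredTiling

/-! ### The theorem for both families -/

theorem mainTheorem3 :
    -- elongated Kelvin partitions
    (Function.Injective elongatedKelvin ∧
      (∀ w : Word, IsProperKelvin w →
        (∀ P ∈ elongatedKelvin w,
          IsRegularTetrahedron P ∨ IsRegularOctahedron P ∨ IsTriangularPrism P) ∧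
        IsAlmostUniform (elongatedKelvin w) ∧
        (∀ v ∈ vertices (elongatedKelvin w),
          {P ∈ delaunayStar (elongatedKelvin w) v | IsTriangularPrism P}.ncard = 6 ∧
          {P ∈ delaunayStar (elongatedKelvin w) v | IsRegularTetrahedron P}.ncard = 4 ∧
          {P ∈ delaunayStar (elongatedKelvin w) v | IsRegularOctahedron P}.ncard = 3) ∧
        (IsPeriodic (elongatedKelvin w) ↔ IsPeriodicWord w)) ∧
      (∀ w w' : Word, IsProperKelvin w → IsProperKelvin w' →
        ∀ v ∈ vertices (elongatedKelvin w), ∀ v' ∈ vertices (elongatedKelvin w'),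
          StarsCongruent (elongatedKelvin w) v (elongatedKelvin w') v') ∧
      Cardinal.mk ↥(congruenceClass '' (elongatedKelvin ''
        {w | IsProperKelvin w ∧ IsPeriodic (elongatedKelvin w)})) = Cardinal.aleph0 ∧
      Cardinal.mk ↥(congruenceClass '' (elongatedKelvin ''
        {w | IsProperKelvin w ∧ ¬ IsPeriodic (elongatedKelvin w)})) = Cardinal.continuum) ∧
    -- elongated Grünbaum partitions
    (Function.Injective elongatedGrunbaum ∧
      (∀ w : Word, IsProperGrunbaum w →
        (∀ P ∈ elongatedGrunbaum w, IsTriangularPrism P ∨ IsCube P) ∧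
        IsAlmostUniform (elongatedGrunbaum w) ∧
        (∀ v ∈ vertices (elongatedGrunbaum w),
          {P ∈ delaunayStar (elongatedGrunbaum w) v | IsCube P}.ncard = 4 ∧
          {P ∈ delaunayStar (elongatedGrunbaum w) v | IsTriangularPrism P}.ncard = 6) ∧
        (IsPeriodic (elongatedGrunbaum w) ↔ IsPeriodicWord w)) ∧
      (∀ w w' : Word, IsProperGrunbaum w → IsProperGrunbaum w' →
        ∀ v ∈ vertices (elongatedGrunbaum w), ∀ v' ∈ vertices (elongatedGrunbaum w'),
          StarsCongruent (elongatedGrunbaum w) v (elongatedGrunbaum w') v') ∧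
      Cardinal.mk ↥(congruenceClass '' (elongatedGrunbaum ''
        {w | IsProperGrunbaum w ∧ IsPeriodic (elongatedGrunbaum w)})) = Cardinal.aleph0 ∧
      Cardinal.mk ↥(congruenceClass '' (elongatedGrunbaum ''
        {w | IsProperGrunbaum w ∧ ¬ IsPeriodic (elongatedGrunbaum w)})) = Cardinal.continuum) := by
  exact ⟨⟨elongatedKelvin_injective,
    fun w hw => ⟨elongatedKelvin_shapes w, isAlmostUniform_elongatedKelvin hw,
      fun _ hv => ncard_kelvin_star hv, isPeriodic_elongatedKelvin_iff w⟩,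
    fun _ _ _ _ _ hv _ hv' => starsCongruent_kelvin hv hv',
    mk_congruenceClasses_periodic wordsEquivalent_of_elongatedKelvin_eq
      (fun w _ => isPeriodic_elongatedKelvin_iff w) isProperKelvin_sparseWord,
    mk_congruenceClasses_aperiodic wordsEquivalent_of_elongatedKelvin_eq
      (fun w _ => isPeriodic_elongatedKelvin_iff w) isPeriodicWord_of_not_isProperKelvin⟩,
   elongatedGrunbaum_injective,
    fun w hw => ⟨elongatedGrunbaum_shapes w, isAlmostUniform_elongatedGrunbaum hw,
      fun _ hv => ncard_grunbaum_star hv, isPeriodic_elongatedGrunbaum_iff w⟩,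
    fun _ _ _ _ _ hv _ hv' => starsCongruent_grunbaum hv hv',
    mk_congruenceClasses_periodic wordsEquivalent_of_elongatedGrunbaum_eq
      (fun w _ => isPeriodic_elongatedGrunbaum_iff w) isProperGrunbaum_sparseWord,
    mk_congruenceClasses_aperiodic wordsEquivalent_of_elongatedGrunbaum_eq
      (fun w _ => isPeriodic_elongatedGrunbaum_iff w) isPeriodicWord_of_not_isProperGrunbaum⟩
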